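/- **Setting.** Let $k\ge 4$ be even and $d\ge k$. Let $v_*\in\mathbb R^d$ be a unit vector and let $\mathbf T^{(t)}=\lambda v_*^{\otimes k}+\mathbf E^{(t)}$, $t=1,\dots,N$, where $\mathbf E^{(1)},\dots,\mathbf E^{(N)}$ are i.i.d. random tensors in $(\mathbb R^d)^{\otimes k}$ with $\mathbb E\exp\langle u,\mathbf E^{(t)}\rangle\le\exp(\sigma^2\|u\|^2)$ for every $u\in(\mathbb R^d)^{\otimes k}$ (entrywise inner product; in particular the noise has mean zero). Given constants $c_0,C_0>0$, assume $c_0\le\lambda\le C_0d^{k/4}$ and $\sigma\ge c_0$. **Algorithm (NSGA).** Let $T_1=\lfloor N/\log N\rfloor$, $\widehat R^{(t)}(W)=\langle W^{\otimes k/2},\mathbf T^{(t)}\rangle$ for $W\in\mathbb R^{d\times d}$, where $(W^{\otimes k/2})_{i_1\cdots i_k}=\prod_{l=1}^{k/2}W_{i_{2l-1}i_{2l}}$. Start from $W^{(0)}=I_d$ and for $t=0,\dots,N-1$ put, with $\eta_t=\eta_0 2^{-\lfloor t/T_1\rfloor}$, $$W^{(t+1)}=\Big(1-\frac{\eta_t(k-4)}{2\|W^{(t)}\|_{\mathrm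 F}^{k/2}}\widehat R^{(t+1)}(W^{(t)})\Big)W^{(t)}+\frac{\eta_t}{\|W^{(t)}\|_{\mathrm F}^{k/2-2}}\nabla_W\widehat R^{(t+1)}(W^{(t)}).$$ The output $\hat v$ is a unit eigenvector of $W^{(N)}+(W^{(N)})^{\top}$ for its largest eigenvalue. **Claim.** Write $L=\log(\sigma kNd/\delta)$ and $$S=\max\Big\{\frac{\log N}{k},\frac{k\,d^{k/4-1}}{\max\{k(k-4),1/\log d\}}\Big\}\cdot\frac{\lceil\log N\rceil}{\lambda N}.$$ There is $a>0$, depending only on $c_0,C_0$, such that for every $A\ge a$ there are $C_1,C_2>0$ and $p\in\mathbb N$, depending only on $c_0,C_0,A$, with the following property. Let $k,d,v_*,\lambda,\sigma$ and the noise be as above, $\delta\in(0,1)$, and suppose $$N\ge C_1\max\Big\{1,\ \Big(\max\Big\{\frac{\log N}{d^{k/4-1}},\log d\Big\}\Big)^2\cdot\frac{\sigma^2k\,L^{7/2}}{\lambda^2}\cdot d^{k/2}\Big\},\qquad aS\le\eta_0\le AS,\qquad \frac{\eta_0\lambda k}{2e}\le1 .$$ Then, with probability at least $1-\delta$, $$\min\{\|\hat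 v-v_*\|^2,\|\hat v+v_*\|^2\}\le C_2L^{p}\left(\Big(1-\frac{\eta_0\lambda k}{2e}\Big)^{\frac12\lfloor N/\log N\rfloor}\frac1{k\delta^{1/2}}+\frac{(\lambda^2k+\sigma d^2)\,d^{k/8-1/2}}{\lambda^2k\,\delta^{1/2}N}+\frac{\sigma}{\lambda\,\delta^{1/2}\sqrt N}\right).$$ -/

import Mathlib

open MeasureTheory ProbabilityTheory Matrix

noncomputable section

namespace TensorPCA

/-- Real tensors of order `k` and dimension `d`, given by their entries. -/
abbrev Tensor (k d : ℕ) : Type := (Fin k → Fin d) → ℝ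

/-- The entrywise inner product of two tensors (that is, of their flattenings). -/
def tensorInner {k d : ℕ} (S T : Tensor k d) : ℝ := ∑ I, S I * T I

/-- The outer power `v^{⊗k}` of a vector. -/
def vecPow (k : ℕ) {d : ℕ} (v : EuclideanSpace ℝ (Fin d)) : Tensor k d :=
  fun I => ∏ j, v (I j)

/-- The outer power `W^{⊗(k/2)}` of a matrix as a tensor of order `k` (for even `k`): the `l`-th
factor carries the `l`-th pair of consecutive indices. -/
def matPow (k : ℕ) {d : ℕ} (W : Matrix (Fin d) (Fin d) ℝ) : Tensor k d :=
  fun I => ∏ l : Fin (k / 2), W (I ⟨2 * l.1, by omega⟩) (I ⟨2 * l.1 + 1, by omega⟩)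

/-- The Frobenius norm. -/
def frob {d : ℕ} (W : Matrix (Fin d) (Fin d) ℝ) : ℝ := √(∑ i, ∑ j, W i j ^ 2)

/-- The reward `⟨W^{⊗(k/2)}, T⟩`. -/
def reward {k d : ℕ} (T : Tensor k d) (W : Matrix (Fin d) (Fin d) ℝ) : ℝ :=
  tensorInner (matPow k W) T

/-- The gradient of the reward at `W`: the matrix of its partial derivatives. -/
def gradReward {k d : ℕ} (T : Tensor k d) (W : Matrix (Fin d) (Fin d) ℝ) :
    Matrix (Fin d) (Fin d) ℝ :=
  Matrix.of fun i j => deriv (fun s : ℝ => reward T (W + s • Matrix.single i j (1 : ℝ))) 0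

/-- One normalized stochastic gradient ascent update with step size `η` and fresh sample `T`. -/
def nsgaStep {k d : ℕ} (η : ℝ) (T : Tensor k d) (W : Matrix (Fin d) (Fin d) ℝ) :
    Matrix (Fin d) (Fin d) ℝ :=
  (1 - η * ((k : ℝ) - 4) / (2 * frob W ^ (k / 2)) * reward T W) • W
    + (η / frob W ^ (k / 2 - 2)) • gradReward T W

/-- The phase length `T₁ = ⌊N / log N⌋`. -/
def phaseLength (N : ℕ) : ℕ := ⌊(N : ℝ) / Real.log N⌋₊

/-- The iterates `W^{(t)}` of NSGA, started at the identity. The step size is halved at each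
positive `t` divisible by `T₁`, so the update from `W^{(t)}` to `W^{(t+1)}` uses `η₀ / 2^⌊t/T₁⌋`;
it uses the `(t+1)`-st observation, which is `T t` here. -/
def nsga {k d : ℕ} (η₀ : ℝ) (N : ℕ) (T : ℕ → Tensor k d) : ℕ → Matrix (Fin d) (Fin d) ℝ
  | 0 => 1
  | t + 1 => nsgaStep (η₀ / 2 ^ (t / phaseLength N)) (T t) (nsga η₀ N T t)

/-- `v` is a unit eigenvector of `A` that belongs to its largest real eigenvalue. -/
def IsTopEigenvector {d : ℕ} (A : Matrix (Fin d) (Fin d) ℝ) (v : EuclideanSpace ℝ (Fin d)) :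
    Prop :=
  ‖v‖ = 1 ∧ ∃ ρ : ℝ, A *ᵥ WithLp.ofLp v = ρ • WithLp.ofLp v ∧
    ∀ (ν : ℝ) (w : Fin d → ℝ), w ≠ 0 → A *ᵥ w = ν • w → ν ≤ ρ

/-- `v` is a possible output of NSGA on the observations `T 0, …, T (N - 1)`. -/
def IsNSGAOutput {k d : ℕ} (η₀ : ℝ) (N : ℕ) (T : ℕ → Tensor k d)
    (v : EuclideanSpace ℝ (Fin d)) : Prop :=
  IsTopEigenvector (nsga η₀ N T N + (nsga η₀ N T N)ᵀ) v

/-- `E 0, …, E (N - 1)` are i.i.d. random tensors whose common law is sub-Gaussian with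
parameter `σ`. (The bound on the moment generating function forces mean zero.) -/
structure IsIIDSubGaussianNoise {Ω : Type*} [MeasurableSpace Ω] (μ : Measure Ω) {k d : ℕ}
    (N : ℕ) (σ : ℝ) (E : ℕ → Ω → Tensor k d) : Prop where
  measurable : ∀ t < N, Measurable (E t)
  indep : iIndepFun (fun t : Fin N => E t) μ
  ident : ∀ s < N, ∀ t < N, IdentDistrib (E s) (E t) μ μ
  integrable_exp : ∀ t < N, ∀ u : Tensor k d,
    Integrable (fun ω => Real.exp (tensorInner u (E t ω))) μ
  mgf_le : ∀ t < N, ∀ u : Tensor k d,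
    ∫ ω, Real.exp (tensorInner u (E t ω)) ∂μ ≤ Real.exp (σ ^ 2 * tensorInner u u)

/-- The observation `λ v_*^{⊗k} + E`. -/
def observation {k d : ℕ} (lam : ℝ) (vstar : EuclideanSpace ℝ (Fin d)) (E : Tensor k d) :
    Tensor k d :=
  lam • vecPow k vstar + E

/-- `log (σ k N d / δ)`. -/
def logFactor (k d N : ℕ) (σ δ : ℝ) : ℝ := Real.log (σ * k * N * d / δ)

/-- The required order of the sample size:
`max {log N / d^(k/4-1), log d}² · σ² k log^{7/2}(σkNd/δ) / λ² · d^(k/2)`. -/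
def sampleOrder (k d N : ℕ) (lam σ δ : ℝ) : ℝ :=
  (max (Real.log N / (d : ℝ) ^ ((k : ℝ) / 4 - 1)) (Real.log d)) ^ 2
    * (σ ^ 2 * k * logFactor k d N σ δ ^ (7 / 2 : ℝ) / lam ^ 2) * (d : ℝ) ^ ((k : ℝ) / 2)

/-- The order of the initial step size:
`max {log N / k, k d^(k/4-1) / max {k(k-4), 1 / log d}} · ⌈log N⌉ / (λ N)`. -/
def stepOrder (k d N : ℕ) (lam : ℝ) : ℝ :=
  max (Real.log N / k)
      ((k : ℝ) * (d : ℝ) ^ ((k : ℝ) / 4 - 1) / max ((k : ℝ) * ((k : ℝ) - 4)) (Real.log d)⁻¹)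
    * ((⌈Real.log N⌉₊ : ℝ) / (lam * N))

/-- The error rate, without the polylogarithmic factor. -/
def errorRate (k d N : ℕ) (lam σ δ η₀ : ℝ) : ℝ :=
  (1 - η₀ * lam * k / (2 * Real.exp 1)) ^ ((phaseLength N : ℝ) / 2) * (1 / (k * √δ))
    + (lam ^ 2 * k + σ * d ^ 2) * (d : ℝ) ^ ((k : ℝ) / 8 - 1 / 2) / (lam ^ 2 * k * √δ * N)
    + σ / (lam * √δ * √N)

end TensorPCA

end

/-! Put m = k/2, e = v vᵀ and s = λmη_t, and let α be the cosine between W and e. The update is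
positively homogeneous of degree one in W, so the iterates are W_t = c_t M_t with c_t > 0, where the
scale is chosen so that ⟨M_t, e⟩ would stay equal to 1 without noise (`nsgaStep_asMat`,
`exists_nsga_eq`). In this scale the signal coordinate only accumulates noise. The part orthogonal
to e is multiplied by `ratio`, which is at most 1/(1 + sα^(m-2)), and receives noise whose component
along a unit matrix pairs E with a tensor of squared norm at most 2m
(`tensorInner_noiseTensor_self_le`).

Alignment: the start I has squared norm d. If p is the accumulated contraction, then M_t has size
about ν = √(1 + d p²) and α is about 1/ν. The potential ν^(m-2) drops by at least a constant times s
per step (`potential_step`), so an accumulated step size of order d^((m-2)/2) = d^(k/4-1) is enough;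
for m = 2 the decay is geometric and order log d is enough (`decay_of_potential`). After that
√m‖perp‖ is bounded and α^m is at least the constant `cosBound`, so once the step size has been
halved every step contracts by 1 - const·s, and the second phase makes the remaining transient
exponentially small.

Noise: each noise contribution is written as an autoregressive process whose predictable
coefficients are truncated by `clip`. Such processes have sub-Gaussian tails unconditionally
(`lintegral_cosh_ar_le`), so one union bound gives an event on which all of them are small
(`exists_noise_event`). On that event a purely deterministic induction over the trajectory (`IsRun`)
shows that the truncations are never active, so no stopping times are needed.

Error: the leading eigenvector feels the perturbation Q only through Qv and Qᵀv
(`IsTopEigenvector.min_le`), that is through 2d coordinates of stationary variance of order σ²η₀/λ.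
The squared error is therefore of order dσ²η₀/λ up to logarithms and the transient. The upper bound
on η₀ and the lower bound on N turn this into σ/(λ√N), so the last term of the error rate already
dominates; the other two are only needed to be nonnegative. -/

noncomputable section
namespace TensorPCA
open scoped RealInnerProductSpace

/-- Matrices as a Euclidean space, with the Frobenius inner product. -/
abbrev MatSpace (d : ℕ) : Type := EuclideanSpace ℝ (Fin d × Fin d)

def asMat {d : ℕ} (h : MatSpace d) : Matrix (Fin d) (Fin d) ℝ := Matrix.of fun i j => h (i, j)

/-- The rank-one matrix `v wᵀ`. -/
def outer {d : ℕ} (v w : EuclideanSpace ℝ (Fin d)) : MatSpace d :=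
  WithLp.toLp 2 fun p => v p.1 * w p.2

def pairIdx {k d : ℕ} (I : Fin k → Fin d) (l : Fin (k / 2)) : Fin d × Fin d :=
  (I ⟨2 * l.1, by omega⟩, I ⟨2 * l.1 + 1, by omega⟩)

/-- The derivative of `h ↦ h^{⊗(k/2)}` at `h` in direction `u`. -/
def dPow (k : ℕ) {d : ℕ} (h u : MatSpace d) : Tensor k d :=
  fun I => ∑ l : Fin (k / 2), ∏ l', (if l' = l then u (pairIdx I l') else h (pairIdx I l'))

/-- The tensor that pairs with the noise in the component of a normalised update along `u`. -/
def noiseTensor (k : ℕ) {d : ℕ} (h u : MatSpace d) : Tensor k d :=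
  dPow k h u - ((((k / 2 : ℕ) : ℝ) - 2) * ⟪u, h⟫) • matPow k (asMat h)

/-- The direction of the noise in a normalised update. -/
def noiseDir {k d : ℕ} (h : MatSpace d) (E : Tensor k d) : MatSpace d :=
  WithLp.toLp 2 fun p => tensorInner (noiseTensor k h (EuclideanSpace.single p 1)) E

/-! ### Tensor inner products of matrix powers. -/

section Pairs
variable {k d : ℕ}

def pairEquiv (hk : Even k) : Fin (k / 2) × Fin 2 ≃ Fin k :=
  finProdFinEquiv.trans (finCongr (Nat.div_mul_cancel hk.two_dvd))

theorem pairEquiv_zero (hk : Even k) (l : Fin (k / 2)) :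
    pairEquiv hk (l, 0) = ⟨2 * l.1, by omega⟩ := by
  ext; simp [pairEquiv]

theorem pairEquiv_one (hk : Even k) (l : Fin (k / 2)) :
    pairEquiv hk (l, 1) = ⟨2 * l.1 + 1, by omega⟩ := by
  ext; simp [pairEquiv]; omega

theorem prod_eq_prod_pairs (hk : Even k) (f : Fin k → ℝ) :
    ∏ j, f j = ∏ l : Fin (k / 2), f ⟨2 * l.1, by omega⟩ * f ⟨2 * l.1 + 1, by omega⟩ := by
  rw [← (pairEquiv hk).prod_comp, Fintype.prod_prod_type]
  refine Finset.prod_congr rfl fun l _ => ?_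
  rw [Fin.prod_univ_two, pairEquiv_zero, pairEquiv_one]

/-- A multi-index of even length is the same as a word of k/2 matrix positions; this is what makes
sums over tensor entries factor. -/
theorem pairIdx_bijective (hk : Even k) :
    Function.Bijective (fun I : Fin k → Fin d => pairIdx I) := by
  constructor
  · intro I J hIJ
    funext j
    obtain ⟨⟨l, b⟩, rfl⟩ := (pairEquiv hk).surjective j
    have h := congrFun hIJ l
    simp only [pairIdx, Prod.mk.injEq] at h
    fin_cases b
    · simpa [pairEquiv_zero] using h.1
    · simpa [pairEquiv_one] using h.2
  · intro f
    refine ⟨fun j => if ((pairEquiv hk).symm j).2 = 0 then (f ((pairEquiv hk).symm j).1).1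
      else (f ((pairEquiv hk).symm j).1).2, ?_⟩
    funext l
    simp only [pairIdx, ← pairEquiv_zero hk, ← pairEquiv_one hk, Equiv.symm_apply_apply]
    simp

theorem sum_prod_pairs (hk : Even k) (A : Fin (k / 2) → Fin d × Fin d → ℝ) :
    ∑ I : Fin k → Fin d, ∏ l, A l (pairIdx I l) = ∏ l, ∑ p, A l p := by
  rw [Finset.prod_univ_sum, Fintype.piFinset_univ]
  exact Fintype.sum_bijective _ (pairIdx_bijective hk) _ _ fun I => rfl

theorem inner_eq_sum (x y : MatSpace d) : ⟪x, y⟫ = ∑ p, x p * y p := by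
  simp [PiLp.inner_apply, mul_comm]

theorem matPow_asMat (h : MatSpace d) (I : Fin k → Fin d) :
    matPow k (asMat h) I = ∏ l, h (pairIdx I l) := rfl

theorem vecPow_eq (hk : Even k) (v : EuclideanSpace ℝ (Fin d)) (I : Fin k → Fin d) :
    vecPow k v I = ∏ l, outer v v (pairIdx I l) := by
  rw [vecPow, prod_eq_prod_pairs hk]; rfl

/-- Summing over each index pair separately turns the tensor pairing into a product of Frobenius
inner products. All tensor computations below are instances of this. -/
theorem prod_pow_inner (hk : Even k) (A B : Fin (k / 2) → MatSpace d) :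
    ∑ I : Fin k → Fin d, (∏ l, A l (pairIdx I l)) * ∏ l, B l (pairIdx I l)
      = ∏ l, ⟪A l, B l⟫ := by
  simp only [← Finset.prod_mul_distrib, inner_eq_sum]
  exact sum_prod_pairs hk fun l p => A l p * B l p

theorem tensorInner_matPow (hk : Even k) (h g : MatSpace d) :
    tensorInner (matPow k (asMat h)) (fun I => ∏ l, g (pairIdx I l)) = ⟪h, g⟫ ^ (k / 2) := by
  simpa [tensorInner, matPow_asMat] using prod_pow_inner hk (fun _ => h) (fun _ => g)

theorem dPow_eq (h u : MatSpace d) (I : Fin k → Fin d) :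
    dPow k h u I = ∑ l : Fin (k / 2), ∏ l', (if l' = l then u else h) (pairIdx I l') := by
  refine Finset.sum_congr rfl fun l _ => Finset.prod_congr rfl fun l' _ => ?_
  split_ifs <;> rfl

theorem prod_ite_pow {n : ℕ} (l : Fin n) (a b : ℝ) :
    ∏ l', (if l' = l then a else b) = a * b ^ (n - 1) := by
  rw [Finset.prod_ite, Finset.prod_const, Finset.prod_const]
  simp [Finset.filter_eq', Finset.filter_ne', Finset.card_erase_of_mem]

theorem tensorInner_dPow (hk : Even k) (h u g : MatSpace d) :
    tensorInner (dPow k h u) (fun I => ∏ l, g (pairIdx I l))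
      = (k / 2 : ℕ) * (⟪u, g⟫ * ⟪h, g⟫ ^ (k / 2 - 1)) := by
  simp only [tensorInner, dPow_eq, Finset.sum_mul]
  rw [Finset.sum_comm]
  have : ∀ l : Fin (k / 2), ∑ I : Fin k → Fin d,
      (∏ l', (if l' = l then u else h) (pairIdx I l')) * ∏ l, g (pairIdx I l)
        = ⟪u, g⟫ * ⟪h, g⟫ ^ (k / 2 - 1) := by
    intro l
    rw [prod_pow_inner hk (fun l' => if l' = l then u else h) (fun _ => g), ← prod_ite_pow l]
    refine Finset.prod_congr rfl fun l' _ => ?_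
    split_ifs <;> rfl
  simp [this]

/-- Expanding the square over the slot that carries u: the m diagonal pairs give ‖u‖² and the m(m-1)
others give ⟨u,h⟩². -/
theorem tensorInner_dPow_self (hk : Even k) (h u : MatSpace d) (hh : ‖h‖ = 1) :
    tensorInner (dPow k h u) (dPow k h u)
      = (k / 2 : ℕ) * (‖u‖ ^ 2 + ((k / 2 : ℕ) - 1) * ⟪u, h⟫ ^ 2) := by
  have hone : ⟪h, h⟫ = 1 := by rw [real_inner_self_eq_norm_sq, hh, one_pow]
  have key : ∀ l₁ l₂ : Fin (k / 2), ∑ I : Fin k → Fin d,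
      (∏ l', (if l' = l₁ then u else h) (pairIdx I l'))
        * (∏ l', (if l' = l₂ then u else h) (pairIdx I l'))
      = if l₁ = l₂ then ‖u‖ ^ 2 else ⟪u, h⟫ ^ 2 := by
    intro l₁ l₂
    rw [prod_pow_inner hk (fun l' => if l' = l₁ then u else h) (fun l' => if l' = l₂ then u else h)]
    split_ifs with hl
    · subst hl
      have : ∀ l' : Fin (k / 2), ⟪if l' = l₁ then u else h, if l' = l₁ then u else h⟫
          = if l' = l₁ then ‖u‖ ^ 2 else 1 := by
        intro l'; split_ifs
        · exact real_inner_self_eq_norm_sq u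
        · exact hone
      simp only [this, prod_ite_pow, one_pow, mul_one]
    · have : ∀ l' : Fin (k / 2), ⟪if l' = l₁ then u else h, if l' = l₂ then u else h⟫
          = (if l' = l₁ then ⟪u, h⟫ else 1) * (if l' = l₂ then ⟪u, h⟫ else 1) := by
        intro l'
        split_ifs with h1 h2
        · exact absurd (h1.symm.trans h2) hl
        · simp
        · simp [real_inner_comm]
        · rw [hone, one_mul]
      simp only [this, Finset.prod_mul_distrib, prod_ite_pow, one_pow, mul_one]
      ring
  have : tensorInner (dPow k h u) (dPow k h u)
      = ∑ l₁ : Fin (k / 2), ∑ l₂ : Fin (k / 2), if l₁ = l₂ then ‖u‖ ^ 2 else ⟪u, h⟫ ^ 2 := by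
    simp only [tensorInner, dPow_eq, Finset.sum_mul_sum]
    rw [Finset.sum_comm]
    refine Finset.sum_congr rfl fun l₁ _ => ?_
    rw [Finset.sum_comm]
    exact Finset.sum_congr rfl fun l₂ _ => key l₁ l₂
  rw [this]
  have h2 : ∀ l₁ l₂ : Fin (k / 2), (if l₁ = l₂ then ‖u‖ ^ 2 else ⟪u, h⟫ ^ 2)
      = (if l₁ = l₂ then ‖u‖ ^ 2 - ⟪u, h⟫ ^ 2 else 0) + ⟪u, h⟫ ^ 2 := by
    intro l₁ l₂; split_ifs <;> ring
  simp only [h2, Finset.sum_add_distrib, Finset.sum_ite_eq, Finset.mem_univ, if_true,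
    Finset.sum_const, Finset.card_univ, Fintype.card_fin, nsmul_eq_mul]
  ring

theorem tensorInner_comm (S T : Tensor k d) : tensorInner S T = tensorInner T S := by
  simp [tensorInner, mul_comm]

theorem tensorInner_sub_left (S S' T : Tensor k d) :
    tensorInner (S - S') T = tensorInner S T - tensorInner S' T := by
  simp [tensorInner, sub_mul, Finset.sum_sub_distrib]

theorem tensorInner_smul_left (c : ℝ) (S T : Tensor k d) :
    tensorInner (c • S) T = c * tensorInner S T := by
  simp [tensorInner, mul_assoc, Finset.mul_sum]

theorem tensorInner_add_right (S T T' : Tensor k d) :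
    tensorInner S (T + T') = tensorInner S T + tensorInner S T' := by
  simp [tensorInner, mul_add, Finset.sum_add_distrib]

theorem tensorInner_smul_right (c : ℝ) (S T : Tensor k d) :
    tensorInner S (c • T) = c * tensorInner S T := by
  rw [tensorInner_comm, tensorInner_smul_left, tensorInner_comm]

/-- The squared norm is exactly m‖u‖² + (4 - m)⟨u,h⟩². The normalisation term cancels most of the
radial part, which alone would contribute m²; without it the variance proxy would be quadratic in m.
-/
theorem tensorInner_noiseTensor_self_le (hk : Even k) (hk4 : 4 ≤ k) (h u : MatSpace d)
    (hh : ‖h‖ = 1) :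
    tensorInner (noiseTensor k h u) (noiseTensor k h u) ≤ 2 * (k / 2 : ℕ) * ‖u‖ ^ 2 := by
  have hone : ⟪h, h⟫ = 1 := by rw [real_inner_self_eq_norm_sq, hh, one_pow]
  have e1 := tensorInner_dPow_self hk h u hh
  have e2 : tensorInner (dPow k h u) (matPow k (asMat h)) = (k / 2 : ℕ) * ⟪u, h⟫ := by
    have := tensorInner_dPow hk h u h
    rw [hone, one_pow, mul_one] at this
    exact this
  have e3 : tensorInner (matPow k (asMat h)) (matPow k (asMat h)) = 1 := by
    have := tensorInner_matPow hk h h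
    rw [hone, one_pow] at this
    exact this
  have hm : (2 : ℝ) ≤ (k / 2 : ℕ) := by exact_mod_cast (by omega : 2 ≤ k / 2)
  set m : ℝ := ((k / 2 : ℕ) : ℝ)
  have hc : ⟪u, h⟫ ^ 2 ≤ ‖u‖ ^ 2 := by
    have := abs_real_inner_le_norm u h
    rw [hh, mul_one] at this
    exact sq_le_sq' (by linarith [neg_abs_le ⟪u, h⟫]) ((le_abs_self _).trans this)
  have : tensorInner (noiseTensor k h u) (noiseTensor k h u)
      = m * ‖u‖ ^ 2 + (4 - m) * ⟪u, h⟫ ^ 2 := by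
    rw [noiseTensor, tensorInner_sub_left, tensorInner_comm (dPow k h u), tensorInner_sub_left,
      tensorInner_smul_left, tensorInner_smul_left, tensorInner_comm _ (_ - _),
      tensorInner_sub_left, tensorInner_smul_left, e1, tensorInner_comm (matPow k _), e2, e3]
    ring
  rw [this]
  nlinarith [sq_nonneg ⟪u, h⟫]

end Pairs

/-! ### Linearity of the noise, homogeneity, and the gradient of the reward. -/

section Linear
variable {k d : ℕ}

theorem dPow_add (h u u' : MatSpace d) : dPow k h (u + u') = dPow k h u + dPow k h u' := by
  funext I
  simp only [dPow, Pi.add_apply, ← Finset.sum_add_distrib]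
  refine Finset.sum_congr rfl fun l _ => ?_
  simp only [Finset.prod_ite, Finset.filter_eq', Finset.mem_univ, if_true, Finset.prod_singleton,
    PiLp.add_apply]
  ring

theorem dPow_smul (h u : MatSpace d) (c : ℝ) : dPow k h (c • u) = c • dPow k h u := by
  funext I
  simp only [dPow, Pi.smul_apply, smul_eq_mul, Finset.mul_sum]
  refine Finset.sum_congr rfl fun l _ => ?_
  simp only [Finset.prod_ite, Finset.filter_eq', Finset.mem_univ, if_true, Finset.prod_singleton,
    PiLp.smul_apply, smul_eq_mul]
  ring

/-- `u ↦ ⟨noiseTensor h u, E⟩` as a linear functional. -/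
def noiseFunctional (h : MatSpace d) (E : Tensor k d) : MatSpace d →ₗ[ℝ] ℝ where
  toFun u := tensorInner (noiseTensor k h u) E
  map_add' u u' := by
    simp only [noiseTensor, dPow_add, inner_add_left, tensorInner_sub_left, tensorInner_smul_left]
    rw [tensorInner_comm (_ + _), tensorInner_add_right, tensorInner_comm E, tensorInner_comm E]
    ring
  map_smul' c u := by
    simp only [noiseTensor, dPow_smul, inner_smul_left, tensorInner_sub_left,
      tensorInner_smul_left, RingHom.id_apply, smul_eq_mul, conj_trivial]
    ring

/-- Every component of the noise direction is linear in E with an explicit coefficient tensor, so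
the moment bound of the noise applies to it directly. -/
theorem inner_noiseDir (h u : MatSpace d) (E : Tensor k d) :
    ⟪noiseDir h E, u⟫ = tensorInner (noiseTensor k h u) E := by
  have hu : u = ∑ p, u p • EuclideanSpace.single p (1 : ℝ) := by
    ext p
    simp [Pi.single_apply]
  have h1 : tensorInner (noiseTensor k h u) E = noiseFunctional h E u := rfl
  rw [h1]
  conv_rhs => rw [hu]
  rw [map_sum, inner_eq_sum]
  refine Finset.sum_congr rfl fun p _ => ?_
  rw [map_smul, smul_eq_mul, mul_comm]
  rfl

theorem frob_asMat (h : MatSpace d) : frob (asMat h) = ‖h‖ := by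
  rw [frob, EuclideanSpace.norm_eq, Fintype.sum_prod_type]
  simp [asMat]

theorem matPow_smul (c : ℝ) (h : MatSpace d) :
    matPow k (asMat (c • h)) = c ^ (k / 2) • matPow k (asMat h) := by
  funext I
  simp [matPow_asMat, Finset.prod_mul_distrib]

theorem dPow_smul_left (c : ℝ) (h u : MatSpace d) :
    dPow k (c • h) u = c ^ (k / 2 - 1) • dPow k h u := by
  funext I
  simp only [dPow, Pi.smul_apply, smul_eq_mul, Finset.mul_sum]
  refine Finset.sum_congr rfl fun l _ => ?_
  simp only [Finset.prod_ite, Finset.filter_eq', Finset.filter_ne', Finset.mem_univ, if_true,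
    Finset.prod_singleton, PiLp.smul_apply, smul_eq_mul, Finset.prod_mul_distrib,
    Finset.prod_const, Finset.card_erase_of_mem, Finset.card_univ, Fintype.card_fin]
  ring

theorem gradReward_apply (h : MatSpace d) (T : Tensor k d) (i j : Fin d) :
    gradReward T (asMat h) i j = tensorInner (dPow k h (EuclideanSpace.single (i, j) 1)) T := by
  have hd : ∀ I : Fin k → Fin d, HasDerivAt
      (fun s : ℝ => matPow k (asMat h + s • Matrix.single i j (1 : ℝ)) I)
      (dPow k h (EuclideanSpace.single (i, j) 1) I) 0 := by
    intro I
    have h1 : ∀ l ∈ (Finset.univ : Finset (Fin (k / 2))), HasDerivAt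
        (fun s : ℝ => (asMat h + s • Matrix.single i j (1 : ℝ)) (pairIdx I l).1 (pairIdx I l).2)
        ((EuclideanSpace.single (i, j) (1 : ℝ) : MatSpace d) (pairIdx I l)) 0 := by
      intro l _
      have h2 : (EuclideanSpace.single (i, j) (1 : ℝ) : MatSpace d) (pairIdx I l)
          = Matrix.single i j (1 : ℝ) (pairIdx I l).1 (pairIdx I l).2 := by
        rw [PiLp.single_apply, Matrix.single_apply]
        congr 1
        rw [Prod.ext_iff]
        simp [eq_comm]
      rw [h2]
      simp only [Matrix.add_apply, Matrix.smul_apply, smul_eq_mul]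
      simpa using ((hasDerivAt_id (0 : ℝ)).mul_const
        (Matrix.single i j (1 : ℝ) (pairIdx I l).1 (pairIdx I l).2)).const_add
        (asMat h (pairIdx I l).1 (pairIdx I l).2)
    have h3 := HasDerivAt.fun_finsetProd h1
    refine h3.congr_deriv ?_
    rw [dPow]
    refine Finset.sum_congr rfl fun l _ => ?_
    simp only [Finset.prod_ite, Finset.filter_eq', Finset.filter_ne', Finset.mem_univ, if_true,
      Finset.prod_singleton, zero_smul, add_zero, smul_eq_mul]
    rw [mul_comm]
    rfl
  have h4 : HasDerivAt (fun s : ℝ => reward T (asMat h + s • Matrix.single i j (1 : ℝ)))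
      (tensorInner (dPow k h (EuclideanSpace.single (i, j) 1)) T) 0 :=
    HasDerivAt.fun_sum fun I _ => (hd I).mul_const (T I)
  exact h4.deriv

end Linear

/-! ### One update in signal-normalised coordinates. -/

section Step

/-- The factor by which the part of the iterate orthogonal to the signal is multiplied. -/
def shrink (m : ℕ) (s α : ℝ) : ℝ := 1 - s * (1 - 2 / m) * α ^ m

/-- The factor by which the signal part of the iterate is multiplied. -/
def growth (m : ℕ) (s α : ℝ) : ℝ := shrink m s α + s * α ^ (m - 2)

/-- The contraction factor of the orthogonal part relative to the signal part. -/
def ratio (m : ℕ) (s α : ℝ) : ℝ := shrink m s α / growth m s α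

variable {H : Type*} [NormedAddCommGroup H] [InnerProductSpace ℝ H]

def cosine (e M : H) : ℝ := ⟪M, e⟫ / ‖M‖

/-- The step of the iteration after rescaling so that the noiseless signal part is constant. -/
def normStep (m : ℕ) (s η : ℝ) (e M X : H) : H :=
  ratio m s (cosine e M) • M + ((1 - ratio m s (cosine e M)) * ⟪M, e⟫) • e
    + (η * ‖M‖ / growth m s (cosine e M)) • X

theorem growth_smul_normStep {m : ℕ} {s η : ℝ} {e M X : H}
    (hg : growth m s (cosine e M) ≠ 0) :
    growth m s (cosine e M) • normStep m s η e M X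
      = shrink m s (cosine e M) • M + (s * cosine e M ^ (m - 2) * ⟪M, e⟫) • e
        + (η * ‖M‖) • X := by
  have h1 : growth m s (cosine e M) * ratio m s (cosine e M) = shrink m s (cosine e M) :=
    mul_div_cancel₀ _ hg
  have h2 : growth m s (cosine e M) * ((1 - ratio m s (cosine e M)) * ⟪M, e⟫)
      = s * cosine e M ^ (m - 2) * ⟪M, e⟫ := by
    rw [← mul_assoc, mul_sub, h1, mul_one, growth]; ring
  have h3 : growth m s (cosine e M) * (η * ‖M‖ / growth m s (cosine e M)) = η * ‖M‖ :=
    mul_div_cancel₀ _ hg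
  rw [normStep, smul_add, smul_add, smul_smul, smul_smul, smul_smul, h1, h2, h3]

/-- Homogeneity: the reward has degree m and is divided by ‖W‖^m, the gradient has degree m - 1 and
is divided by ‖W‖^(m-2). Hence the scale c passes through the step, and the noiseless growth of the
signal coordinate can be split off as a scalar. -/
theorem nsgaStep_asMat {k d : ℕ} (hk : Even k) (hk4 : 4 ≤ k) (η lam c : ℝ)
    (v : EuclideanSpace ℝ (Fin d)) (E : Tensor k d) (M : MatSpace d) (hM : M ≠ 0) (hc : 0 < c)
    (hg : growth (k / 2) (η * lam * (k / 2 : ℕ)) (cosine (outer v v) M) ≠ 0) :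
    nsgaStep η (observation lam v E) (asMat (c • M))
      = asMat ((c * growth (k / 2) (η * lam * (k / 2 : ℕ)) (cosine (outer v v) M)) •
        normStep (k / 2) (η * lam * (k / 2 : ℕ)) η (outer v v) M (noiseDir (‖M‖⁻¹ • M) E)) := by
  obtain ⟨m, rfl⟩ := hk
  obtain ⟨n, rfl⟩ : ∃ n, m = n + 2 := ⟨m - 2, by omega⟩
  have hk2 : (n + 2 + (n + 2)) / 2 = n + 2 := by omega
  have hF : 0 < ‖M‖ := norm_pos_iff.2 hM
  set F := ‖M‖
  set h : MatSpace d := F⁻¹ • M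
  set e := outer v v
  have hMh : M = F • h := by simp [h, smul_smul, hF.ne']
  set α := cosine e M
  have hα : ⟪h, e⟫ = α := by
    simp only [h, α, cosine, inner_smul_left, conj_trivial, F]; ring
  have hρ : ⟪M, e⟫ = F * α := by rw [hMh, inner_smul_left, hα, conj_trivial]
  have hcM : c • M = (c * F) • h := by rw [hMh, smul_smul]
  have hvec : vecPow (n + 2 + (n + 2)) v = fun I => ∏ l, e (pairIdx I l) :=
    funext fun I => vecPow_eq ⟨n + 2, rfl⟩ v I
  ext i j
  have hE : (asMat ((c * F) • h)) i j = c * F * h (i, j) := by simp [asMat]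
  rw [hcM, nsgaStep, Matrix.add_apply, Matrix.smul_apply, Matrix.smul_apply, gradReward_apply,
    frob_asMat, reward, observation, matPow_smul, dPow_smul_left, norm_smul]
  have hnh : ‖h‖ = 1 := by
    rw [norm_smul, norm_inv, norm_norm]; exact inv_mul_cancel₀ hF.ne'
  rw [hnh, tensorInner_add_right, tensorInner_add_right, tensorInner_smul_right,
    tensorInner_smul_right]
  simp only [tensorInner_smul_left]
  rw [hvec, tensorInner_matPow ⟨n + 2, rfl⟩, tensorInner_dPow ⟨n + 2, rfl⟩, hα, hE]
  have hgM := growth_smul_normStep (η := η) (X := noiseDir h E) hg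
  rw [← smul_smul, hgM]
  have hD : (noiseDir h E) (i, j)
      = tensorInner (dPow (n + 2 + (n + 2)) h (EuclideanSpace.single (i, j) 1)) E
        - (((n + 2 : ℕ) : ℝ) - 2) * h (i, j)
          * tensorInner (matPow (n + 2 + (n + 2)) (asMat h)) E := by
    simp only [noiseDir, noiseTensor]
    rw [tensorInner_sub_left, tensorInner_smul_left, EuclideanSpace.inner_single_left, hk2]
    simp
  have hRHS : ∀ (a b g : ℝ) (x y z : MatSpace d),
      asMat (c • (a • x + b • y + g • z)) i j
        = c * (a * x (i, j) + b * y (i, j) + g * z (i, j)) := by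
    intros; simp [asMat]; ring
  rw [hRHS, hD, hρ, EuclideanSpace.inner_single_left]
  have hMij : M (i, j) = F * h (i, j) := by
    conv_lhs => rw [hMh]
    simp
  rw [hMij, shrink]
  generalize tensorInner (dPow (n + 2 + (n + 2)) h (EuclideanSpace.single (i, j) 1)) E = a
  generalize tensorInner (matPow (n + 2 + (n + 2)) (asMat h)) E = b
  generalize e (i, j) = y
  generalize h (i, j) = x
  simp only [hk2, Nat.add_sub_cancel, show n + 2 - 1 = n + 1 from rfl, smul_eq_mul, map_one,
    one_mul, norm_mul, Real.norm_eq_abs, abs_of_pos hc, abs_of_pos hF, mul_one]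
  push_cast
  have hc' := hc.ne'
  have hF' := hF.ne'
  have hn : (n : ℝ) + 2 ≠ 0 := by positivity
  field_simp
  ring

end Step
end TensorPCA
end
-- Scalar bounds for the contraction factors.
noncomputable section
namespace TensorPCA
open scoped RealInnerProductSpace

section Scalars
variable {m : ℕ} {s α : ℝ}

theorem one_sub_two_div_nonneg (hm : 2 ≤ m) : (0 : ℝ) ≤ 1 - 2 / m := by
  have : (2 : ℝ) ≤ m := by exact_mod_cast hm
  rw [sub_nonneg, div_le_one (by linarith)]
  exact this

theorem one_sub_two_div_le (m : ℕ) : 1 - 2 / (m : ℝ) ≤ 1 := by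
  have : (0 : ℝ) ≤ 2 / m := by positivity
  linarith

theorem pow_le_pow_sub_two (hα : 0 ≤ α) (hα1 : α ≤ 1) : α ^ m ≤ α ^ (m - 2) :=
  pow_le_pow_of_le_one hα hα1 (Nat.sub_le m 2)

/-- The gain sα^(m-2) beats the normalisation loss s(1 - 2/m)α^m because α ≤ 1. So dividing by
`growth` never amplifies the noise. -/
theorem growth_ge_one (hs : 0 ≤ s) (hα : 0 ≤ α) (hα1 : α ≤ 1) :
    1 ≤ growth m s α := by
  have h1 := pow_le_pow_sub_two (m := m) hα hα1
  have h2 : s * (1 - 2 / m) * α ^ m ≤ s * α ^ m := by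
    have : 0 ≤ s * α ^ m := by positivity
    nlinarith [one_sub_two_div_le m]
  have h3 : s * α ^ m ≤ s * α ^ (m - 2) := by gcongr
  rw [growth, shrink]; linarith

theorem shrink_le_one (hm : 2 ≤ m) (hs : 0 ≤ s) (hα : 0 ≤ α) : shrink m s α ≤ 1 := by
  have := mul_nonneg (mul_nonneg hs (one_sub_two_div_nonneg hm)) (pow_nonneg hα m)
  rw [shrink]; linarith

theorem ratio_le (hm : 2 ≤ m) (hs : 0 ≤ s) (hα : 0 ≤ α) (hα1 : α ≤ 1) :
    ratio m s α ≤ 1 / (1 + s * α ^ (m - 2)) := by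
  have hg := growth_ge_one (m := m) hs hα hα1
  have hx : 0 ≤ s * α ^ (m - 2) := by positivity
  rw [ratio, div_le_div_iff₀ (by linarith) (by linarith), growth]
  nlinarith [shrink_le_one hm hs hα]

theorem ratio_nonneg (hs : 0 ≤ s) (hα : 0 ≤ α) (hα1 : α ≤ 1)
    (h0 : 0 ≤ shrink m s α) : 0 ≤ ratio m s α :=
  div_nonneg h0 (zero_le_one.trans (growth_ge_one hs hα hα1))

/-- The step parameter s may be larger than 1, in which case the orthogonal part can overshoot and
change sign; the overshoot is at most s - 1. -/
theorem abs_ratio_le_of_shrink_neg (hs : 0 ≤ s) (hα : 0 ≤ α) (hα1 : α ≤ 1)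
    (h0 : shrink m s α < 0) : |ratio m s α| ≤ s - 1 := by
  have hg := growth_ge_one (m := m) hs hα hα1
  rw [ratio, abs_div, abs_of_neg h0, abs_of_pos (by linarith)]
  refine (div_le_self (by linarith) hg).trans ?_
  have h1 : s * (1 - 2 / m) * α ^ m ≤ s * 1 * 1 := by
    have := pow_le_one₀ (n := m) hα hα1
    have h2 := one_sub_two_div_le m
    have h3 : s * (1 - 2 / m) * α ^ m ≤ s * 1 * α ^ m := by gcongr
    exact h3.trans (by gcongr)
  rw [shrink]; linarith

theorem shrink_ge_half (hs : 0 ≤ s) (hα : 0 ≤ α) (h : s * α ^ m ≤ 1 / 2) :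
    1 / 2 ≤ shrink m s α := by
  have h2 : s * (1 - 2 / m) * α ^ m ≤ s * α ^ m := by
    have : 0 ≤ s * α ^ m := by positivity
    nlinarith [one_sub_two_div_le m]
  rw [shrink]; linarith

/-- The numerator is at least 1/2 and `growth` is at most 1 + 3. -/
theorem ratio_ge (hm : 2 ≤ m) (hs : 0 ≤ s) (hs3 : s ≤ 3) (hα : 0 ≤ α) (hα1 : α ≤ 1)
    (h : s * α ^ m ≤ 1 / 2) : 1 / 8 ≤ ratio m s α := by
  have h1 := shrink_ge_half hs hα h
  have h2 : growth m s α ≤ 4 := by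
    have h3 := shrink_le_one hm hs hα
    have h4 : s * α ^ (m - 2) ≤ 3 * 1 := by
      have := pow_le_one₀ (n := m - 2) hα hα1
      gcongr
    rw [growth]; linarith
  have hg := growth_ge_one (m := m) hs hα hα1
  rw [ratio, div_le_div_iff₀ (by norm_num) (by linarith)]
  linarith

end Scalars

/-! ### A potential for the time needed to align. -/

section Potential

theorem one_div_one_add_le_exp {θ : ℝ} (h0 : 0 ≤ θ) (h : θ ≤ 3 / 2) :
    1 / (1 + θ) ≤ Real.exp (-(θ / 3)) := by
  have h1 : 1 / (1 + θ) = -(θ / (1 + θ)) + 1 := by field_simp; ring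
  rw [h1]
  refine (Real.add_one_le_exp _).trans (Real.exp_le_exp.2 ?_)
  rw [neg_le_neg_iff]
  exact div_le_div_of_nonneg_left h0 (by linarith) (by linarith)

/-- Let x = Dp² and let ψ = (1 + x)^((m-2)/2) be the potential. A contraction of p at rate s/(2ψ)
lowers ψ by a fraction of order s/ψ, hence by an amount of order s that does not depend on ψ. The
condition mx ≥ 1 makes x at least a fraction 1/(m+1) of 1 + x, and the exponent m - 2 makes up for
this factor. -/
theorem potential_step {m : ℕ} (hm : 3 ≤ m) {D s p p' : ℝ} (hD : 0 ≤ D) (hs : 0 ≤ s)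
    (hs3 : s ≤ 3) (hp' : 0 ≤ p')
    (hle : p' ≤ p / (1 + s / (2 * √(1 + D * p ^ 2) ^ (m - 2))))
    (hx : 1 ≤ m * (D * p ^ 2)) :
    √(1 + D * p' ^ 2) ^ (m - 2) + s / 67 ≤ √(1 + D * p ^ 2) ^ (m - 2) := by
  have hx0 : 0 ≤ D * p ^ 2 := by positivity
  set x := D * p ^ 2 with hxdef
  set ψ := √(1 + x) ^ (m - 2) with hψ
  have hν1 : 1 ≤ √(1 + x) := by rw [Real.one_le_sqrt]; linarith
  have hψ1 : 1 ≤ ψ := one_le_pow₀ hν1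
  set θ := s / (2 * ψ) with hθ
  have hθ0 : 0 ≤ θ := by positivity
  have hθ1 : θ ≤ 3 / 2 := by
    rw [hθ, div_le_iff₀ (by linarith)]; nlinarith
  have hm3 : (3 : ℝ) ≤ m := by exact_mod_cast hm
  -- The relative decrease of 1 + x: the square of the contraction removes at least θ/4 of x, and
  -- x/(1 + x) ≥ 1/(m + 1).
  set y := θ / (4 * (m + 1)) with hy
  have hx' : D * p' ^ 2 ≤ x / (1 + θ) ^ 2 := by
    have : p' ^ 2 ≤ (p / (1 + θ)) ^ 2 := by gcongr
    calc D * p' ^ 2 ≤ D * (p / (1 + θ)) ^ 2 := by gcongr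
      _ = x / (1 + θ) ^ 2 := by rw [hxdef]; field_simp
  have hy0 : 0 ≤ y := by positivity
  have h1 : 1 + D * p' ^ 2 ≤ (1 + x) * (1 - y) := by
    have h2 : θ / 4 ≤ 1 - 1 / (1 + θ) ^ 2 := by
      rw [le_sub_iff_add_le, ← le_sub_iff_add_le', div_le_iff₀ (by positivity)]
      nlinarith [mul_nonneg hθ0 (sub_nonneg.2 hθ1), mul_nonneg hθ0 hθ0,
        mul_nonneg (mul_nonneg hθ0 hθ0) (sub_nonneg.2 hθ1)]
    have h3 : (1 + x) * y ≤ x * (θ / 4) := by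
      rw [hy, ← mul_div_assoc, div_le_iff₀ (by positivity)]
      nlinarith
    have h4 : x / (1 + θ) ^ 2 = x * (1 / (1 + θ) ^ 2) := by ring
    rw [h4] at hx'
    nlinarith
  have h5 : √(1 + D * p' ^ 2) ≤ √(1 + x) * Real.exp (-(y / 2)) := by
    rw [Real.sqrt_le_left (by positivity), mul_pow, Real.sq_sqrt (by linarith), ← Real.exp_nat_mul]
    refine h1.trans ?_
    gcongr
    have := Real.add_one_le_exp (-y)
    have e : ((2 : ℕ) : ℝ) * -(y / 2) = -y := by push_cast; ring
    rw [e]; linarith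
  -- This is θ/32, by (m - 2)/(8(m + 1)) ≥ 1/32 for m ≥ 3. Since z ≤ 3/64, the drop zψ/(1 + z) is at
  -- least (s/64)/(67/64) = s/67.
  set z := s / (64 * ψ) with hz
  have hz0 : 0 ≤ z := by positivity
  have h6 : √(1 + D * p' ^ 2) ^ (m - 2) ≤ ψ * Real.exp (-z) := by
    refine (pow_le_pow_left₀ (Real.sqrt_nonneg _) h5 _).trans ?_
    rw [mul_pow, ← Real.exp_nat_mul]
    gcongr
    rw [Nat.cast_sub (by omega), Nat.cast_ofNat, mul_neg, neg_le_neg_iff]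
    have e1 : z = θ * (1 / 32) := by rw [hz, hθ]; field_simp; ring
    have e2 : ((m : ℝ) - 2) * (y / 2) = θ * ((m - 2) / (8 * (m + 1))) := by
      rw [hy]; field_simp; ring
    rw [e1, e2]
    refine mul_le_mul_of_nonneg_left ?_ hθ0
    rw [div_le_div_iff₀ (by norm_num) (by positivity)]
    linarith
  have h7 : ψ * Real.exp (-z) ≤ ψ / (1 + z) := by
    rw [Real.exp_neg, div_eq_mul_inv]
    have := Real.add_one_le_exp z
    gcongr
    linarith
  have h8 : ψ / (1 + z) + s / 67 ≤ ψ := by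
    have hzψ : z * ψ = s / 64 := by
      have : ψ ≠ 0 := by linarith
      rw [hz]; field_simp
    have hz1 : z ≤ 3 / 64 := by
      rw [hz, div_le_div_iff₀ (by positivity) (by norm_num)]; nlinarith
    have : ψ / (1 + z) ≤ ψ - s / 67 := by
      rw [div_le_iff₀ (by linarith)]
      nlinarith
    linarith
  linarith

/-- The quotient is at most (1 + 1/D)^((m-2)/2), which is at most e^(1/2) as m ≤ D. -/
theorem sqrt_one_add_pow_le {m : ℕ} {D : ℝ} (hD : 1 ≤ D) (hm : (m : ℝ) ≤ D) :
    √(1 + D) ^ (m - 2) ≤ 2 * √D ^ (m - 2) := by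
  have h1 : √(1 + D) ≤ √D * Real.exp (1 / (2 * D)) := by
    rw [Real.sqrt_le_left (by positivity), mul_pow, Real.sq_sqrt (by linarith), ← Real.exp_nat_mul]
    have e : ((2 : ℕ) : ℝ) * (1 / (2 * D)) = 1 / D := by push_cast; field_simp
    rw [e]
    have := Real.add_one_le_exp (1 / D)
    have h2 : D * (1 / D + 1) = 1 + D := by field_simp
    rw [← h2]
    gcongr
  refine (pow_le_pow_left₀ (Real.sqrt_nonneg _) h1 _).trans ?_
  rw [mul_pow, ← Real.exp_nat_mul, mul_comm]
  gcongr
  have h3 : ((m - 2 : ℕ) : ℝ) * (1 / (2 * D)) ≤ 1 / 2 := by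
    have : ((m - 2 : ℕ) : ℝ) ≤ D := (Nat.cast_le.2 (Nat.sub_le m 2)).trans hm
    rw [mul_one_div, div_le_div_iff₀ (by linarith) (by norm_num)]
    linarith
  refine (Real.exp_le_exp.2 h3).trans ?_
  have := Real.exp_one_lt_d9
  have h4 : Real.exp (1 / 2) ^ 2 = Real.exp 1 := by rw [← Real.exp_nat_mul]; norm_num
  nlinarith [Real.exp_pos (1 / 2)]

/-- A positive sequence whose relative decay is bounded below in terms of the potential
`√(1 + D p²)^(m-2)` gets as small as `1 / √(m D)`. -/
theorem decay_of_potential {m T : ℕ} (hm : 2 ≤ m) {D s : ℝ} (hD : 2 ≤ D) (hmD : (m : ℝ) ≤ D)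
    (hs : 0 ≤ s) (hs3 : s ≤ 3) {p : ℕ → ℝ} (hp0 : p 0 = 1) (hp : ∀ t ≤ T, 0 < p t)
    (hstep : ∀ t < T, p (t + 1) ≤ p t / (1 + s / (2 * √(1 + D * p t ^ 2) ^ (m - 2))))
    (h1 : 134 * √D ^ (m - 2) < T * s) (h2 : 6 * Real.log D < T * s) :
    m * (D * p T ^ 2) ≤ 1 := by
  by_contra hcon
  push Not at hcon
  have hm2 : (2 : ℝ) ≤ m := by exact_mod_cast hm
  -- For m = 2 the potential is constantly 1 and carries no information, but then the contraction
  -- rate is constant and the decay geometric; only here is the condition on log D used.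
  rcases hm.eq_or_lt with hm | hm
  · subst hm
    have hind : ∀ t ≤ T, p t ≤ Real.exp (-(s / 6)) ^ t := by
      intro t
      induction t with
      | zero => intro _; simp [hp0]
      | succ t ih =>
        intro ht
        have h3 := hstep t (by omega)
        simp only [Nat.sub_self, pow_zero, mul_one] at h3
        have h4 := one_div_one_add_le_exp (θ := s / 2) (by linarith) (by linarith)
        have h5 : s / 2 / 3 = s / 6 := by ring
        rw [h5] at h4
        calc p (t + 1) ≤ p t * (1 / (1 + s / 2)) := by rw [mul_one_div]; exact h3
          _ ≤ Real.exp (-(s / 6)) ^ t * Real.exp (-(s / 6)) := by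
            have := ih (by omega)
            gcongr
          _ = _ := (pow_succ _ _).symm
    have h3 := hind T le_rfl
    rw [← Real.exp_nat_mul] at h3
    have h4 : p T ^ 2 ≤ Real.exp (-(T * s / 3)) := by
      calc p T ^ 2 ≤ Real.exp (T * -(s / 6)) ^ 2 := by
            have := hp T le_rfl
            gcongr
        _ = _ := by rw [← Real.exp_nat_mul]; congr 1; push_cast; ring
    have h5 : Real.exp (-(T * s / 3)) ≤ 1 / D ^ 2 := by
      have : Real.exp (-(T * s / 3)) ≤ Real.exp (-(2 * Real.log D)) :=
        Real.exp_le_exp.2 (by linarith)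
      refine this.trans (le_of_eq ?_)
      have h6 : (2 : ℝ) * Real.log D = ((2 : ℕ) : ℝ) * Real.log D := by norm_num
      rw [Real.exp_neg, h6, Real.exp_nat_mul, Real.exp_log (by linarith), one_div]
    have h6 : (2 : ℕ) * (D * p T ^ 2) ≤ 2 * (D * (1 / D ^ 2)) := by
      push_cast
      have := h4.trans h5
      gcongr
    have h7 : 2 * (D * (1 / D ^ 2)) ≤ 1 := by
      have : 2 * (D * (1 / D ^ 2)) = 2 / D := by field_simp
      rw [this, div_le_one (by linarith)]; exact hD
    rw [Nat.cast_ofNat] at hcon h6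
    linarith
  · have hanti : ∀ t < T, p (t + 1) ≤ p t := by
      intro t ht
      refine (hstep t ht).trans (div_le_self (hp t ht.le).le ?_)
      have : 0 ≤ s / (2 * √(1 + D * p t ^ 2) ^ (m - 2)) := by positivity
      linarith
    have hge : ∀ j ≤ T, p T ≤ p (T - j) := by
      intro j
      induction j with
      | zero => intro _; simp
      | succ j ih =>
        intro hj
        refine (ih (by omega)).trans ?_
        have := hanti (T - (j + 1)) (by omega)
        rwa [show T - (j + 1) + 1 = T - j by omega] at this
    have hge' : ∀ t ≤ T, p T ≤ p t := by
      intro t ht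
      have := hge (T - t) (by omega)
      rwa [show T - (T - t) = t by omega] at this
    have hind : ∀ t ≤ T, √(1 + D * p t ^ 2) ^ (m - 2) + t * (s / 67) ≤ √(1 + D) ^ (m - 2) := by
      intro t
      induction t with
      | zero => intro _; simp [hp0]
      | succ t ih =>
        intro ht
        have hpT := hp T le_rfl
        have h3 : 1 ≤ m * (D * p t ^ 2) := by
          refine hcon.le.trans ?_
          have := hge' t (by omega)
          gcongr
        have h4 := potential_step hm (by linarith) hs hs3 (hp (t + 1) ht).le (hstep t (by omega)) h3
        have h5 := ih (by omega)
        push_cast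
        linarith
    -- T steps would lower the potential by Ts/67, more than its initial value of at most 2√D^(m-2);
    -- hence 134 = 2·67.
    have h3 := hind T le_rfl
    have h4 := sqrt_one_add_pow_le (by linarith) hmD
    have h5 : 0 ≤ √(1 + D * p T ^ 2) ^ (m - 2) := by positivity
    nlinarith

end Potential
end TensorPCA
end
-- Truncated autoregressive processes.
noncomputable section
namespace TensorPCA
open scoped RealInnerProductSpace

section Autoregression

/-- Truncation of a number to zero when its absolute value exceeds `B`. -/
def clip (B x : ℝ) : ℝ := if |x| ≤ B then x else 0

theorem clip_of_abs_le {B x : ℝ} (h : |x| ≤ B) : clip B x = x := if_pos h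

theorem clip_of_le {B x : ℝ} (h0 : 0 ≤ x) (h : x ≤ B) : clip B x = x :=
  clip_of_abs_le (by rwa [abs_of_nonneg h0])

theorem abs_clip_le {B : ℝ} (hB : 0 ≤ B) (x : ℝ) : |clip B x| ≤ B := by
  rw [clip]; split_ifs with h
  · exact h
  · simpa using hB

variable {V W : Type*} [AddCommGroup V] [Module ℝ V] [AddCommGroup W] [Module ℝ W]

/-- The autoregressive process with coefficients `c`, gains `g` and innovations `X`, started at
zero at time `r`. -/
def ar (c g : ℕ → ℝ) (X : ℕ → V) (r : ℕ) : ℕ → V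
  | 0 => 0
  | t + 1 => if t < r then 0 else c t • ar c g X r t + g t • X t

theorem ar_of_le {c g : ℕ → ℝ} {X : ℕ → V} {r t : ℕ} (h : t ≤ r) : ar c g X r t = 0 := by
  cases t with
  | zero => rfl
  | succ t => rw [ar, if_pos (by omega)]

theorem ar_succ {c g : ℕ → ℝ} {X : ℕ → V} {r t : ℕ} (h : r ≤ t) :
    ar c g X r (t + 1) = c t • ar c g X r t + g t • X t := by
  rw [ar, if_neg (by omega)]

theorem map_ar (f : V →ₗ[ℝ] W) (c g : ℕ → ℝ) (X : ℕ → V) (r t : ℕ) :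
    f (ar c g X r t) = ar c g (fun u => f (X u)) r t := by
  induction t with
  | zero => simp [ar]
  | succ t ih =>
    rw [ar, ar]
    split_ifs
    · simp
    · rw [map_add, map_smul, map_smul, ih]

/-- Variation of constants. The recursion is required only between r and t, so truncated
coefficients may be used wherever the truncation is known to be inactive up to time t. -/
theorem eq_prod_smul_add_ar {c g : ℕ → ℝ} {Y Z : ℕ → V} {r t : ℕ} (hrt : r ≤ t)
    (h : ∀ u, r ≤ u → u < t → Z (u + 1) = c u • Z u + g u • Y u) :
    Z t = (∏ u ∈ Finset.Ico r t, c u) • Z r + ar c g Y r t := by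
  induction t, hrt using Nat.le_induction with
  | base => simp [ar_of_le]
  | succ t hrt ih =>
    rw [h t hrt (by omega), ih fun u hu hut => h u hu (by omega), ar_succ hrt,
      Finset.prod_Ico_succ_top hrt, smul_add, smul_smul, mul_comm (c t)]
    abel

end Autoregression

/-! ### Signal and orthogonal components, and the cosine. -/

section Geometry
variable {H : Type*} [NormedAddCommGroup H] [InnerProductSpace ℝ H]

/-- The component orthogonal to the unit vector `e`. -/
def perp (e : H) : H →ₗ[ℝ] H where
  toFun x := x - ⟪x, e⟫ • e
  map_add' x y := by rw [inner_add_left, add_smul]; abel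
  map_smul' c x := by
    rw [inner_smul_left, conj_trivial, mul_smul, RingHom.id_apply, smul_sub]

theorem perp_apply (e x : H) : perp e x = x - ⟪x, e⟫ • e := rfl

theorem perp_self {e : H} (he : ‖e‖ = 1) : perp e e = 0 := by
  rw [perp_apply, real_inner_self_eq_norm_sq, he]; simp

theorem inner_perp_right {e : H} (x y : H) : ⟪perp e x, y⟫ = ⟪x, perp e y⟫ := by
  simp only [perp_apply, inner_sub_left, inner_sub_right, inner_smul_left, inner_smul_right,
    conj_trivial, real_inner_comm e]
  ring

theorem norm_sq_eq {e : H} (he : ‖e‖ = 1) (x : H) : ‖x‖ ^ 2 = ⟪x, e⟫ ^ 2 + ‖perp e x‖ ^ 2 := by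
  rw [perp_apply, norm_sub_sq_real, inner_smul_right, norm_smul, he, mul_one, Real.norm_eq_abs,
    sq_abs]
  ring

theorem norm_perp_le {e : H} (he : ‖e‖ = 1) (x : H) : ‖perp e x‖ ≤ ‖x‖ := by
  have := norm_sq_eq he x
  exact le_of_sq_le_sq (by nlinarith [sq_nonneg ⟪x, e⟫]) (norm_nonneg _)

theorem norm_le_inner_add {e : H} (he : ‖e‖ = 1) {x : H} (hx : 0 ≤ ⟪x, e⟫) :
    ‖x‖ ≤ ⟪x, e⟫ + ‖perp e x‖ := by
  have := norm_sq_eq he x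
  refine le_of_sq_le_sq ?_ (by positivity)
  nlinarith [mul_nonneg hx (norm_nonneg (perp e x))]

theorem cosine_nonneg {e M : H} (h : 0 ≤ ⟪M, e⟫) : 0 ≤ cosine e M := by
  rw [cosine]; positivity

theorem cosine_le_one {e : H} (he : ‖e‖ = 1) (M : H) : cosine e M ≤ 1 := by
  have h := (le_abs_self _).trans (abs_real_inner_le_norm M e)
  rw [he, mul_one] at h
  exact div_le_one_of_le₀ h (norm_nonneg _)

/-- The coefficient of the noise in `normStep`. -/
def gain (m : ℕ) (s η : ℝ) (e M : H) : ℝ := η * ‖M‖ / growth m s (cosine e M)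

theorem gain_nonneg {m : ℕ} {s η : ℝ} {e M : H} (he : ‖e‖ = 1) (hs : 0 ≤ s) (hη : 0 ≤ η)
    (h : 0 ≤ ⟪M, e⟫) : 0 ≤ gain m s η e M :=
  div_nonneg (by positivity)
    (zero_le_one.trans (growth_ge_one hs (cosine_nonneg h) (cosine_le_one he M)))

theorem gain_le {m : ℕ} {s η : ℝ} {e M : H} (he : ‖e‖ = 1) (hs : 0 ≤ s) (hη : 0 ≤ η)
    (h : 0 ≤ ⟪M, e⟫) : gain m s η e M ≤ η * ‖M‖ :=
  div_le_self (by positivity) (growth_ge_one hs (cosine_nonneg h) (cosine_le_one he M))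

theorem inner_normStep {m : ℕ} {s η : ℝ} {e : H} (he : ‖e‖ = 1) (M X : H) :
    ⟪normStep m s η e M X, e⟫ = ⟪M, e⟫ + gain m s η e M * ⟪X, e⟫ := by
  simp only [normStep, inner_add_left, inner_smul_left, conj_trivial,
    real_inner_self_eq_norm_sq, he, gain]
  ring

theorem perp_normStep {m : ℕ} {s η : ℝ} {e : H} (he : ‖e‖ = 1) (M X : H) :
    perp e (normStep m s η e M X)
      = ratio m s (cosine e M) • perp e M + gain m s η e M • perp e X := by
  simp only [normStep, map_add, map_smul, perp_self he, smul_zero, add_zero, gain]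

theorem one_add_pow_mul_cosine_pow {e M : H} (he : ‖e‖ = 1) (h : 0 < ⟪M, e⟫) (m : ℕ) :
    (1 + ‖perp e M‖ ^ 2 / ⟪M, e⟫ ^ 2) ^ m * (cosine e M ^ m) ^ 2 = 1 := by
  have h1 := norm_sq_eq he M
  have hM : 0 < ‖M‖ ^ 2 := by rw [h1]; positivity
  rw [← pow_mul, mul_comm m 2, pow_mul, ← mul_pow, cosine, div_pow]
  have : (1 + ‖perp e M‖ ^ 2 / ⟪M, e⟫ ^ 2) * (⟪M, e⟫ ^ 2 / ‖M‖ ^ 2) = 1 := by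
    rw [h1] at hM ⊢
    field_simp
  rw [this, one_pow]

/-- With y the squared tangent, cos^(2m) = (1 + y)^(-m), and Bernoulli's inequality gives (1 + y)^m
≥ 1 + my. -/
theorem mul_norm_perp_sq_le {e M : H} (he : ‖e‖ = 1) (h : 0 < ⟪M, e⟫) {m : ℕ} {c : ℝ} (hc : 0 < c)
    (hcos : c ≤ cosine e M ^ m) : m * ‖perp e M‖ ^ 2 ≤ ⟪M, e⟫ ^ 2 * ((c ^ 2)⁻¹ - 1) := by
  have h1 := one_add_pow_mul_cosine_pow he h m
  set y := ‖perp e M‖ ^ 2 / ⟪M, e⟫ ^ 2 with hy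
  have hy0 : 0 ≤ y := by positivity
  have h2 : 1 + m * y ≤ (1 + y) ^ m := one_add_mul_le_pow (by linarith) m
  have h3 : (1 + y) ^ m ≤ (c ^ 2)⁻¹ := by
    rw [← one_div, le_div_iff₀ (by positivity)]
    refine le_trans ?_ h1.le
    gcongr
  have h4 : m * ‖perp e M‖ ^ 2 = ⟪M, e⟫ ^ 2 * (m * y) := by rw [hy]; field_simp
  rw [h4]
  gcongr
  linarith

/-- The lower bound for `cos^m` once the iterate is aligned with the signal. -/
def cosBound : ℝ := Real.exp (-26)

theorem cosBound_pos : 0 < cosBound := Real.exp_pos _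

theorem cosBound_le : cosBound ≤ 1 / 27 := by
  rw [cosBound, Real.exp_neg, ← one_div]
  have := Real.add_one_le_exp (26 : ℝ)
  exact one_div_le_one_div_of_le (by norm_num) (by linarith)

/-- The converse direction, by 1 + y ≤ e^y. Here my ≤ 49·(54/53)² < 52, and halving this exponent
gives the 26 in `cosBound`. -/
theorem cosBound_le_cosine_pow {e M : H} (he : ‖e‖ = 1) {m : ℕ} (hm : 0 < m)
    (h : 53 / 54 ≤ ⟪M, e⟫) (hw : m * ‖perp e M‖ ^ 2 ≤ 49) : cosBound ≤ cosine e M ^ m := by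
  have hρ : 0 < ⟪M, e⟫ := by linarith
  have h1 := one_add_pow_mul_cosine_pow he hρ m
  set y := ‖perp e M‖ ^ 2 / ⟪M, e⟫ ^ 2 with hy
  have hm0 : (0 : ℝ) < m := by exact_mod_cast hm
  have hy1 : m * y ≤ 52 := by
    rw [hy, ← mul_div_assoc, div_le_iff₀ (by positivity)]
    nlinarith
  have h2 : (1 + y) ^ m ≤ Real.exp 52 := by
    have h3 : 1 + y ≤ Real.exp y := by rw [add_comm]; exact Real.add_one_le_exp y
    calc (1 + y) ^ m ≤ Real.exp y ^ m := pow_le_pow_left₀ (by positivity) h3 m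
      _ = Real.exp (m * y) := by rw [Real.exp_nat_mul]
      _ ≤ _ := Real.exp_le_exp.2 hy1
  refine le_of_sq_le_sq ?_ (pow_nonneg (cosine_nonneg hρ.le) m)
  have h4 : cosBound ^ 2 * Real.exp 52 = 1 := by
    rw [cosBound, ← Real.exp_nat_mul, ← Real.exp_add]; norm_num
  have h5 : 1 ≤ Real.exp 52 * (cosine e M ^ m) ^ 2 := by
    rw [← h1]; gcongr
  have := Real.exp_pos 52
  nlinarith

end Geometry
end TensorPCA
end
-- Trajectories with controlled noise.
noncomputable section
namespace TensorPCA
open scoped RealInnerProductSpace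

section Run
variable {H : Type*} [NormedAddCommGroup H] [InnerProductSpace ℝ H]

def ratioSeq (m : ℕ) (Λ : ℝ) (e : H) (η : ℕ → ℝ) (M : ℕ → H) (t : ℕ) : ℝ :=
  ratio m (Λ * η t) (cosine e (M t))

def gainSeq (m : ℕ) (Λ : ℝ) (e : H) (η : ℕ → ℝ) (M : ℕ → H) (t : ℕ) : ℝ :=
  gain m (Λ * η t) (η t) e (M t)

/-- The accumulated contraction of the orthogonal part. -/
def decay (m : ℕ) (Λ : ℝ) (e : H) (η : ℕ → ℝ) (M : ℕ → H) (t : ℕ) : ℝ :=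
  ∏ u ∈ Finset.range t, ratioSeq m Λ e η M u

/-- The predicted size of the normalised iterate. -/
def sizeSeq (m : ℕ) (D Λ : ℝ) (e : H) (η : ℕ → ℝ) (M : ℕ → H) (t : ℕ) : ℝ :=
  √(1 + D * decay m Λ e η M t ^ 2)

/-- The early deviation from the predicted trajectory is measured relative to the predicted size,
which makes its coefficients at most 1 although the size changes by a power of D. -/
def earlyCoeff (m : ℕ) (D Λ : ℝ) (e : H) (η : ℕ → ℝ) (M : ℕ → H) (t : ℕ) : ℝ :=
  clip 1 (ratioSeq m Λ e η M t * sizeSeq m D Λ e η M t / sizeSeq m D Λ e η M (t + 1))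

/-- The threshold is 2·8: the iterate is at most twice its predicted size, and the predicted size
drops at most by a factor 8 per step. -/
def earlyGain (m : ℕ) (D Λ : ℝ) (e : H) (η : ℕ → ℝ) (M : ℕ → H) (t : ℕ) : ℝ :=
  clip (16 * η t) (gainSeq m Λ e η M t / sizeSeq m D Λ e η M (t + 1))

def signalGain (m : ℕ) (D Λ : ℝ) (e : H) (η : ℕ → ℝ) (M : ℕ → H) (t : ℕ) : ℝ :=
  clip (4 * √D * η t) (gainSeq m Λ e η M t)

def lateGain (m : ℕ) (Λ : ℝ) (e : H) (η : ℕ → ℝ) (M : ℕ → H) (t : ℕ) : ℝ :=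
  clip (16 * η t) (gainSeq m Λ e η M t)

def lateCoeff (m : ℕ) (Λ : ℝ) (e : H) (η : ℕ → ℝ) (M : ℕ → H) (t : ℕ) : ℝ :=
  clip 1 (ratioSeq m Λ e η M t)

/-- The strict threshold below 1 gives the noise process a stationary variance, whereas `lateCoeff`
only yields a variance growing linearly in time. -/
def fineCoeff (m : ℕ) (Λ : ℝ) (e : H) (η : ℕ → ℝ) (M : ℕ → H) (t : ℕ) : ℝ :=
  clip (1 - cosBound / 3 * (Λ * η t)) (ratioSeq m Λ e η M t)

/-- A normalised trajectory with well-behaved noise. -/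
structure IsRun (m T N : ℕ) (D Λ : ℝ) (e : H) (η : ℕ → ℝ) (M X : ℕ → H) : Prop where
  hm : 2 ≤ m
  hT : 2 * T ≤ N
  hD : 4 ≤ D
  hmD : (m : ℝ) ≤ D
  he : ‖e‖ = 1
  hΛ : 0 < Λ
  step_pos : ∀ t, 0 < η t
  step_early : ∀ t < T, η t = η 0
  step_late : ∀ t, T ≤ t → η t ≤ η 0 / 2
  step_mid : ∀ t, T ≤ t → t < 2 * T → η t = η 0 / 2
  -- A rational bound slightly above e: the step-size condition says λmη₀ ≤ e.
  step_le : Λ * η 0 ≤ 68 / 25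
  inner_init : ⟪M 0, e⟫ = 1
  norm_init : ‖M 0‖ ^ 2 = D
  succ : ∀ t, M (t + 1) = normStep m (Λ * η t) (η t) e (M t) (X t)
  time_pow : 134 * √D ^ (m - 2) < T * (Λ * η 0)
  time_log : 6 * Real.log D < T * (Λ * η 0)
  noise_signal : ∀ t ≤ N, |⟪ar (fun _ => 1) (signalGain m D Λ e η M) X 0 t, e⟫| ≤ cosBound / m
  noise_early : ∀ t ≤ N, ‖perp e (ar (earlyCoeff m D Λ e η M) (earlyGain m D Λ e η M) X 0 t)‖
    ≤ cosBound / m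
  -- All starting times are needed: r = T after the first phase, and r = t to bound the noise of a
  -- single step.
  noise_late : ∀ r ≤ N, ∀ t ≤ N, ‖perp e (ar (lateCoeff m Λ e η M) (lateGain m Λ e η M) X r t)‖
    ≤ cosBound / m

namespace IsRun
variable {m T N : ℕ} {D Λ : ℝ} {e : H} {η : ℕ → ℝ} {M X : ℕ → H}

theorem two_le (R : IsRun m T N D Λ e η M X) : (2 : ℝ) ≤ m := by exact_mod_cast R.hm

theorem eps_pos (R : IsRun m T N D Λ e η M X) : 0 < cosBound / m := by
  have := R.two_le
  have := cosBound_pos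
  positivity

theorem eps_le (R : IsRun m T N D Λ e η M X) : cosBound / m ≤ 1 / 54 := by
  have := R.two_le
  have := cosBound_le
  rw [div_le_div_iff₀ (by linarith) (by norm_num)]
  linarith

theorem rate_pos (R : IsRun m T N D Λ e η M X) (t : ℕ) : 0 < Λ * η t := mul_pos R.hΛ (R.step_pos t)

theorem inner_succ (R : IsRun m T N D Λ e η M X) (t : ℕ) :
    ⟪M (t + 1), e⟫ = ⟪M t, e⟫ + gainSeq m Λ e η M t * ⟪X t, e⟫ := by
  rw [R.succ, inner_normStep R.he]; rfl

theorem perp_succ (R : IsRun m T N D Λ e η M X) (t : ℕ) :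
    perp e (M (t + 1)) = ratioSeq m Λ e η M t • perp e (M t)
      + gainSeq m Λ e η M t • perp e (X t) := by
  rw [R.succ, perp_normStep R.he]; rfl

theorem gainSeq_nonneg (R : IsRun m T N D Λ e η M X) {t : ℕ} (h : 0 ≤ ⟪M t, e⟫) :
    0 ≤ gainSeq m Λ e η M t := gain_nonneg R.he (R.rate_pos t).le (R.step_pos t).le h

theorem gainSeq_le (R : IsRun m T N D Λ e η M X) {t : ℕ} (h : 0 ≤ ⟪M t, e⟫) :
    gainSeq m Λ e η M t ≤ η t * ‖M t‖ := gain_le R.he (R.rate_pos t).le (R.step_pos t).le h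

/-- In the normalised scale the signal coordinate has no drift, so its deviation from 1 is a pure
noise sum. The bounds at earlier times serve to deactivate the truncation of its gain. -/
theorem abs_inner_sub_one_le (R : IsRun m T N D Λ e η M X) {t : ℕ} (ht : t ≤ N)
    (h : ∀ u < t, 0 ≤ ⟪M u, e⟫ ∧ ‖M u‖ ≤ 4 * √D) : |⟪M t, e⟫ - 1| ≤ cosBound / m := by
  have key := eq_prod_smul_add_ar (c := fun _ => (1 : ℝ)) (g := signalGain m D Λ e η M)
    (Y := fun u => ⟪X u, e⟫) (Z := fun u => ⟪M u, e⟫) (Nat.zero_le t) (by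
      intro u _ hu
      have h1 : signalGain m D Λ e η M u = gainSeq m Λ e η M u := by
        refine clip_of_le (R.gainSeq_nonneg (h u hu).1) ((R.gainSeq_le (h u hu).1).trans ?_)
        have := R.step_pos u
        nlinarith [(h u hu).2]
      simp only [h1, smul_eq_mul, one_mul]
      exact R.inner_succ u)
  have h2 := map_ar ((innerₗ H).flip e) (fun _ => (1 : ℝ)) (signalGain m D Λ e η M) X 0 t
  simp only [LinearMap.flip_apply, innerₗ_apply_apply] at h2
  simp only [Finset.prod_const_one, one_smul, R.inner_init] at key
  rw [key, ← h2, add_sub_cancel_left]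
  exact R.noise_signal t ht

end IsRun
end Run
end TensorPCA
end
-- Early phase: from the identity to alignment.
noncomputable section
namespace TensorPCA
open scoped RealInnerProductSpace

section EarlyPhase
variable {H : Type*} [NormedAddCommGroup H] [InnerProductSpace ℝ H]

/-- The invariants of the early phase. -/
structure IsEarly (m : ℕ) (D Λ : ℝ) (e : H) (η : ℕ → ℝ) (M : ℕ → H) (t : ℕ) : Prop where
  signal : |⟪M t, e⟫ - 1| ≤ cosBound / m
  noise : ‖perp e (M t) - decay m Λ e η M t • perp e (M 0)‖
    ≤ cosBound / m * sizeSeq m D Λ e η M t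
  decay_pos : 0 < decay m Λ e η M t
  decay_le : decay m Λ e η M t ≤ 1

namespace IsRun
variable {m T N : ℕ} {D Λ : ℝ} {e : H} {η : ℕ → ℝ} {M X : ℕ → H}

theorem one_le_sizeSeq (R : IsRun m T N D Λ e η M X) (t : ℕ) : 1 ≤ sizeSeq m D Λ e η M t := by
  have := R.hD
  rw [sizeSeq, Real.one_le_sqrt]
  have : 0 ≤ D * decay m Λ e η M t ^ 2 := by positivity
  linarith

theorem inner_bounds (R : IsRun m T N D Λ e η M X) {t : ℕ} (h : |⟪M t, e⟫ - 1| ≤ cosBound / m) :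
    53 / 54 ≤ ⟪M t, e⟫ ∧ ⟪M t, e⟫ ≤ 55 / 54 := by
  have h1 := abs_le.1 (h.trans R.eps_le)
  constructor <;> linarith [h1.1, h1.2]

theorem norm_perp_zero_le (R : IsRun m T N D Λ e η M X) : ‖perp e (M 0)‖ ^ 2 ≤ D := by
  have := norm_sq_eq R.he (M 0)
  rw [R.norm_init] at this
  nlinarith [sq_nonneg ⟪M 0, e⟫]

/-- The predicted iterate e + p·perp(M₀) has norm at most ν; the signal error adds ε ≤ εν and the
orthogonal error adds εν. -/
theorem norm_le_of_isEarly (R : IsRun m T N D Λ e η M X) {t : ℕ}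
    (h : IsEarly m D Λ e η M t) :
    ‖M t‖ ≤ sizeSeq m D Λ e η M t * (1 + 2 * (cosBound / m)) := by
  have hε := R.eps_pos
  have hν := R.one_le_sizeSeq t
  set p := decay m Λ e η M t
  set ν := sizeSeq m D Λ e η M t with hνdef
  have e1 : M t = (e + p • perp e (M 0)) + (⟪M t, e⟫ - 1) • e + (perp e (M t) - p • perp e (M 0)) := by
    have : M t = ⟪M t, e⟫ • e + perp e (M t) := by rw [perp_apply]; abel
    conv_lhs => rw [this]
    rw [sub_smul, one_smul]; abel
  have h1 : ‖e + p • perp e (M 0)‖ ≤ ν := by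
    have horth : ⟪e, p • perp e (M 0)⟫ = 0 := by
      rw [inner_smul_right, ← inner_perp_right, perp_self R.he, inner_zero_left, mul_zero]
    rw [hνdef, sizeSeq]
    refine Real.le_sqrt_of_sq_le ?_
    rw [norm_add_sq_real, horth, R.he, norm_smul, mul_pow, Real.norm_eq_abs, sq_abs]
    nlinarith [R.norm_perp_zero_le, sq_nonneg p]
  have h2 : ‖(⟪M t, e⟫ - 1) • e‖ ≤ cosBound / m := by
    rw [norm_smul, R.he, mul_one]; exact h.signal
  rw [e1]
  refine (norm_add₃_le).trans ?_
  have := h.noise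
  nlinarith

theorem norm_le_of_isEarly' (R : IsRun m T N D Λ e η M X) {t : ℕ}
    (h : IsEarly m D Λ e η M t) : ‖M t‖ ≤ 2 * sizeSeq m D Λ e η M t ∧ ‖M t‖ ≤ 4 * √D := by
  have h1 := R.norm_le_of_isEarly h
  have hε := R.eps_le
  have hν := R.one_le_sizeSeq t
  have h2 : ‖M t‖ ≤ 2 * sizeSeq m D Λ e η M t := by nlinarith
  refine ⟨h2, h2.trans ?_⟩
  have hD := R.hD
  have h3 : sizeSeq m D Λ e η M t ≤ 2 * √D := by
    rw [sizeSeq, Real.sqrt_le_left (by positivity), mul_pow, Real.sq_sqrt (by linarith)]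
    have : decay m Λ e η M t ^ 2 ≤ 1 := pow_le_one₀ h.decay_pos.le h.decay_le
    nlinarith
  linarith

theorem cosine_pow_ge (R : IsRun m T N D Λ e η M X) {t : ℕ} (h : IsEarly m D Λ e η M t) :
    1 / (2 * sizeSeq m D Λ e η M t ^ (m - 2)) ≤ cosine e (M t) ^ (m - 2) := by
  have hε := R.eps_le
  have hε0 := R.eps_pos
  have hν := R.one_le_sizeSeq t
  have hρ := (R.inner_bounds h.signal).1
  have hF := R.norm_le_of_isEarly h
  have hF0 : 0 < ‖M t‖ := by
    rw [norm_pos_iff]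
    rintro h0
    rw [h0, inner_zero_left] at hρ
    norm_num at hρ
  have hs := (abs_le.1 h.signal).1
  set ν := sizeSeq m D Λ e η M t
  set ε := cosBound / m with hεdef
  have h1 : 1 / (ν * (1 + 4 * ε)) ≤ cosine e (M t) := by
    rw [cosine, div_le_div_iff₀ (by positivity) hF0, one_mul]
    refine hF.trans ?_
    have : 1 + 2 * ε ≤ ⟪M t, e⟫ * (1 + 4 * ε) := by nlinarith
    nlinarith
  refine le_trans ?_ (pow_le_pow_left₀ (by positivity) h1 _)
  rw [div_pow, one_pow, mul_pow]
  -- This is why noise tolerances are of the form constant/m: relative errors are raised to a power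
  -- of order m.
  have h2 : (1 + 4 * ε) ^ (m - 2) ≤ 2 := by
    have h3 : 1 + 4 * ε ≤ Real.exp (4 * ε) := by rw [add_comm]; exact Real.add_one_le_exp _
    calc (1 + 4 * ε) ^ (m - 2) ≤ (1 + 4 * ε) ^ m :=
          pow_le_pow_right₀ (by linarith) (Nat.sub_le m 2)
      _ ≤ Real.exp (4 * ε) ^ m := pow_le_pow_left₀ (by positivity) h3 m
      _ = Real.exp (m * (4 * ε)) := by rw [Real.exp_nat_mul]
      _ = Real.exp (4 * cosBound) := by
        congr 1
        have := R.two_le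
        rw [hεdef]; field_simp
      _ ≤ Real.exp (1 / 2) := Real.exp_le_exp.2 (by linarith [cosBound_le])
      _ ≤ 2 := by
        have := Real.exp_one_lt_d9
        have h4 : Real.exp (1 / 2) ^ 2 = Real.exp 1 := by rw [← Real.exp_nat_mul]; norm_num
        nlinarith [Real.exp_pos (1 / 2)]
  rw [mul_comm 2]
  gcongr

/-- Bounds on one contraction factor in the early phase. -/
theorem ratioSeq_bounds (R : IsRun m T N D Λ e η M X) {t : ℕ} (ht : t < T)
    (h : IsEarly m D Λ e η M t) (hc : Λ * η 0 * cosine e (M t) ^ m ≤ 1 / 2) :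
    1 / 8 ≤ ratioSeq m Λ e η M t ∧
      ratioSeq m Λ e η M t ≤ 1 / (1 + Λ * η 0 / (2 * sizeSeq m D Λ e η M t ^ (m - 2))) ∧
      ratioSeq m Λ e η M t ≤ 1 := by
  have hρ := (R.inner_bounds h.signal).1
  have h0 : 0 ≤ cosine e (M t) := cosine_nonneg (by linarith)
  have h1 := cosine_le_one R.he (M t)
  have hs0 := (R.rate_pos 0).le
  have hν := R.one_le_sizeSeq t
  have hle : ratioSeq m Λ e η M t
      ≤ 1 / (1 + Λ * η 0 / (2 * sizeSeq m D Λ e η M t ^ (m - 2))) := by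
    rw [ratioSeq, R.step_early t ht]
    refine (ratio_le R.hm hs0 h0 h1).trans ?_
    refine one_div_le_one_div_of_le (by positivity) ?_
    have h2 : Λ * η 0 / (2 * sizeSeq m D Λ e η M t ^ (m - 2))
        = Λ * η 0 * (1 / (2 * sizeSeq m D Λ e η M t ^ (m - 2))) := by ring
    rw [h2]
    have := R.cosine_pow_ge h
    gcongr
  refine ⟨?_, hle, hle.trans ?_⟩
  · rw [ratioSeq, R.step_early t ht]
    exact ratio_ge R.hm hs0 (by linarith [R.step_le]) h0 h1 hc
  · refine div_le_one_of_le₀ ?_ (by positivity)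
    have : 0 ≤ Λ * η 0 / (2 * sizeSeq m D Λ e η M t ^ (m - 2)) := by positivity
    linarith

theorem decay_succ (t : ℕ) :
    decay m Λ e η M (t + 1) = decay m Λ e η M t * ratioSeq m Λ e η M t :=
  Finset.prod_range_succ _ _

/-- While `s cos^m ≤ 1/2`, the truncations in the early noise process are inactive. -/
theorem early_unclipped (R : IsRun m T N D Λ e η M X) {t : ℕ} (ht : t < T)
    (h : IsEarly m D Λ e η M t) (hc : Λ * η 0 * cosine e (M t) ^ m ≤ 1 / 2) :
    earlyCoeff m D Λ e η M t
        = ratioSeq m Λ e η M t * sizeSeq m D Λ e η M t / sizeSeq m D Λ e η M (t + 1) ∧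
      earlyGain m D Λ e η M t = gainSeq m Λ e η M t / sizeSeq m D Λ e η M (t + 1) := by
  obtain ⟨hμ8, -, hμ1⟩ := R.ratioSeq_bounds ht h hc
  have hν := R.one_le_sizeSeq t
  have hν' := R.one_le_sizeSeq (t + 1)
  have hD := R.hD
  -- With μ ≤ 1 the contraction factor, μ²(1 + Dp²) ≤ 1 + D(μp)².
  have hle : ratioSeq m Λ e η M t * sizeSeq m D Λ e η M t ≤ sizeSeq m D Λ e η M (t + 1) := by
    conv_rhs => rw [sizeSeq]
    refine Real.le_sqrt_of_sq_le ?_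
    rw [mul_pow, sizeSeq, Real.sq_sqrt (by positivity), decay_succ]
    nlinarith [pow_le_one₀ (n := 2) (by linarith : 0 ≤ ratioSeq m Λ e η M t) hμ1]
  have hρ : 0 ≤ ⟪M t, e⟫ := by linarith [(R.inner_bounds h.signal).1]
  constructor
  · refine clip_of_le ?_ (div_le_one_of_le₀ hle (by linarith))
    have : 0 ≤ ratioSeq m Λ e η M t := by linarith
    positivity
  · refine clip_of_le (div_nonneg (R.gainSeq_nonneg hρ) (by linarith)) ?_
    rw [div_le_iff₀ (by linarith)]
    refine (R.gainSeq_le hρ).trans ?_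
    have h2 := (R.norm_le_of_isEarly' h).1
    have h3 : sizeSeq m D Λ e η M t ≤ 8 * sizeSeq m D Λ e η M (t + 1) := by nlinarith
    have := R.step_pos t
    rw [mul_assoc, mul_left_comm]
    nlinarith

/-- Bootstrap: the invariants before time t make all truncations inactive before t, so the
deviations at time t equal the truncated noise processes, which are small by assumption. The
tolerance is the same at every time, so errors do not compound. -/
theorem isEarly (R : IsRun m T N D Λ e η M X) {t : ℕ} (ht : t ≤ T)
    (hc : ∀ u < t, Λ * η 0 * cosine e (M u) ^ m ≤ 1 / 2) : IsEarly m D Λ e η M t := by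
  induction t using Nat.strong_induction_on with
  | _ t ih =>
  have hE : ∀ u < t, IsEarly m D Λ e η M u := fun u hu =>
    ih u hu (by omega) fun w hw => hc w (hw.trans hu)
  have hTN := R.hT
  have hν : ∀ u, 0 < sizeSeq m D Λ e η M u := fun u =>
    zero_lt_one.trans_le (R.one_le_sizeSeq u)
  have hratio : ∀ u < t, 0 < ratioSeq m Λ e η M u ∧ ratioSeq m Λ e η M u ≤ 1 := fun u hu => by
    obtain ⟨h1, -, h2⟩ := R.ratioSeq_bounds (by omega) (hE u hu) (hc u hu)
    exact ⟨by linarith, h2⟩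
  refine ⟨?_, ?_, ?_, ?_⟩
  · refine R.abs_inner_sub_one_le (by omega) fun u hu => ⟨?_, (R.norm_le_of_isEarly' (hE u hu)).2⟩
    linarith [(R.inner_bounds (hE u hu).signal).1]
  · have key := eq_prod_smul_add_ar (c := earlyCoeff m D Λ e η M) (g := earlyGain m D Λ e η M)
      (Y := fun u => perp e (X u)) (Z := fun u => (sizeSeq m D Λ e η M u)⁻¹ •
        (perp e (M u) - decay m Λ e η M u • perp e (M 0))) (Nat.zero_le t) (by
        intro u _ hu
        obtain ⟨h1, h2⟩ := R.early_unclipped (by omega) (hE u hu) (hc u hu)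
        have n1 := (hν u).ne'
        have n2 := (hν (u + 1)).ne'
        rw [h1, h2, R.perp_succ, decay_succ]
        match_scalars <;> field_simp)
    have h0 : perp e (M 0) - decay m Λ e η M 0 • perp e (M 0) = 0 := by simp [decay]
    rw [h0, smul_zero, smul_zero, zero_add, ← map_ar] at key
    have h1 := R.noise_early t (by omega)
    rw [← key, norm_smul, norm_inv, Real.norm_of_nonneg (hν t).le, ← div_eq_inv_mul,
      div_le_iff₀ (hν t)] at h1
    exact h1
  · exact Finset.prod_pos fun u hu => (hratio u (Finset.mem_range.1 hu)).1
  · exact Finset.prod_le_one (fun u hu => (hratio u (Finset.mem_range.1 hu)).1.le)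
      fun u hu => (hratio u (Finset.mem_range.1 hu)).2

/-- If the early phase lasts until time `T`, the orthogonal part is small at time `T`. -/
theorem norm_perp_of_early (R : IsRun m T N D Λ e η M X)
    (hc : ∀ u < T, Λ * η 0 * cosine e (M u) ^ m ≤ 1 / 2) :
    m * ‖perp e (M T)‖ ^ 2 ≤ 36 := by
  have hE : ∀ t ≤ T, IsEarly m D Λ e η M t := fun t ht =>
    R.isEarly ht fun u hu => hc u (by omega)
  have hD := R.hD
  have hm := R.two_le
  have h1 := decay_of_potential R.hm (by linarith) R.hmD (R.rate_pos 0).le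
    (by linarith [R.step_le]) (p := decay m Λ e η M) (by simp [decay])
    (fun t ht => (hE t ht).decay_pos) (fun t ht => by
      rw [decay_succ, div_eq_mul_one_div]
      have := (R.ratioSeq_bounds ht (hE t ht.le) (hc t ht)).2.1
      have := (hE t ht.le).decay_pos
      gcongr
      exact (R.ratioSeq_bounds ht (hE t ht.le) (hc t ht)).2.1) R.time_pow R.time_log
  have h2 := (hE T le_rfl).noise
  have hp := (hE T le_rfl).decay_pos
  set p := decay m Λ e η M T
  have hx : D * p ^ 2 ≤ 1 / 2 := by nlinarith [mul_nonneg (by linarith : (0:ℝ) ≤ D) (sq_nonneg p)]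
  have hν : sizeSeq m D Λ e η M T ≤ 2 := by
    rw [sizeSeq, Real.sqrt_le_left (by norm_num)]
    linarith
  have hw : ‖perp e (M T)‖ ≤ p * ‖perp e (M 0)‖ + 2 * (cosBound / m) := by
    have h3 : perp e (M T) = p • perp e (M 0) + (perp e (M T) - p • perp e (M 0)) := by abel
    rw [h3]
    refine (norm_add_le _ _).trans ?_
    rw [norm_smul, Real.norm_of_nonneg hp.le]
    have := R.eps_pos
    nlinarith
  have ha : m * (p * ‖perp e (M 0)‖) ^ 2 ≤ 1 := by
    refine le_trans ?_ h1
    rw [mul_pow, mul_comm (p ^ 2)]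
    have := R.norm_perp_zero_le
    gcongr
  have hb : m * (2 * (cosBound / m)) ^ 2 ≤ 1 := by
    have h4 : m * (2 * (cosBound / m)) ^ 2 = 4 * cosBound ^ 2 / m := by field_simp; ring
    rw [h4, div_le_one (by linarith)]
    nlinarith [cosBound_le, cosBound_pos]
  have hε := R.eps_pos
  calc m * ‖perp e (M T)‖ ^ 2 ≤ m * (p * ‖perp e (M 0)‖ + 2 * (cosBound / m)) ^ 2 := by gcongr
    _ ≤ m * (2 * (p * ‖perp e (M 0)‖) ^ 2 + 2 * (2 * (cosBound / m)) ^ 2) := by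
      gcongr
      nlinarith [sq_nonneg (p * ‖perp e (M 0)‖ - 2 * (cosBound / m))]
    _ ≤ 36 := by linarith

end IsRun
end EarlyPhase
end TensorPCA
end
-- Late phase: staying aligned and contracting.
noncomputable section
namespace TensorPCA
open scoped RealInnerProductSpace

section LatePhase
variable {H : Type*} [NormedAddCommGroup H] [InnerProductSpace ℝ H]
namespace IsRun
variable {m T N : ℕ} {D Λ : ℝ} {e : H} {η : ℕ → ℝ} {M X : ℕ → H}

/-- The iterate is in the range where it stays away from zero and bounded. -/
def IsBounded (D : ℝ) (e : H) (M : ℕ → H) (t : ℕ) : Prop := 0 ≤ ⟪M t, e⟫ ∧ ‖M t‖ ≤ 4 * √D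

theorem norm_perp_le_of_mul_sq_le (R : IsRun m T N D Λ e η M X) {x : H} {b : ℝ} (hb : 0 ≤ b)
    (h : m * ‖x‖ ^ 2 ≤ 2 * b ^ 2) : ‖x‖ ≤ b := by
  have := R.two_le
  refine le_of_sq_le_sq ?_ hb
  nlinarith [sq_nonneg ‖x‖]

theorem norm_le_eight (R : IsRun m T N D Λ e η M X) {t : ℕ} (h : |⟪M t, e⟫ - 1| ≤ cosBound / m)
    (hw : m * ‖perp e (M t)‖ ^ 2 ≤ 49) : ‖M t‖ ≤ 8 := by
  have h1 := R.inner_bounds h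
  have h2 := R.norm_perp_le_of_mul_sq_le (b := 5) (by norm_num) (by linarith)
  have h3 := norm_le_inner_add R.he (x := M t) (by linarith [h1.1])
  linarith [h1.2]

theorem isBounded_of_perp (R : IsRun m T N D Λ e η M X) {t : ℕ}
    (h : |⟪M t, e⟫ - 1| ≤ cosBound / m) (hw : m * ‖perp e (M t)‖ ^ 2 ≤ 49) :
    IsBounded D e M t := by
  refine ⟨by linarith [(R.inner_bounds h).1], (R.norm_le_eight h hw).trans ?_⟩
  have : 2 ≤ √D := Real.le_sqrt_of_sq_le (by linarith [R.hD])
  linarith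

theorem lateGain_eq (R : IsRun m T N D Λ e η M X) {t : ℕ} (h : |⟪M t, e⟫ - 1| ≤ cosBound / m)
    (hw : m * ‖perp e (M t)‖ ^ 2 ≤ 49) : lateGain m Λ e η M t = gainSeq m Λ e η M t := by
  have hρ : 0 ≤ ⟪M t, e⟫ := by linarith [(R.inner_bounds h).1]
  refine clip_of_le (R.gainSeq_nonneg hρ) ((R.gainSeq_le hρ).trans ?_)
  have := R.step_pos t
  nlinarith [R.norm_le_eight h hw]

/-- Bound for one step with a large step size: the orthogonal part stays below its threshold. -/
theorem norm_perp_large_step (R : IsRun m T N D Λ e η M X) {t : ℕ} (ht : t < T)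
    (hs : 1 / 2 ≤ Λ * η 0) (h : |⟪M t, e⟫ - 1| ≤ cosBound / m)
    (hw : m * ‖perp e (M t)‖ ^ 2 ≤ 36) : m * ‖perp e (M (t + 1))‖ ^ 2 ≤ 36 := by
  have hTN := R.hT
  have hm := R.two_le
  have hc := cosBound_pos
  have hc' := cosBound_le
  have hρ := R.inner_bounds h
  have hρ0 : 0 < ⟪M t, e⟫ := by linarith [hρ.1]
  have h0 : 0 ≤ cosine e (M t) := cosine_nonneg hρ0.le
  have h1 := cosine_le_one R.he (M t)
  have hs0 := (R.rate_pos 0).le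
  have hsl := R.step_le
  have hstep : ‖perp e (M (t + 1))‖ ≤ |ratioSeq m Λ e η M t| * ‖perp e (M t)‖ + cosBound / m := by
    -- Started at t and stopped at t + 1, the process is just the noise of one step.
    have h2 := R.noise_late t (by omega) (t + 1) (by omega)
    rw [ar_succ le_rfl, ar_of_le le_rfl, smul_zero, zero_add, map_smul,
      R.lateGain_eq h (by linarith)] at h2
    rw [R.perp_succ]
    refine (norm_add_le _ _).trans ?_
    rw [norm_smul, Real.norm_eq_abs]
    linarith
  set q := √(m : ℝ) with hq
  have hq2 : q ^ 2 = m := Real.sq_sqrt (by linarith)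
  have hq0 : 0 < q := Real.sqrt_pos.2 (by linarith)
  have hq1 : 1 ≤ q := by nlinarith
  have hqε : q * (cosBound / m) ≤ cosBound := by
    rw [← hq2, ← mul_div_assoc, div_le_iff₀ (by positivity)]
    nlinarith [mul_nonneg (mul_nonneg hc.le hq0.le) (sub_nonneg.2 hq1)]
  have hqw : q * ‖perp e (M (t + 1))‖
      ≤ |ratioSeq m Λ e η M t| * (q * ‖perp e (M t)‖) + cosBound := by
    nlinarith
  suffices hsuf : q * ‖perp e (M (t + 1))‖ ≤ 6 by
    rw [← hq2, ← mul_pow]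
    have : 0 ≤ q * ‖perp e (M (t + 1))‖ := by positivity
    nlinarith
  have hqx0 : 0 ≤ q * ‖perp e (M t)‖ := by positivity
  have hqx : (q * ‖perp e (M t)‖) ^ 2 = m * ‖perp e (M t)‖ ^ 2 := by rw [mul_pow, hq2]
  refine hqw.trans ?_
  rw [ratioSeq, R.step_early t ht]
  rcases le_or_gt 0 (shrink m (Λ * η 0) (cosine e (M t))) with hsh | hsh
  -- Here s ≥ 1/2, so a genuine contraction takes at least 2·`cosBound` off the threshold 6, more
  -- than the noise of one step.
  · have h6 : q * ‖perp e (M t)‖ ≤ 6 := by nlinarith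
    have hcos := cosBound_le_cosine_pow R.he (by have := R.hm; omega) hρ.1
      (by linarith : m * ‖perp e (M t)‖ ^ 2 ≤ 49)
    have hcos2 := hcos.trans (pow_le_pow_sub_two h0 h1)
    rw [abs_of_nonneg (ratio_nonneg hs0 h0 h1 hsh)]
    have h7 := ratio_le R.hm hs0 h0 h1
    have h8 : 1 / (1 + Λ * η 0 * cosine e (M t) ^ (m - 2)) ≤ 1 - cosBound / 3 := by
      rw [div_le_iff₀ (by positivity)]
      have : cosBound / 2 ≤ Λ * η 0 * cosine e (M t) ^ (m - 2) := by nlinarith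
      nlinarith
    have h9 : ratio m (Λ * η 0) (cosine e (M t)) * (q * ‖perp e (M t)‖) ≤ (1 - cosBound / 3) * 6 :=
      mul_le_mul (h7.trans h8) h6 hqx0 (by linarith)
    linarith
  -- The orthogonal part may now expand by up to 43/25, but a negative factor requires cos^m ≥
  -- 25/68, so √m‖perp‖ ≤ 2.6 and the image stays below 6.
  · have h7 := abs_ratio_le_of_shrink_neg hs0 h0 h1 hsh
    have hcos : 25 / 68 ≤ cosine e (M t) ^ m := by
      have hx := pow_nonneg h0 m
      have h2 : Λ * η 0 * (1 - 2 / m) * cosine e (M t) ^ m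
          ≤ 68 / 25 * cosine e (M t) ^ m := by
        have := one_sub_two_div_le m
        have h3 := one_sub_two_div_nonneg R.hm
        have : Λ * η 0 * (1 - 2 / m) ≤ 68 / 25 * 1 := by gcongr
        nlinarith
      rw [shrink] at hsh
      linarith
    have h8 := mul_norm_perp_sq_le R.he hρ0 (by norm_num) hcos
    have h9 : q * ‖perp e (M t)‖ ≤ 26 / 10 := by
      refine le_of_sq_le_sq ?_ (by norm_num)
      rw [hqx]
      refine h8.trans ?_
      norm_num
      nlinarith [hρ.1, hρ.2]
    have h10 : |ratio m (Λ * η 0) (cosine e (M t))| * (q * ‖perp e (M t)‖) ≤ 43 / 25 * (26 / 10) :=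
      mul_le_mul (by linarith) h9 hqx0 (by norm_num)
    linarith

/-- At the end of the first phase the iterate is aligned with the signal. -/
theorem first_phase (R : IsRun m T N D Λ e η M X) :
    (∀ t ≤ T, IsBounded D e M t) ∧ m * ‖perp e (M T)‖ ^ 2 ≤ 36 := by
  classical
  have hTN := R.hT
  have hbdd : ∀ t, IsEarly m D Λ e η M t → IsBounded D e M t := fun t h =>
    ⟨by linarith [(R.inner_bounds h.signal).1], (R.norm_le_of_isEarly' h).2⟩
  -- Either the potential argument covers the whole phase, or s·cos^m exceeds 1/2 at a first time τ.
  -- In the second case s ≤ 68/25 forces cos^m ≥ 25/136, so the iterate is aligned at τ already, and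
  -- `norm_perp_large_step` keeps it aligned.
  by_cases hc : ∀ u < T, Λ * η 0 * cosine e (M u) ^ m ≤ 1 / 2
  · exact ⟨fun t ht => hbdd t (R.isEarly ht fun u hu => hc u (by omega)),
      R.norm_perp_of_early hc⟩
  · push Not at hc
    obtain ⟨τ, ⟨hτT, hτ⟩, hmin⟩ : ∃ τ, (τ < T ∧ 1 / 2 < Λ * η 0 * cosine e (M τ) ^ m) ∧
        ∀ u < τ, ¬ (u < T ∧ 1 / 2 < Λ * η 0 * cosine e (M u) ^ m) :=
      ⟨Nat.find hc, Nat.find_spec hc, fun u hu => Nat.find_min hc hu⟩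
    have hE : ∀ t ≤ τ, IsEarly m D Λ e η M t := fun t ht =>
      R.isEarly (by omega) fun u hu => by
        by_contra hcon
        exact hmin u (by omega) ⟨by omega, lt_of_not_ge hcon⟩
    have hρ := R.inner_bounds (hE τ le_rfl).signal
    have hρ0 : 0 < ⟪M τ, e⟫ := by linarith [hρ.1]
    have hx : 0 ≤ cosine e (M τ) ^ m := pow_nonneg (cosine_nonneg hρ0.le) m
    have hx1 : cosine e (M τ) ^ m ≤ 1 := pow_le_one₀ (cosine_nonneg hρ0.le) (cosine_le_one R.he _)
    have hsl := R.step_le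
    have hs0 := R.rate_pos 0
    have hs : 1 / 2 ≤ Λ * η 0 := by nlinarith
    have hcos : 25 / 136 ≤ cosine e (M τ) ^ m := by nlinarith
    have hw : m * ‖perp e (M τ)‖ ^ 2 ≤ 36 := by
      refine (mul_norm_perp_sq_le R.he hρ0 (by norm_num) hcos).trans ?_
      norm_num
      nlinarith [hρ.1, hρ.2]
    have hind : ∀ t, τ ≤ t → t ≤ T → (∀ u ≤ t, IsBounded D e M u) ∧
        |⟪M t, e⟫ - 1| ≤ cosBound / m ∧ m * ‖perp e (M t)‖ ^ 2 ≤ 36 := by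
      intro t ht
      induction t, ht using Nat.le_induction with
      | base => exact fun _ => ⟨fun u hu => hbdd u (hE u hu), (hE τ le_rfl).signal, hw⟩
      | succ t ht ih =>
        intro htT
        obtain ⟨hB, hsig, hwt⟩ := ih (by omega)
        have hw' := R.norm_perp_large_step (by omega) hs hsig hwt
        have hsig' := R.abs_inner_sub_one_le (t := t + 1) (by omega) fun u hu => hB u (by omega)
        refine ⟨fun u hu => ?_, hsig', hw'⟩
        rcases Nat.lt_or_eq_of_le hu with hu | rfl
        · exact hB u (by omega)
        · exact R.isBounded_of_perp hsig' (by linarith)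
    obtain ⟨hB, -, hwT⟩ := hind T hτT.le le_rfl
    exact ⟨hB, hwT⟩

/-- After the halving s ≤ 34/25, so even a negative factor has absolute value at most 9/25.
Otherwise α^(m-2) ≥ α^m ≥ `cosBound` gives the contraction. -/
theorem abs_ratioSeq_le (R : IsRun m T N D Λ e η M X) {t : ℕ} (ht : T ≤ t)
    (h : |⟪M t, e⟫ - 1| ≤ cosBound / m) (hw : m * ‖perp e (M t)‖ ^ 2 ≤ 49) :
    |ratioSeq m Λ e η M t| ≤ 1 - cosBound / 3 * (Λ * η t) := by
  have hρ := R.inner_bounds h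
  have hρ0 : 0 < ⟪M t, e⟫ := by linarith [hρ.1]
  have h0 : 0 ≤ cosine e (M t) := cosine_nonneg hρ0.le
  have h1 := cosine_le_one R.he (M t)
  have hs0 := (R.rate_pos t).le
  have hc := cosBound_pos
  have hc' := cosBound_le
  have hsl : Λ * η t ≤ 34 / 25 := by
    have := R.step_le
    have h2 := R.step_late t ht
    have := R.hΛ
    nlinarith
  rw [ratioSeq]
  rcases le_or_gt 0 (shrink m (Λ * η t) (cosine e (M t))) with hsh | hsh
  · have hcos := cosBound_le_cosine_pow R.he (by have := R.hm; omega) hρ.1 hw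
    have hcos2 := hcos.trans (pow_le_pow_sub_two h0 h1)
    rw [abs_of_nonneg (ratio_nonneg hs0 h0 h1 hsh)]
    refine (ratio_le R.hm hs0 h0 h1).trans ?_
    have h3 : Λ * η t * cosBound ≤ Λ * η t * cosine e (M t) ^ (m - 2) := by gcongr
    rw [div_le_iff₀ (by positivity)]
    have h4 : 0 ≤ Λ * η t * cosBound := by positivity
    have h5 : Λ * η t * cosBound ≤ 34 / 25 * (1 / 27) := by gcongr
    nlinarith
  · have h7 := abs_ratio_le_of_shrink_neg hs0 h0 h1 hsh
    nlinarith

/-- The orthogonal part after the first phase. -/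
theorem late_phase (R : IsRun m T N D Λ e η M X) {t : ℕ} (hTt : T ≤ t) (htN : t ≤ N) :
    (∀ u ≤ t, IsBounded D e M u) ∧ |⟪M t, e⟫ - 1| ≤ cosBound / m ∧
      m * ‖perp e (M t)‖ ^ 2 ≤ 49 := by
  induction t using Nat.strong_induction_on with
  | _ t ih =>
  have hTN := R.hT
  have hm := R.two_le
  have hB : ∀ u < t, IsBounded D e M u := by
    intro u hu
    rcases le_or_gt u T with h | h
    · exact R.first_phase.1 u h
    · exact (ih u hu (by omega) (by omega)).1 u le_rfl
  have hsig := R.abs_inner_sub_one_le htN hB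
  have hlate : ∀ u, T ≤ u → u < t → |⟪M u, e⟫ - 1| ≤ cosBound / m ∧
      m * ‖perp e (M u)‖ ^ 2 ≤ 49 := fun u h1 h2 => (ih u h2 h1 (by omega)).2
  have hrat : ∀ u, T ≤ u → u < t → |ratioSeq m Λ e η M u| ≤ 1 := fun u h1 h2 => by
    have h3 := R.abs_ratioSeq_le h1 (hlate u h1 h2).1 (hlate u h1 h2).2
    have := R.rate_pos u
    have := cosBound_pos
    have : 0 ≤ cosBound / 3 * (Λ * η u) := by positivity
    linarith
  have key := eq_prod_smul_add_ar (c := lateCoeff m Λ e η M) (g := lateGain m Λ e η M)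
    (Y := fun u => perp e (X u)) (Z := fun u => perp e (M u)) hTt (by
      intro u h1 h2
      rw [R.lateGain_eq (hlate u h1 h2).1 (hlate u h1 h2).2, lateCoeff,
        clip_of_abs_le (hrat u h1 h2)]
      exact R.perp_succ u)
  rw [← map_ar] at key
  have hprod : |∏ u ∈ Finset.Ico T t, lateCoeff m Λ e η M u| ≤ 1 := by
    rw [Finset.abs_prod]
    exact Finset.prod_le_one (fun _ _ => abs_nonneg _) fun u _ => abs_clip_le zero_le_one _
  have hw : m * ‖perp e (M t)‖ ^ 2 ≤ 49 := by
    have h1 := R.first_phase.2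
    have h2 := R.noise_late T (by omega) t htN
    have h3 : ‖perp e (M t)‖ ≤ ‖perp e (M T)‖ + cosBound / m := by
      rw [key]
      refine (norm_add_le _ _).trans ?_
      rw [norm_smul, Real.norm_eq_abs]
      nlinarith [norm_nonneg (perp e (M T))]
    have hc := cosBound_pos
    have hc' := cosBound_le
    have h4 : m * (cosBound / m) ^ 2 ≤ 1 / 36 := by
      have : m * (cosBound / m) ^ 2 = cosBound ^ 2 / m := by field_simp
      rw [this, div_le_iff₀ (by linarith)]
      nlinarith
    calc m * ‖perp e (M t)‖ ^ 2 ≤ m * (‖perp e (M T)‖ + cosBound / m) ^ 2 := by gcongr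
      -- Weighted Young inequality: 7/6·36 = 42 leaves room for the noise below 49.
      _ ≤ m * (7 / 6 * ‖perp e (M T)‖ ^ 2 + 7 * (cosBound / m) ^ 2) := by
        gcongr
        nlinarith [sq_nonneg (‖perp e (M T)‖ - 6 * (cosBound / m))]
      _ ≤ 49 := by linarith
  refine ⟨fun u hu => ?_, hsig, hw⟩
  rcases Nat.lt_or_eq_of_le hu with hu | rfl
  · exact hB u hu
  · exact R.isBounded_of_perp hsig hw

theorem isBounded (R : IsRun m T N D Λ e η M X) {t : ℕ} (ht : t ≤ N) :
    0 ≤ ⟪M t, e⟫ ∧ ‖M t‖ ≤ 4 * √D := by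
  have := R.hT
  exact (R.late_phase (t := N) (by omega) le_rfl).1 t ht

theorem inner_ge (R : IsRun m T N D Λ e η M X) {t : ℕ} (ht : t ≤ N) : 53 / 54 ≤ ⟪M t, e⟫ :=
  (R.inner_bounds (R.abs_inner_sub_one_le ht fun _ hu => R.isBounded (by omega))).1

/-- The final orthogonal part: an exponentially small multiple of a bounded vector, plus noise. -/
theorem final (R : IsRun m T N D Λ e η M X) :
    ∃ π : ℝ, |π| ≤ Real.exp (-(cosBound / 6 * (T * (Λ * η 0)))) ∧ ‖perp e (M T)‖ ≤ 5 ∧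
      ‖perp e (M N)‖ ≤ 5 * |π| + cosBound / m ∧
      perp e (M N) = π • perp e (M T)
        + perp e (ar (fineCoeff m Λ e η M) (lateGain m Λ e η M) X T N) := by
  have hTN := R.hT
  have hlate : ∀ u, T ≤ u → u < N → |⟪M u, e⟫ - 1| ≤ cosBound / m ∧
      m * ‖perp e (M u)‖ ^ 2 ≤ 49 := fun u h1 h2 => (R.late_phase h1 h2.le).2
  have hrat : ∀ u, T ≤ u → u < N →
      |ratioSeq m Λ e η M u| ≤ 1 - cosBound / 3 * (Λ * η u) := fun u h1 h2 =>
    R.abs_ratioSeq_le h1 (hlate u h1 h2).1 (hlate u h1 h2).2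
  have hc := cosBound_pos
  have hpos : ∀ u, 0 ≤ cosBound / 3 * (Λ * η u) := fun u => by
    have := R.rate_pos u
    positivity
  have key := eq_prod_smul_add_ar (c := fineCoeff m Λ e η M) (g := lateGain m Λ e η M)
    (Y := fun u => perp e (X u)) (Z := fun u => perp e (M u)) (by omega : T ≤ N) (by
      intro u h1 h2
      rw [R.lateGain_eq (hlate u h1 h2).1 (hlate u h1 h2).2, fineCoeff,
        clip_of_abs_le (hrat u h1 h2)]
      exact R.perp_succ u)
  -- The same expansion with the weaker truncation: `noise_late` bounds this process in norm.
  have key2 := eq_prod_smul_add_ar (c := lateCoeff m Λ e η M) (g := lateGain m Λ e η M)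
    (Y := fun u => perp e (X u)) (Z := fun u => perp e (M u)) (by omega : T ≤ N) (by
      intro u h1 h2
      rw [R.lateGain_eq (hlate u h1 h2).1 (hlate u h1 h2).2, lateCoeff,
        clip_of_abs_le ((hrat u h1 h2).trans (by linarith [hpos u]))]
      exact R.perp_succ u)
  rw [← map_ar] at key key2
  have hpc : ∀ u ∈ Finset.Ico T N, lateCoeff m Λ e η M u = fineCoeff m Λ e η M u := by
    intro u hu
    rw [Finset.mem_Ico] at hu
    rw [fineCoeff, lateCoeff, clip_of_abs_le (hrat u hu.1 hu.2),
      clip_of_abs_le ((hrat u hu.1 hu.2).trans (by linarith [hpos u]))]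
  rw [Finset.prod_congr rfl hpc] at key2
  have hfine : ∀ u ∈ Finset.Ico T N,
      |fineCoeff m Λ e η M u| ≤ 1 - cosBound / 3 * (Λ * η u) := by
    intro u hu
    rw [Finset.mem_Ico] at hu
    rw [fineCoeff, clip_of_abs_le (hrat u hu.1 hu.2)]
    exact hrat u hu.1 hu.2
  have h5 : ‖perp e (M T)‖ ≤ 5 :=
    R.norm_perp_le_of_mul_sq_le (by norm_num) (by linarith [R.first_phase.2])
  refine ⟨∏ u ∈ Finset.Ico T N, fineCoeff m Λ e η M u, ?_, h5, ?_, key⟩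
  -- Only the second phase, with step size exactly η₀/2, is used for the exponential decay; the
  -- later factors are at most 1.
  · rw [Finset.abs_prod, ← Finset.prod_Ico_consecutive _ (by omega : T ≤ 2 * T) hTN]
    have h1 : ∏ u ∈ Finset.Ico (2 * T) N, |fineCoeff m Λ e η M u| ≤ 1 :=
      Finset.prod_le_one (fun _ _ => abs_nonneg _) fun u hu => by
        rw [Finset.mem_Ico] at hu
        exact (hfine u (Finset.mem_Ico.2 ⟨by omega, hu.2⟩)).trans (by linarith [hpos u])
    have h2 : ∏ u ∈ Finset.Ico T (2 * T), |fineCoeff m Λ e η M u|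
        ≤ ∏ u ∈ Finset.Ico T (2 * T), Real.exp (-(cosBound / 6 * (Λ * η 0))) := by
      refine Finset.prod_le_prod (fun _ _ => abs_nonneg _) fun u hu => ?_
      rw [Finset.mem_Ico] at hu
      refine (hfine u (Finset.mem_Ico.2 ⟨hu.1, by omega⟩)).trans ?_
      rw [R.step_mid u hu.1 hu.2]
      have := Real.add_one_le_exp (-(cosBound / 6 * (Λ * η 0)))
      linarith
    rw [Finset.prod_const, Nat.card_Ico, show 2 * T - T = T by omega, ← Real.exp_nat_mul] at h2
    have h3 : 0 ≤ ∏ u ∈ Finset.Ico T (2 * T), |fineCoeff m Λ e η M u| :=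
      Finset.prod_nonneg fun _ _ => abs_nonneg _
    calc _ ≤ _ * 1 := mul_le_mul_of_nonneg_left h1 h3
      _ ≤ Real.exp (T * -(cosBound / 6 * (Λ * η 0))) := by rw [mul_one]; exact h2
      _ = _ := by congr 1; ring
  · rw [key2]
    refine (norm_add_le _ _).trans ?_
    rw [norm_smul, Real.norm_eq_abs]
    have := R.noise_late T (by omega) N le_rfl
    have h6 := abs_nonneg (∏ u ∈ Finset.Ico T N, fineCoeff m Λ e η M u)
    nlinarith

end IsRun
end LatePhase
end TensorPCA
end
-- Concentration for adapted autoregressive processes.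
noncomputable section
namespace TensorPCA
open scoped RealInnerProductSpace

section Concentration
variable {Ω : Type*} {mΩ : MeasurableSpace Ω} {μ : Measure Ω}
  {k d N : ℕ} {σ : ℝ} {E : ℕ → Ω → Tensor k d}

/-- The information of the first `t` observations. -/
@[reducible] def past (N : ℕ) (E : ℕ → Ω → Tensor k d) (t : ℕ) : MeasurableSpace Ω :=
  ⨆ s ∈ {s : Fin N | s.1 < t}, MeasurableSpace.comap (E s) inferInstance

theorem past_mono {s t : ℕ} (h : s ≤ t) : past N E s ≤ past N E t :=
  biSup_mono fun i (hi : i.1 < s) => show i.1 < t from hi.trans_le h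

theorem measurable_past {s t : ℕ} (hst : s < t) (hs : s < N) : Measurable[past N E t] (E s) := by
  have h : MeasurableSpace.comap (E s) inferInstance ≤ past N E t :=
    le_biSup (fun s : Fin N => MeasurableSpace.comap (E s) inferInstance)
      (show (⟨s, hs⟩ : Fin N) ∈ {s : Fin N | s.1 < t} from hst)
  exact Measurable.mono (comap_measurable (E s)) h le_rfl

namespace IsIIDSubGaussianNoise

theorem past_le (hE : IsIIDSubGaussianNoise μ N σ E) (t : ℕ) : past N E t ≤ mΩ :=
  iSup₂_le fun s _ => (hE.measurable s s.2).comap_le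

theorem indepFun_past (hE : IsIIDSubGaussianNoise μ N σ E) {t : ℕ} (ht : t < N) {β : Type*}
    [MeasurableSpace β] {f : Ω → β} (hf : Measurable[past N E t] f) : IndepFun f (E t) μ := by
  have h := indep_iSup_of_disjoint (m := fun s : Fin N => MeasurableSpace.comap (E s) inferInstance)
    (fun s => (hE.measurable s s.2).comap_le) hE.indep
    (S := {s : Fin N | s.1 < t}) (T := {⟨t, ht⟩}) (by simp)
  rw [iSup_singleton] at h
  rw [IndepFun_iff_Indep]
  exact indep_of_indep_of_le_left h hf.comap_le

theorem lintegral_exp_le (hE : IsIIDSubGaussianNoise μ N σ E) {t : ℕ} (ht : t < N)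
    (u : Tensor k d) :
    ∫⁻ ω, ENNReal.ofReal (Real.exp (tensorInner u (E t ω))) ∂μ
      ≤ ENNReal.ofReal (Real.exp (σ ^ 2 * tensorInner u u)) := by
  rw [← ofReal_integral_eq_lintegral_ofReal (hE.integrable_exp t ht u)
    (Filter.Eventually.of_forall fun _ => (Real.exp_pos _).le)]
  exact ENNReal.ofReal_le_ofReal (hE.mgf_le t ht u)

end IsIIDSubGaussianNoise

theorem continuous_tensorInner :
    Continuous fun p : Tensor k d × Tensor k d => tensorInner p.1 p.2 := by
  unfold tensorInner; fun_prop

theorem measurable_tensorInner :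
    Measurable fun p : Tensor k d × Tensor k d => tensorInner p.1 p.2 :=
  continuous_tensorInner.measurable

/-- The sub-Gaussian tail bound that follows from a bound for `cosh`. -/
theorem measure_abs_gt_le {q : Ω → ℝ} (hσ : 0 < σ) {V ℓ : ℝ} (hV : 0 < V)
    (hℓ : 0 ≤ ℓ)
    (h : ∀ θ : ℝ, ∫⁻ ω, ENNReal.ofReal (Real.cosh (θ * q ω)) ∂μ
      ≤ ENNReal.ofReal (Real.exp (θ ^ 2 * σ ^ 2 * V))) (hq : Measurable q) :
    μ {ω | 2 * σ * √(V * ℓ) < |q ω|} ≤ ENNReal.ofReal (2 * Real.exp (-ℓ)) := by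
  -- With this θ the moment bound is e^ℓ and the event means cosh ≥ cosh(2ℓ) ≥ e^(2ℓ)/2, so Markov's
  -- inequality gives 2e^(-ℓ).
  set θ := √ℓ / (σ * √V)
  have hsV : 0 < √V := Real.sqrt_pos.2 hV
  have hθ0 : 0 ≤ θ := by positivity
  have h1 : θ ^ 2 * σ ^ 2 * V = ℓ := by
    simp only [θ, div_pow, mul_pow, Real.sq_sqrt hℓ, Real.sq_sqrt hV.le]
    field_simp
  have h2 : θ * (2 * σ * √(V * ℓ)) = 2 * ℓ := by
    rw [Real.sqrt_mul hV.le]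
    simp only [θ]
    field_simp
    rw [Real.sq_sqrt hℓ]
  have hsub : {ω | 2 * σ * √(V * ℓ) < |q ω|}
      ⊆ {ω | ENNReal.ofReal (Real.cosh (2 * ℓ)) ≤ ENNReal.ofReal (Real.cosh (θ * q ω))} := by
    intro ω hω
    refine ENNReal.ofReal_le_ofReal ?_
    rw [Real.cosh_le_cosh, ← h2, abs_mul θ, abs_mul θ, abs_of_nonneg hθ0,
      abs_of_nonneg (by positivity : 0 ≤ 2 * σ * √(V * ℓ))]
    exact mul_le_mul_of_nonneg_left (le_of_lt hω) hθ0
  refine (measure_mono hsub).trans ?_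
  have hpos : 0 < Real.cosh (2 * ℓ) := Real.cosh_pos _
  refine (meas_ge_le_lintegral_div ?_ ?_ ENNReal.ofReal_ne_top).trans ?_
  · exact (Real.continuous_cosh.measurable.comp (hq.const_mul _)).ennreal_ofReal.aemeasurable
  · rw [Ne, ENNReal.ofReal_eq_zero]; linarith
  · have h3 := h θ
    rw [h1] at h3
    refine (ENNReal.div_le_div_right h3 _).trans ?_
    rw [← ENNReal.ofReal_div_of_pos hpos]
    refine ENNReal.ofReal_le_ofReal ?_
    rw [div_le_iff₀ hpos, Real.cosh_eq]
    have h4 : Real.exp (-ℓ) * Real.exp (2 * ℓ) = Real.exp ℓ := by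
      rw [← Real.exp_add]; congr 1; ring
    have h5 := Real.exp_pos (-ℓ)
    have h6 := Real.exp_pos (-(2 * ℓ))
    nlinarith [mul_pos h5 h6]

namespace IsIIDSubGaussianNoise

/-- Split cosh into its two exponentials and use the moment bound at u and at -u; the odd parts
recombine to cosh a. Since cosh is even and increasing in |x|, it later allows random coefficients
to be replaced by their bounds, which a single exponential does not. -/
theorem lintegral_cosh_le (hE : IsIIDSubGaussianNoise μ N σ E) {t : ℕ} (ht : t < N) (a : ℝ)
    (u : Tensor k d) :
    ∫⁻ ω, ENNReal.ofReal (Real.cosh (a + tensorInner u (E t ω))) ∂μ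
      ≤ ENNReal.ofReal (Real.cosh a * Real.exp (σ ^ 2 * tensorInner u u)) := by
  have hneg : ∀ T : Tensor k d, tensorInner (-u) T = -tensorInner u T := fun T => by
    simp [tensorInner]
  have hself : tensorInner (-u) (-u) = tensorInner u u := by simp [tensorInner]
  have h1 : ∀ ω, ENNReal.ofReal (Real.cosh (a + tensorInner u (E t ω)))
      = ENNReal.ofReal (Real.exp a / 2) * ENNReal.ofReal (Real.exp (tensorInner u (E t ω)))
        + ENNReal.ofReal (Real.exp (-a) / 2)
          * ENNReal.ofReal (Real.exp (tensorInner (-u) (E t ω))) := by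
    intro ω
    rw [← ENNReal.ofReal_mul (by positivity), ← ENNReal.ofReal_mul (by positivity),
      ← ENNReal.ofReal_add (by positivity) (by positivity), hneg, Real.cosh_eq, neg_add,
      Real.exp_add, Real.exp_add]
    congr 1; ring
  have hm : ∀ w : Tensor k d,
      Measurable fun ω => ENNReal.ofReal (Real.exp (tensorInner w (E t ω))) := fun w =>
    (Real.measurable_exp.comp (measurable_tensorInner.comp
      (measurable_const.prodMk (hE.measurable t ht)))).ennreal_ofReal
  simp only [h1]
  rw [lintegral_add_left ((hm u).const_mul _), lintegral_const_mul _ (hm u),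
    lintegral_const_mul _ (hm (-u))]
  have h2 := hE.lintegral_exp_le ht u
  have h3 := hE.lintegral_exp_le ht (-u)
  rw [hself] at h3
  calc _ ≤ ENNReal.ofReal (Real.exp a / 2) * ENNReal.ofReal (Real.exp (σ ^ 2 * tensorInner u u))
        + ENNReal.ofReal (Real.exp (-a) / 2)
          * ENNReal.ofReal (Real.exp (σ ^ 2 * tensorInner u u)) := by gcongr
    _ = _ := by
      rw [← ENNReal.ofReal_mul (by positivity), ← ENNReal.ofReal_mul (by positivity),
        ← ENNReal.ofReal_add (by positivity) (by positivity), Real.cosh_eq]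
      congr 1; ring

variable [IsProbabilityMeasure μ]

/-- The conditional form of `lintegral_cosh_le`, for coefficients that depend on the past. -/
theorem lintegral_cosh_adapted_le (hE : IsIIDSubGaussianNoise μ N σ E) {t : ℕ} (ht : t < N)
    {a : Ω → ℝ} {u : Ω → Tensor k d} (ha : Measurable[past N E t] a)
    (hu : Measurable[past N E t] u) :
    ∫⁻ ω, ENNReal.ofReal (Real.cosh (a ω + tensorInner (u ω) (E t ω))) ∂μ
      ≤ ∫⁻ ω, ENNReal.ofReal
        (Real.cosh (a ω) * Real.exp (σ ^ 2 * tensorInner (u ω) (u ω))) ∂μ := by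
  have hp : Measurable[past N E t] fun ω => (a ω, u ω) := ha.prodMk hu
  have hp' : Measurable fun ω => (a ω, u ω) := hp.mono (hE.past_le t) le_rfl
  have hE' := hE.measurable t ht
  have hmap := (indepFun_iff_map_prod_eq_prod_map_map hp'.aemeasurable hE'.aemeasurable).1
    (hE.indepFun_past ht hp)
  have hF : Measurable fun q : (ℝ × Tensor k d) × Tensor k d =>
      ENNReal.ofReal (Real.cosh (q.1.1 + tensorInner q.1.2 q.2)) := by
    have : Continuous fun q : (ℝ × Tensor k d) × Tensor k d =>
        Real.cosh (q.1.1 + tensorInner q.1.2 q.2) := by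
      refine Real.continuous_cosh.comp ((by fun_prop : Continuous fun q :
        (ℝ × Tensor k d) × Tensor k d => q.1.1).add ?_)
      exact continuous_tensorInner.comp (by fun_prop :
        Continuous fun q : (ℝ × Tensor k d) × Tensor k d => (q.1.2, q.2))
    exact this.measurable.ennreal_ofReal
  have h1 : ∫⁻ ω, ENNReal.ofReal (Real.cosh (a ω + tensorInner (u ω) (E t ω))) ∂μ
      = ∫⁻ q, ENNReal.ofReal (Real.cosh (q.1.1 + tensorInner q.1.2 q.2))
        ∂(μ.map fun ω => ((a ω, u ω), E t ω)) := by
    rw [lintegral_map hF (hp'.prodMk hE')]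
  -- Independence makes the joint law a product, so the past can be frozen while integrating over
  -- the fresh sample.
  rw [h1, hmap, lintegral_prod _ hF.aemeasurable, lintegral_map hF.lintegral_prod_right' hp']
  refine lintegral_mono fun ω => ?_
  simp only
  have h2 : Measurable fun y : Tensor k d =>
      ENNReal.ofReal (Real.cosh (a ω + tensorInner (u ω) y)) :=
    (Real.continuous_cosh.measurable.comp ((measurable_tensorInner.comp
      (measurable_const.prodMk measurable_id)).const_add _)).ennreal_ofReal
  rw [lintegral_map h2 hE']
  exact hE.lintegral_cosh_le ht (a ω) (u ω)

/-- Exponential moments of an autoregressive process with predictable coefficients. -/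
theorem lintegral_cosh_ar_le (hE : IsIIDSubGaussianNoise μ N σ E) {r : ℕ} {q c : ℕ → Ω → ℝ}
    {u : ℕ → Ω → Tensor k d} {cbar b V : ℕ → ℝ}
    (hq : ∀ t ≤ N, Measurable[past N E t] (q t)) (hc : ∀ t < N, Measurable[past N E t] (c t))
    (hu : ∀ t < N, Measurable[past N E t] (u t)) (hr : ∀ ω, q r ω = 0)
    (hrec : ∀ t, r ≤ t → t < N → ∀ ω, q (t + 1) ω = c t ω * q t ω + tensorInner (u t ω) (E t ω))
    (hcb : ∀ t, r ≤ t → t < N → ∀ ω, |c t ω| ≤ cbar t)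
    (hub : ∀ t, r ≤ t → t < N → ∀ ω, tensorInner (u t ω) (u t ω) ≤ b t)
    (hV0 : 0 ≤ V r) (hV : ∀ t, r ≤ t → t < N → cbar t ^ 2 * V t + b t ≤ V (t + 1))
    {t : ℕ} (hrt : r ≤ t) (htN : t ≤ N) (θ : ℝ) :
    ∫⁻ ω, ENNReal.ofReal (Real.cosh (θ * q t ω)) ∂μ
      ≤ ENNReal.ofReal (Real.exp (θ ^ 2 * σ ^ 2 * V t)) := by
  -- θ has to vary: the step uses the hypothesis at θ·`cbar t`.
  induction t, hrt using Nat.le_induction generalizing θ with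
  | base =>
    simp only [hr, mul_zero, Real.cosh_zero, ENNReal.ofReal_one, lintegral_const, measure_univ,
      mul_one]
    rw [ENNReal.one_le_ofReal, Real.one_le_exp_iff]
    positivity
  | succ t hrt ih =>
    have htN' : t < N := htN
    have h1 : ∀ ω, θ * q (t + 1) ω
        = θ * (c t ω * q t ω) + tensorInner (θ • u t ω) (E t ω) := fun ω => by
      rw [hrec t hrt htN', tensorInner_smul_left]; ring
    simp only [h1]
    refine (hE.lintegral_cosh_adapted_le htN'
      (((hc t htN').mul (hq t htN'.le)).const_mul θ) ((hu t htN').const_smul θ)).trans ?_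
    have h2 : ∀ ω, Real.cosh (θ * (c t ω * q t ω))
        * Real.exp (σ ^ 2 * tensorInner (θ • u t ω) (θ • u t ω))
        ≤ Real.exp (σ ^ 2 * θ ^ 2 * b t) * Real.cosh (θ * cbar t * q t ω) := by
      intro ω
      rw [mul_comm]
      have hcosh : Real.cosh (θ * (c t ω * q t ω)) ≤ Real.cosh (θ * cbar t * q t ω) := by
        rw [Real.cosh_le_cosh]
        simp only [abs_mul]
        rw [← mul_assoc]
        have := hcb t hrt htN' ω
        exact mul_le_mul_of_nonneg_right (mul_le_mul_of_nonneg_left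
          (this.trans (le_abs_self _)) (abs_nonneg _)) (abs_nonneg _)
      have hexp : σ ^ 2 * tensorInner (θ • u t ω) (θ • u t ω) ≤ σ ^ 2 * θ ^ 2 * b t := by
        rw [tensorInner_smul_left, tensorInner_smul_right]
        have := hub t hrt htN' ω
        calc σ ^ 2 * (θ * (θ * tensorInner (u t ω) (u t ω)))
            = σ ^ 2 * θ ^ 2 * tensorInner (u t ω) (u t ω) := by ring
          _ ≤ _ := by gcongr
      have := (Real.cosh_pos (θ * (c t ω * q t ω))).le
      gcongr
    calc _ ≤ ∫⁻ ω, ENNReal.ofReal (Real.exp (σ ^ 2 * θ ^ 2 * b t))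
          * ENNReal.ofReal (Real.cosh (θ * cbar t * q t ω)) ∂μ := by
          refine lintegral_mono fun ω => ?_
          rw [← ENNReal.ofReal_mul (Real.exp_pos _).le]
          exact ENNReal.ofReal_le_ofReal (h2 ω)
      _ = ENNReal.ofReal (Real.exp (σ ^ 2 * θ ^ 2 * b t))
          * ∫⁻ ω, ENNReal.ofReal (Real.cosh (θ * cbar t * q t ω)) ∂μ := by
          rw [lintegral_const_mul]
          exact (Real.continuous_cosh.measurable.comp (((hq t htN'.le).mono
            (hE.past_le t) le_rfl).const_mul _)).ennreal_ofReal
      _ ≤ ENNReal.ofReal (Real.exp (σ ^ 2 * θ ^ 2 * b t))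
          * ENNReal.ofReal (Real.exp ((θ * cbar t) ^ 2 * σ ^ 2 * V t)) := by
          gcongr
          exact ih htN'.le _
      _ ≤ _ := by
          rw [← ENNReal.ofReal_mul (Real.exp_pos _).le, ← Real.exp_add]
          refine ENNReal.ofReal_le_ofReal (Real.exp_le_exp.2 ?_)
          have h3 := hV t hrt htN'
          have h4 : 0 ≤ θ ^ 2 * σ ^ 2 := by positivity
          nlinarith

end IsIIDSubGaussianNoise
end Concentration
end TensorPCA
end
-- The normalised iteration and its measurability.
noncomputable section
namespace TensorPCA
open scoped RealInnerProductSpace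

section Recursion
variable {k d : ℕ}

/-- The identity matrix. -/
def oneMat (d : ℕ) : MatSpace d := WithLp.toLp 2 fun p => if p.1 = p.2 then 1 else 0

/-- The iterates of the algorithm, rescaled so that the noiseless signal part is constant. -/
def normIter (lam : ℝ) (v : EuclideanSpace ℝ (Fin d)) (η : ℕ → ℝ) (E : ℕ → Tensor k d) :
    ℕ → MatSpace d
  | 0 => oneMat d
  | t + 1 => normStep (k / 2) (lam * (k / 2 : ℕ) * η t) (η t) (outer v v) (normIter lam v η E t)
      (noiseDir (‖normIter lam v η E t‖⁻¹ • normIter lam v η E t) (E t))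

/-- The noise directions along `normIter`. -/
def normNoise (lam : ℝ) (v : EuclideanSpace ℝ (Fin d)) (η : ℕ → ℝ) (E : ℕ → Tensor k d) (t : ℕ) :
    MatSpace d :=
  noiseDir (‖normIter lam v η E t‖⁻¹ • normIter lam v η E t) (E t)

theorem continuous_noiseTensor (u : MatSpace d) : Continuous fun h => noiseTensor k h u := by
  refine continuous_pi fun I => ?_
  simp only [noiseTensor, Pi.sub_apply, Pi.smul_apply, smul_eq_mul, matPow_asMat, dPow]
  refine Continuous.sub ?_ ?_
  · refine continuous_finsetSum _ fun l _ => continuous_finsetProd _ fun l' _ => ?_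
    split_ifs <;> fun_prop
  · fun_prop

theorem continuous_noiseDir :
    Continuous fun p : MatSpace d × Tensor k d => noiseDir p.1 p.2 := by
  refine (PiLp.continuous_toLp 2 _).comp (continuous_pi fun q => ?_)
  exact continuous_tensorInner.comp
    (((continuous_noiseTensor _).comp continuous_fst).prodMk continuous_snd)

theorem measurable_cosine (e : MatSpace d) : Measurable (cosine e) := by
  unfold cosine
  exact (Continuous.measurable (by fun_prop)).div measurable_norm

theorem measurable_growth (m : ℕ) (s : ℝ) : Measurable (growth m s) := by
  unfold growth shrink; fun_prop

theorem measurable_ratio (m : ℕ) (s : ℝ) : Measurable (ratio m s) := by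
  unfold ratio growth shrink; fun_prop

theorem measurable_gain (m : ℕ) (s η : ℝ) (e : MatSpace d) : Measurable (gain m s η e) := by
  unfold gain
  exact (measurable_norm.const_mul _).div ((measurable_growth m s).comp (measurable_cosine e))

theorem measurable_normalize : Measurable fun M : MatSpace d => ‖M‖⁻¹ • M :=
  measurable_norm.inv.smul measurable_id

theorem measurable_noiseDir :
    Measurable fun p : MatSpace d × Tensor k d => noiseDir p.1 p.2 :=
  continuous_noiseDir.measurable

theorem measurable_noiseDir_normalize :
    Measurable fun p : MatSpace d × Tensor k d => noiseDir (‖p.1‖⁻¹ • p.1) p.2 := by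
  have h := (measurable_noiseDir (k := k) (d := d)).comp
    ((measurable_normalize.comp measurable_fst).prodMk measurable_snd)
  exact h

theorem measurable_normStep (m : ℕ) (s η : ℝ) (e : MatSpace d) :
    Measurable fun p : MatSpace d × MatSpace d => normStep m s η e p.1 p.2 := by
  have h1 : Measurable fun p : MatSpace d × MatSpace d => ratio m s (cosine e p.1) :=
    (measurable_ratio m s).comp ((measurable_cosine e).comp measurable_fst)
  have h2 : Measurable fun p : MatSpace d × MatSpace d =>
      η * ‖p.1‖ / growth m s (cosine e p.1) := (measurable_gain m s η e).comp measurable_fst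
  have h3 : Measurable fun p : MatSpace d × MatSpace d => ⟪p.1, e⟫ :=
    Continuous.measurable (by fun_prop)
  have h4 := h1.smul (measurable_fst : Measurable fun p : MatSpace d × MatSpace d => p.1)
  have h5 := ((h1.const_sub 1).mul h3).smul_const e
  have h6 := h2.smul (measurable_snd : Measurable fun p : MatSpace d × MatSpace d => p.2)
  exact (h4.add h5).add h6

theorem measurable_clip (B : ℝ) : Measurable (clip B) := by
  unfold clip
  exact Measurable.ite (measurableSet_le measurable_norm measurable_const) measurable_id
    measurable_const

variable {Ω : Type*} {mΩ : MeasurableSpace Ω} {μ : Measure Ω} {N : ℕ} {σ : ℝ}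
  {E : ℕ → Ω → Tensor k d} {lam : ℝ} {v : EuclideanSpace ℝ (Fin d)} {η : ℕ → ℝ}

theorem normIter_succ (E : ℕ → Tensor k d) (t : ℕ) :
    normIter lam v η E (t + 1) = normStep (k / 2) (lam * (k / 2 : ℕ) * η t) (η t) (outer v v)
      (normIter lam v η E t) (normNoise lam v η E t) := rfl

theorem measurable_normNoise_of {t : ℕ} (ht : t < N)
    (h : Measurable[past N E t] fun ω => normIter lam v η (fun s => E s ω) t) :
    Measurable[past N E (t + 1)] fun ω => normNoise lam v η (fun s => E s ω) t := by
  have h1 := h.mono (past_mono (Nat.le_succ t)) le_rfl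
  have h2 : Measurable[past N E (t + 1)] (E t) := measurable_past (Nat.lt_succ_self t) ht
  have h3 := (measurable_noiseDir_normalize (k := k) (d := d)).comp (h1.prodMk h2)
  exact h3

theorem measurable_normIter {t : ℕ} (ht : t ≤ N) :
    Measurable[past N E t] fun ω => normIter lam v η (fun s => E s ω) t := by
  induction t with
  | zero => exact measurable_const
  | succ t ih =>
    have h1 := (ih (by omega)).mono (past_mono (Nat.le_succ t)) le_rfl
    have h2 := measurable_normNoise_of ht (ih (by omega))
    have h3 := (measurable_normStep (k / 2) (lam * (k / 2 : ℕ) * η t) (η t) (outer v v)).comp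
      (h1.prodMk h2)
    simp only [normIter_succ]
    exact h3

theorem measurable_normNoise {t : ℕ} (ht : t < N) :
    Measurable[past N E (t + 1)] fun ω => normNoise lam v η (fun s => E s ω) t :=
  measurable_normNoise_of ht (measurable_normIter ht.le)

theorem measurable_ratioSeq (Λ : ℝ) (m : ℕ) (e : MatSpace d) {t : ℕ} (ht : t ≤ N) :
    Measurable[past N E t] fun ω =>
      ratioSeq m Λ e η (normIter lam v η fun s => E s ω) t :=
  (measurable_ratio m _).comp ((measurable_cosine e).comp (measurable_normIter ht))

theorem measurable_gainSeq (Λ : ℝ) (m : ℕ) (e : MatSpace d) {t : ℕ} (ht : t ≤ N) :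
    Measurable[past N E t] fun ω =>
      gainSeq m Λ e η (normIter lam v η fun s => E s ω) t :=
  (measurable_gain m _ _ e).comp (measurable_normIter ht)

/-- The product up to t + 1 involves only the iterates up to time t. So the predicted size at t + 1
is known before the sample used in that step, and dividing by it keeps the early coefficients
predictable. -/
theorem measurable_decay (Λ : ℝ) (m : ℕ) (e : MatSpace d) {t : ℕ} (ht : t ≤ N) :
    Measurable[past N E t] fun ω =>
      decay m Λ e η (normIter lam v η fun s => E s ω) (t + 1) :=
  Finset.measurable_fun_prod _ fun u hu => by
    have hu' : u ≤ t := Nat.lt_succ_iff.1 (Finset.mem_range.1 hu)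
    exact (measurable_ratioSeq Λ m e (hu'.trans ht)).mono (past_mono hu') le_rfl

theorem measurable_sizeSeq_succ (Λ D : ℝ) (m : ℕ) (e : MatSpace d) {t : ℕ} (ht : t ≤ N) :
    Measurable[past N E t] fun ω =>
      sizeSeq m D Λ e η (normIter lam v η fun s => E s ω) (t + 1) := by
  have h : Measurable fun p : ℝ => √(1 + D * p ^ 2) := by fun_prop
  exact h.comp (measurable_decay Λ m e ht)

theorem measurable_sizeSeq (Λ D : ℝ) (m : ℕ) (e : MatSpace d) {t : ℕ} (ht : t ≤ N) :
    Measurable[past N E t] fun ω =>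
      sizeSeq m D Λ e η (normIter lam v η fun s => E s ω) t := by
  cases t with
  | zero => simp [sizeSeq, decay]
  | succ t => exact (measurable_sizeSeq_succ Λ D m e (by omega)).mono (past_mono (Nat.le_succ t)) le_rfl

theorem measurable_earlyCoeff (Λ D : ℝ) (m : ℕ) (e : MatSpace d) {t : ℕ} (ht : t ≤ N) :
    Measurable[past N E t] fun ω =>
      earlyCoeff m D Λ e η (normIter lam v η fun s => E s ω) t :=
  (measurable_clip 1).comp (((measurable_ratioSeq Λ m e ht).mul
    (measurable_sizeSeq Λ D m e ht)).div (measurable_sizeSeq_succ Λ D m e ht))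

theorem measurable_earlyGain (Λ D : ℝ) (m : ℕ) (e : MatSpace d) {t : ℕ} (ht : t ≤ N) :
    Measurable[past N E t] fun ω =>
      earlyGain m D Λ e η (normIter lam v η fun s => E s ω) t :=
  (measurable_clip _).comp ((measurable_gainSeq Λ m e ht).div (measurable_sizeSeq_succ Λ D m e ht))

/-- Concentration is applied without knowing that the iterate is nonzero; at zero the normalised
direction is 0 and the noise tensor vanishes. -/
theorem tensorInner_noiseTensor_normalize_le (hk : Even k) (hk4 : 4 ≤ k) (M u : MatSpace d) :
    tensorInner (noiseTensor k (‖M‖⁻¹ • M) u) (noiseTensor k (‖M‖⁻¹ • M) u)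
      ≤ 2 * (k / 2 : ℕ) * ‖u‖ ^ 2 := by
  by_cases hM : M = 0
  · have h1 : noiseTensor k (0 : MatSpace d) u = 0 := by
      have h2 : dPow k (0 : MatSpace d) u = 0 := by
        have := dPow_smul_left (k := k) 0 (0 : MatSpace d) u
        rwa [zero_smul, zero_pow (by omega), zero_smul] at this
      rw [noiseTensor, h2, inner_zero_right, mul_zero, zero_smul, sub_zero]
    rw [hM, smul_zero, h1]
    simp only [tensorInner, Pi.zero_apply, mul_zero, Finset.sum_const_zero]
    positivity
  · refine tensorInner_noiseTensor_self_le hk hk4 _ u ?_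
    rw [norm_smul, norm_inv, norm_norm]
    exact inv_mul_cancel₀ (norm_ne_zero_iff.2 hM)

/-- Tail bound for an autoregressive process driven by the noise along the iterates. -/
theorem measure_ar_gt_le [IsProbabilityMeasure μ] (hE : IsIIDSubGaussianNoise μ N σ E)
    (hσ : 0 < σ) (hk : Even k) (hk4 : 4 ≤ k) {c g : ℕ → Ω → ℝ} {cbar gbar V : ℕ → ℝ} {r : ℕ}
    (hc : ∀ t < N, Measurable[past N E t] (c t)) (hg : ∀ t < N, Measurable[past N E t] (g t))
    (hcb : ∀ t, r ≤ t → t < N → ∀ ω, |c t ω| ≤ cbar t)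
    (hgb : ∀ t, r ≤ t → t < N → ∀ ω, |g t ω| ≤ gbar t)
    (hV0 : 0 ≤ V r)
    (hV : ∀ t, r ≤ t → t < N → cbar t ^ 2 * V t + 2 * (k / 2 : ℕ) * gbar t ^ 2 ≤ V (t + 1))
    {U : MatSpace d} (hU : ‖U‖ ≤ 1) {t : ℕ} (ht : t ≤ N) {W ℓ : ℝ} (hW : 0 < W)
    (hVW : V t ≤ W) (hℓ : 0 ≤ ℓ) :
    μ {ω | 2 * σ * √(W * ℓ) < |⟪ar (fun u => c u ω) (fun u => g u ω)
        (normNoise lam v η fun s => E s ω) r t, U⟫|} ≤ ENNReal.ofReal (2 * Real.exp (-ℓ)) := by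
  rcases lt_or_ge t r with hrt | hrt
  · have : {ω | 2 * σ * √(W * ℓ) < |⟪ar (fun u => c u ω) (fun u => g u ω)
        (normNoise lam v η fun s => E s ω) r t, U⟫|} = ∅ := by
      ext ω
      simp only [ar_of_le hrt.le, inner_zero_left, abs_zero, Set.mem_ofPred_eq, Set.mem_empty_iff_false,
        iff_false, not_lt]
      positivity
    rw [this]; simp
  set q : ℕ → Ω → ℝ := fun t ω => ⟪ar (fun u => c u ω) (fun u => g u ω)
    (normNoise lam v η fun s => E s ω) r t, U⟫ with hqdef
  have hq : ∀ t ≤ N, Measurable[past N E t] (q t) := by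
    have har : ∀ t ≤ N, Measurable[past N E t] fun ω => ar (fun u => c u ω) (fun u => g u ω)
        (normNoise lam v η fun s => E s ω) r t := by
      intro t
      induction t with
      | zero => exact fun _ => measurable_const
      | succ t ih =>
        intro ht
        simp only [ar]
        split_ifs
        · exact measurable_const
        · have hm := past_mono (N := N) (E := E) (Nat.le_succ t)
          exact (((hc t ht).mono hm le_rfl).smul ((ih (by omega)).mono hm le_rfl)).add
            (((hg t ht).mono hm le_rfl).smul (measurable_normNoise ht))
    intro t ht
    exact (Continuous.measurable (by fun_prop : Continuous fun x : MatSpace d => ⟪x, U⟫)).comp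
      (har t ht)
  refine measure_abs_gt_le hσ hW hℓ (fun θ => ?_) ((hq t ht).mono (hE.past_le t) le_rfl)
  refine (hE.lintegral_cosh_ar_le (q := q) (c := c) (u := fun t ω => g t ω • noiseTensor k
    (‖normIter lam v η (fun s => E s ω) t‖⁻¹ • normIter lam v η (fun s => E s ω) t) U)
    (cbar := cbar) (b := fun t => 2 * (k / 2 : ℕ) * gbar t ^ 2) (V := V) (r := r)
    hq hc ?_ ?_ ?_ hcb ?_ hV0 hV hrt ht θ).trans ?_
  · intro t ht
    exact (hg t ht).smul ((continuous_noiseTensor U).measurable.comp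
      (measurable_normalize.comp (measurable_normIter ht.le)))
  · intro ω
    simp [hqdef, ar_of_le]
  · intro t hrt ht ω
    simp only [hqdef]
    rw [ar_succ hrt, inner_add_left, inner_smul_left, inner_smul_left, tensorInner_smul_left,
      normNoise, inner_noiseDir]
    rfl
  · intro t hrt ht ω
    rw [tensorInner_smul_left, tensorInner_smul_right]
    have h1 := tensorInner_noiseTensor_normalize_le hk hk4 (normIter lam v η (fun s => E s ω) t) U
    have h2 := hgb t hrt ht ω
    have h3 : g t ω ^ 2 ≤ gbar t ^ 2 := sq_le_sq' (by linarith [neg_abs_le (g t ω)])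
      ((le_abs_self _).trans h2)
    have h4 : ‖U‖ ^ 2 ≤ 1 := pow_le_one₀ (norm_nonneg U) hU
    set x := tensorInner (noiseTensor k (‖normIter lam v η (fun s => E s ω) t‖⁻¹ •
      normIter lam v η (fun s => E s ω) t) U) (noiseTensor k
      (‖normIter lam v η (fun s => E s ω) t‖⁻¹ • normIter lam v η (fun s => E s ω) t) U)
    have h5 : x ≤ 2 * (k / 2 : ℕ) := h1.trans (by
      have : (0 : ℝ) ≤ 2 * (k / 2 : ℕ) := by positivity
      nlinarith)
    calc g t ω * (g t ω * x) = g t ω ^ 2 * x := by ring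
      _ ≤ g t ω ^ 2 * (2 * (k / 2 : ℕ)) := by gcongr
      _ ≤ gbar t ^ 2 * (2 * (k / 2 : ℕ)) := by gcongr
      _ = _ := by ring
  · refine ENNReal.ofReal_le_ofReal (Real.exp_le_exp.2 ?_)
    gcongr

end Recursion
end TensorPCA
end
-- The union bound over all noise processes.
noncomputable section
namespace TensorPCA
open scoped RealInnerProductSpace

section GoodEvent
variable {k d : ℕ}

/-- There are d² coordinates, whence the factor d. This crude bound serves only for the coarse
tolerances, not for the final rate. -/
theorem norm_perp_le_of_coordinates {e : MatSpace d} {y : MatSpace d} {B : ℝ} (hB : 0 ≤ B)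
    (h : ∀ p, |⟪y, perp e (EuclideanSpace.single p 1)⟫| ≤ B) : ‖perp e y‖ ≤ d * B := by
  rw [EuclideanSpace.norm_eq, Real.sqrt_le_left (by positivity)]
  have h1 : ∀ p, ‖(perp e y) p‖ ^ 2 ≤ B ^ 2 := fun p => by
    have h2 := h p
    rw [← inner_perp_right, real_inner_comm, EuclideanSpace.inner_single_left] at h2
    simp only [map_one, one_mul] at h2
    rw [Real.norm_eq_abs]
    gcongr
  calc ∑ p, ‖(perp e y) p‖ ^ 2 ≤ ∑ _p : Fin d × Fin d, B ^ 2 := Finset.sum_le_sum fun p _ => h1 p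
    _ = (d * B) ^ 2 := by simp; ring

theorem norm_outer (v w : EuclideanSpace ℝ (Fin d)) : ‖outer v w‖ = ‖v‖ * ‖w‖ := by
  rw [EuclideanSpace.norm_eq, EuclideanSpace.norm_eq, EuclideanSpace.norm_eq,
    ← Real.sqrt_mul (by positivity), Finset.sum_mul_sum, Fintype.sum_prod_type]
  simp [outer, mul_pow]

theorem measure_iUnion_le_card {Ω ι : Type*} {mΩ : MeasurableSpace Ω} {μ : Measure Ω} [Fintype ι]
    {A : ι → Set Ω} {x : ℝ} (h : ∀ i, μ (A i) ≤ ENNReal.ofReal x) :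
    μ (⋃ i, A i) ≤ ENNReal.ofReal (Fintype.card ι * x) := by
  refine (measure_iUnion_fintype_le μ A).trans ((Finset.sum_le_sum fun i _ => h i).trans ?_)
  rw [Finset.sum_const, Finset.card_univ, nsmul_eq_mul, ENNReal.ofReal_mul (by positivity),
    ENNReal.ofReal_natCast]

variable {Ω : Type*} {mΩ : MeasurableSpace Ω} {μ : Measure Ω} {N : ℕ} {σ : ℝ}
  {E : ℕ → Ω → Tensor k d}

set_option maxHeartbeats 1000000 in
/-- With high probability all noise processes along the iterates are controlled. -/
theorem exists_noise_event [IsProbabilityMeasure μ] (hE : IsIIDSubGaussianNoise μ N σ E)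
    (hσ : 0 < σ) (hk : Even k) (hk4 : 4 ≤ k) (hd : 0 < d) (hN : 0 < N) {lam Λ D : ℝ}
    {v : EuclideanSpace ℝ (Fin d)} (hv : ‖v‖ = 1) {η : ℕ → ℝ} (hη : ∀ t, 0 < η t)
    (hη0 : ∀ t, η t ≤ η 0) (hΛ : 0 < Λ) (hΛη : Λ * η 0 ≤ 68 / 25) {T : ℕ}
    {ℓ : ℝ} (hℓ : 0 ≤ ℓ) (hD : 0 < D) :
    ∃ bad : Set Ω, μ bad ≤ ENNReal.ofReal (10 * (N + 1) ^ 2 * d ^ 2 * Real.exp (-ℓ)) ∧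
      ∀ ω ∉ bad,
        let M := normIter lam v η fun s => E s ω
        let X := normNoise lam v η fun s => E s ω
        (∀ t ≤ N, |⟪ar (fun _ => 1) (signalGain (k / 2) D Λ (outer v v) η M) X 0 t, outer v v⟫|
          ≤ 2 * σ * √(32 * N * (k / 2 : ℕ) * D * η 0 ^ 2 * ℓ)) ∧
        (∀ t ≤ N, ‖perp (outer v v) (ar (earlyCoeff (k / 2) D Λ (outer v v) η M)
            (earlyGain (k / 2) D Λ (outer v v) η M) X 0 t)‖
          ≤ d * (2 * σ * √(512 * N * (k / 2 : ℕ) * η 0 ^ 2 * ℓ))) ∧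
        (∀ r ≤ N, ∀ t ≤ N, ‖perp (outer v v) (ar (lateCoeff (k / 2) Λ (outer v v) η M)
            (lateGain (k / 2) Λ (outer v v) η M) X r t)‖
          ≤ d * (2 * σ * √(512 * N * (k / 2 : ℕ) * η 0 ^ 2 * ℓ))) ∧
        (∀ i, |⟪ar (fineCoeff (k / 2) Λ (outer v v) η M) (lateGain (k / 2) Λ (outer v v) η M) X T N,
              perp (outer v v) (outer (EuclideanSpace.single i 1) v)⟫|
            ≤ 2 * σ * √(1536 * (k / 2 : ℕ) * η 0 / (cosBound * Λ) * ℓ) ∧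
          |⟪ar (fineCoeff (k / 2) Λ (outer v v) η M) (lateGain (k / 2) Λ (outer v v) η M) X T N,
              perp (outer v v) (outer v (EuclideanSpace.single i 1))⟫|
            ≤ 2 * σ * √(1536 * (k / 2 : ℕ) * η 0 / (cosBound * Λ) * ℓ)) := by
  set e := outer v v with he_def
  have he : ‖e‖ = 1 := by rw [he_def, norm_outer, hv, mul_one]
  set m := k / 2 with hm
  have hm0 : 0 < m := by omega
  have hmR : (0 : ℝ) < m := by exact_mod_cast hm0
  have hNR : (0 : ℝ) < N := by exact_mod_cast hN
  have hη00 := hη 0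
  have hc0 := cosBound_pos
  have hc1 := cosBound_le
  set x := 2 * Real.exp (-ℓ) with hx
  have hx0 : 0 < x := by positivity
  have hsq : ∀ t, η t ^ 2 ≤ η 0 ^ 2 := fun t => by
    have := hη0 t; have := (hη t).le; gcongr
  let MM : Ω → ℕ → MatSpace d := fun ω => normIter lam v η fun s => E s ω
  let XX : Ω → ℕ → MatSpace d := fun ω => normNoise lam v η fun s => E s ω
  have hUp : ∀ u : MatSpace d, ‖u‖ ≤ 1 → ‖perp e u‖ ≤ 1 := fun u hu => (norm_perp_le he u).trans hu
  have hsingle : ∀ p, ‖perp e (EuclideanSpace.single p (1 : ℝ))‖ ≤ 1 := fun p => hUp _ (by simp)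
  have hlin : ∀ {W0 : ℝ}, 0 ≤ W0 → ∀ t ≤ N, (t : ℝ) * W0 ≤ N * W0 := fun h t ht => by gcongr
  have hmeasLG : ∀ t < N, Measurable[past N E t] fun ω => lateGain m Λ e η (MM ω) t :=
    fun t ht => (measurable_clip _).comp (measurable_gainSeq Λ m e ht.le)
  have hA : ∀ t : Fin (N + 1), μ {ω | 2 * σ * √(32 * N * m * D * η 0 ^ 2 * ℓ)
      < |⟪ar (fun _ => 1) (signalGain m D Λ e η (MM ω)) (XX ω) 0 t, e⟫|} ≤ ENNReal.ofReal x := by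
    intro t
    refine measure_ar_gt_le hE hσ hk hk4 (c := fun _ _ => 1)
      (g := fun u ω => signalGain m D Λ e η (MM ω) u) (cbar := fun _ => 1)
      (gbar := fun u => 4 * √D * η u) (V := fun t => t * (32 * m * D * η 0 ^ 2))
      (fun _ _ => measurable_const)
      (fun t ht => (measurable_clip _).comp (measurable_gainSeq Λ m e ht.le))
      (fun _ _ _ _ => by simp) (fun t _ _ ω => abs_clip_le (by have := hη t; positivity) _)
      (by simp) (fun t _ _ => ?_) he.le (Nat.lt_succ_iff.1 t.2) (by positivity) ?_ hℓ
    · rw [mul_pow, mul_pow, Real.sq_sqrt hD.le]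
      push_cast
      have := hsq t
      have h3 : 0 ≤ 32 * m * D := by positivity
      nlinarith
    · refine (hlin (by positivity) t (Nat.lt_succ_iff.1 t.2)).trans (le_of_eq ?_)
      ring
  have hB : ∀ i : Fin (N + 1) × (Fin d × Fin d), μ {ω | 2 * σ * √(512 * N * m * η 0 ^ 2 * ℓ)
      < |⟪ar (earlyCoeff m D Λ e η (MM ω)) (earlyGain m D Λ e η (MM ω)) (XX ω) 0 i.1,
        perp e (EuclideanSpace.single i.2 1)⟫|} ≤ ENNReal.ofReal x := by
    intro i
    refine measure_ar_gt_le hE hσ hk hk4 (c := fun u ω => earlyCoeff m D Λ e η (MM ω) u)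
      (g := fun u ω => earlyGain m D Λ e η (MM ω) u) (cbar := fun _ => 1)
      (gbar := fun u => 16 * η u) (V := fun t => t * (512 * m * η 0 ^ 2))
      (fun t ht => measurable_earlyCoeff Λ D m e ht.le)
      (fun t ht => measurable_earlyGain Λ D m e ht.le)
      (fun t _ _ ω => abs_clip_le zero_le_one _)
      (fun t _ _ ω => abs_clip_le (by have := hη t; positivity) _)
      (by simp) (fun t _ _ => ?_) (hsingle _) (Nat.lt_succ_iff.1 i.1.2) (by positivity) ?_ hℓ
    · rw [mul_pow]
      push_cast
      have := hsq t
      nlinarith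
    · refine (hlin (by positivity) i.1 (Nat.lt_succ_iff.1 i.1.2)).trans (le_of_eq ?_)
      ring
  have hC : ∀ i : Fin (N + 1) × Fin (N + 1) × (Fin d × Fin d),
      μ {ω | 2 * σ * √(512 * N * m * η 0 ^ 2 * ℓ)
      < |⟪ar (lateCoeff m Λ e η (MM ω)) (lateGain m Λ e η (MM ω)) (XX ω) i.1 i.2.1,
        perp e (EuclideanSpace.single i.2.2 1)⟫|} ≤ ENNReal.ofReal x := by
    intro i
    refine measure_ar_gt_le hE hσ hk hk4 (c := fun u ω => lateCoeff m Λ e η (MM ω) u)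
      (g := fun u ω => lateGain m Λ e η (MM ω) u) (cbar := fun _ => 1)
      (gbar := fun u => 16 * η u) (V := fun t => t * (512 * m * η 0 ^ 2))
      (fun t ht => (measurable_clip _).comp (measurable_ratioSeq Λ m e ht.le)) hmeasLG
      (fun t _ _ ω => abs_clip_le zero_le_one _)
      (fun t _ _ ω => abs_clip_le (by have := hη t; positivity) _)
      (by positivity) (fun t _ _ => ?_) (hsingle _) (Nat.lt_succ_iff.1 i.2.1.2) (by positivity)
      ?_ hℓ
    · rw [mul_pow]
      push_cast
      have := hsq t
      nlinarith
    · refine (hlin (by positivity) i.2.1 (Nat.lt_succ_iff.1 i.2.1.2)).trans (le_of_eq ?_)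
      ring
  have hF : ∀ U : MatSpace d, ‖U‖ ≤ 1 →
      μ {ω | 2 * σ * √(1536 * m * η 0 / (cosBound * Λ) * ℓ)
      < |⟪ar (fineCoeff m Λ e η (MM ω)) (lateGain m Λ e η (MM ω)) (XX ω) T N, perp e U⟫|}
        ≤ ENNReal.ofReal x := by
    intro U hU
    have hrate : ∀ t, 0 ≤ Λ * η t ∧ Λ * η t ≤ 68 / 25 := fun t =>
      ⟨mul_nonneg hΛ.le (hη t).le, (mul_le_mul_of_nonneg_left (hη0 t) hΛ.le).trans hΛη⟩
    refine measure_ar_gt_le hE hσ hk hk4 (c := fun u ω => fineCoeff m Λ e η (MM ω) u)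
      (g := fun u ω => lateGain m Λ e η (MM ω) u)
      (cbar := fun t => 1 - cosBound / 3 * (Λ * η t))
      (gbar := fun u => 16 * η u) (V := fun _ => 1536 * m * η 0 / (cosBound * Λ))
      (fun t ht => (measurable_clip _).comp (measurable_ratioSeq Λ m e ht.le)) hmeasLG
      (fun t _ _ ω => abs_clip_le (by nlinarith [hrate t]) _)
      (fun t _ _ ω => abs_clip_le (by have := hη t; positivity) _)
      (by positivity) (fun t _ _ => ?_) (hUp U hU) le_rfl (by positivity) le_rfl hℓ
    have h1 := hη t
    -- A stationary variance bound: each step removes at least (`cosBound`/3)Λη_t·V = 512mη₀η_t, and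
    -- adds at most 2m(16η_t)² = 512mη_t².
    set V := 1536 * m * η 0 / (cosBound * Λ) with hV
    have hVpos : 0 < V := by positivity
    have h2 : cosBound / 3 * (Λ * η t) * V = 512 * m * (η 0 * η t) := by
      rw [hV]; field_simp; ring
    have h3 : (1 - cosBound / 3 * (Λ * η t)) ^ 2 ≤ 1 - cosBound / 3 * (Λ * η t) := by
      have h0 : 0 ≤ cosBound / 3 * (Λ * η t) := by have := hrate t; have := this.1; positivity
      have h0' : cosBound / 3 * (Λ * η t) ≤ 1 := by nlinarith [hrate t]
      nlinarith
    have h4 : η t * η t ≤ η 0 * η t := mul_le_mul_of_nonneg_right (hη0 t) h1.le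
    calc (1 - cosBound / 3 * (Λ * η t)) ^ 2 * V + 2 * m * (16 * η t) ^ 2
        ≤ (1 - cosBound / 3 * (Λ * η t)) * V + 512 * m * (η t * η t) := by
          have := mul_le_mul_of_nonneg_right h3 hVpos.le
          linarith
      _ ≤ (1 - cosBound / 3 * (Λ * η t)) * V + 512 * m * (η 0 * η t) := by gcongr
      _ = V := by rw [← h2]; ring
  have hF1 := fun i : Fin d => hF (outer (EuclideanSpace.single i 1) v) (by
    rw [norm_outer, hv]; simp)
  have hF2 := fun i : Fin d => hF (outer v (EuclideanSpace.single i 1)) (by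
    rw [norm_outer, hv]; simp)
  have mA := measure_iUnion_le_card hA
  have mB := measure_iUnion_le_card hB
  have mC := measure_iUnion_le_card hC
  have m1 := measure_iUnion_le_card hF1
  have m2 := measure_iUnion_le_card hF2
  refine ⟨_ ∪ (_ ∪ (_ ∪ (_ ∪ _))), (measure_union_le _ _).trans ((add_le_add mA
    ((measure_union_le _ _).trans (add_le_add mB ((measure_union_le _ _).trans (add_le_add mC
      ((measure_union_le _ _).trans (add_le_add m1 m2))))))).trans ?_), ?_⟩
  · rw [← ENNReal.ofReal_add (by positivity) (by positivity),
      ← ENNReal.ofReal_add (by positivity) (by positivity),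
      ← ENNReal.ofReal_add (by positivity) (by positivity),
      ← ENNReal.ofReal_add (by positivity) (by positivity)]
    refine ENNReal.ofReal_le_ofReal ?_
    simp only [Fintype.card_prod, Fintype.card_fin]
    push_cast
    have h1 : (1 : ℝ) ≤ d := by exact_mod_cast hd
    have h2 : (1 : ℝ) ≤ N + 1 := by linarith
    -- Five families, each of at most (N+1)²d² events of probability at most x = 2e^(-ℓ).
    have e1 : 10 * ((N : ℝ) + 1) ^ 2 * d ^ 2 * Real.exp (-ℓ)
        = 5 * (((N : ℝ) + 1) * (N + 1) * (d * d)) * x := by rw [hx]; ring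
    rw [e1]
    have a1 : (1 : ℝ) ≤ d * d := by nlinarith
    have a2 : ((N : ℝ) + 1) ≤ (N + 1) * (N + 1) := by nlinarith
    have a3 : ((N : ℝ) + 1) ≤ (N + 1) * (N + 1) * (d * d) := by nlinarith
    have a4 : ((N : ℝ) + 1) * (d * d) ≤ (N + 1) * (N + 1) * (d * d) := by nlinarith
    have a5 : (d : ℝ) ≤ (N + 1) * (N + 1) * (d * d) := by
      have : (1 : ℝ) ≤ (N + 1) * (N + 1) := by nlinarith
      nlinarith
    nlinarith
  · intro ω hω M X
    simp only [Set.mem_union, Set.mem_iUnion, Set.mem_ofPred_eq, not_or, not_exists, not_lt] at hω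
    obtain ⟨wA, wB, wC, w1, w2⟩ := hω
    refine ⟨fun t ht => wA ⟨t, by omega⟩, fun t ht => ?_, fun r hr t ht => ?_, fun i => ⟨w1 i, w2 i⟩⟩
    · exact norm_perp_le_of_coordinates (by positivity) fun p => wB (⟨t, by omega⟩, p)
    · exact norm_perp_le_of_coordinates (by positivity)
        fun p => wC (⟨r, by omega⟩, ⟨t, by omega⟩, p)

end GoodEvent
end TensorPCA
end
-- Perturbation of the leading eigenvector.
noncomputable section
namespace TensorPCA
open scoped RealInnerProductSpace

section Eigenvector
variable {d : ℕ}

theorem inner_outer (Q : MatSpace d) (x y : EuclideanSpace ℝ (Fin d)) :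
    ⟪Q, outer x y⟫ = ∑ i, ∑ j, Q (i, j) * (x i * y j) := by
  rw [inner_eq_sum, Fintype.sum_prod_type]; rfl

theorem outer_add_left (x x' y : EuclideanSpace ℝ (Fin d)) :
    outer (x + x') y = outer x y + outer x' y := by
  ext p; simp [outer]; ring

theorem outer_add_right (x y y' : EuclideanSpace ℝ (Fin d)) :
    outer x (y + y') = outer x y + outer x y' := by
  ext p; simp [outer]; ring

theorem outer_smul_left (c : ℝ) (x y : EuclideanSpace ℝ (Fin d)) :
    outer (c • x) y = c • outer x y := by
  ext p; simp [outer]; ring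

theorem outer_smul_right (c : ℝ) (x y : EuclideanSpace ℝ (Fin d)) :
    outer x (c • y) = c • outer x y := by
  ext p; simp [outer]; ring

theorem inner_outer_outer (x y z w : EuclideanSpace ℝ (Fin d)) :
    ⟪outer x y, outer z w⟫ = ⟪x, z⟫ * ⟪y, w⟫ := by
  rw [inner_outer]
  simp only [PiLp.inner_apply, outer, Finset.sum_mul_sum]
  refine Finset.sum_congr rfl fun i _ => Finset.sum_congr rfl fun j _ => ?_
  simp; ring

theorem dotProduct_asMat_mulVec (Q : MatSpace d) (x y : EuclideanSpace ℝ (Fin d)) :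
    x.ofLp ⬝ᵥ ((asMat Q + (asMat Q)ᵀ) *ᵥ y.ofLp) = ⟪Q, outer x y⟫ + ⟪Q, outer y x⟫ := by
  rw [inner_outer, inner_outer, Finset.sum_comm (f := fun i j => Q (i, j) * (y i * x j)),
    ← Finset.sum_add_distrib]
  simp only [dotProduct, mulVec, Finset.mul_sum, ← Finset.sum_add_distrib]
  refine Finset.sum_congr rfl fun i _ => Finset.sum_congr rfl fun j _ => ?_
  simp [asMat]; ring

/-- A real number that bounds all eigenvalues of a symmetric matrix bounds its quadratic form. -/
theorem dotProduct_mulVec_le {S : Matrix (Fin d) (Fin d) ℝ} (hS : Sᵀ = S) {ρ : ℝ}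
    (h : ∀ (ν : ℝ) (w : Fin d → ℝ), w ≠ 0 → S *ᵥ w = ν • w → ν ≤ ρ) (x : Fin d → ℝ) :
    x ⬝ᵥ (S *ᵥ x) ≤ ρ * (x ⬝ᵥ x) := by
  have hH : (ρ • (1 : Matrix (Fin d) (Fin d) ℝ) - S).IsHermitian := by
    rw [Matrix.IsHermitian, conjTranspose_eq_transpose_of_trivial, transpose_sub, transpose_smul,
      transpose_one, hS]
  have hpos : (ρ • (1 : Matrix (Fin d) (Fin d) ℝ) - S).PosSemidef := by
    rw [hH.posSemidef_iff_eigenvalues_nonneg]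
    intro i
    have h1 := hH.mulVec_eigenvectorBasis i
    have h2 : (hH.eigenvectorBasis i).ofLp ≠ 0 := by
      intro h0
      have h3 : hH.eigenvectorBasis i = 0 := by ext j; simpa using congrFun h0 j
      have h4 := hH.eigenvectorBasis.orthonormal.1 i
      rw [h3, norm_zero] at h4
      exact zero_ne_one h4
    rw [sub_mulVec, smul_mulVec, one_mulVec] at h1
    have h5 := h (ρ - hH.eigenvalues i) _ h2 (by
      rw [sub_smul, ← h1]; abel)
    simpa using h5
  have h6 := hpos.dotProduct_mulVec_nonneg x
  rw [sub_mulVec, smul_mulVec, one_mulVec, dotProduct_sub, dotProduct_smul, star_trivial,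
    smul_eq_mul] at h6
  linarith

/-- The pairing is ⟨p, Qv⟩, and the root of the sum is ‖Qv‖; Cauchy–Schwarz. -/
theorem abs_inner_outer_le_left (Q : MatSpace d) (p v : EuclideanSpace ℝ (Fin d)) :
    |⟪Q, outer p v⟫| ≤ √(∑ i, ⟪Q, outer (EuclideanSpace.single i 1) v⟫ ^ 2) * ‖p‖ := by
  have h1 : ⟪Q, outer p v⟫ = ⟪p, WithLp.toLp 2 fun i =>
      ⟪Q, outer (EuclideanSpace.single i 1) v⟫⟫ := by
    rw [inner_outer, PiLp.inner_apply]
    refine Finset.sum_congr rfl fun i _ => ?_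
    simp [inner_outer, Finset.mul_sum, mul_comm, mul_left_comm]
  rw [h1, mul_comm]
  refine (abs_real_inner_le_norm _ _).trans (le_of_eq ?_)
  congr 1
  rw [EuclideanSpace.norm_eq]
  simp

theorem abs_inner_outer_le_right (Q : MatSpace d) (p v : EuclideanSpace ℝ (Fin d)) :
    |⟪Q, outer v p⟫| ≤ √(∑ i, ⟪Q, outer v (EuclideanSpace.single i 1)⟫ ^ 2) * ‖p‖ := by
  have h1 : ⟪Q, outer v p⟫ = ⟪p, WithLp.toLp 2 fun i =>
      ⟪Q, outer v (EuclideanSpace.single i 1)⟫⟫ := by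
    rw [inner_outer, PiLp.inner_apply, Finset.sum_comm]
    refine Finset.sum_congr rfl fun i _ => ?_
    simp [inner_outer, Finset.mul_sum, mul_comm, mul_left_comm]
  rw [h1, mul_comm]
  refine (abs_real_inner_le_norm _ _).trans (le_of_eq ?_)
  congr 1
  rw [EuclideanSpace.norm_eq]
  simp

set_option maxHeartbeats 1000000 in
/-- Perturbation bound for the leading eigenvector of the symmetrisation of a matrix that is close
to a multiple of `v vᵀ`. -/
theorem IsTopEigenvector.min_le {M : MatSpace d} {c : ℝ} (hc : 0 < c)
    {u v : EuclideanSpace ℝ (Fin d)} (hv : ‖v‖ = 1)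
    (hu : IsTopEigenvector (asMat (c • M) + (asMat (c • M))ᵀ) u)
    (hρ : 3 / 4 ≤ ⟪M, outer v v⟫) (hQ : ‖perp (outer v v) M‖ ≤ 1 / 4) :
    min (‖u - v‖ ^ 2) (‖u + v‖ ^ 2)
      ≤ 4 * (∑ i, ⟪perp (outer v v) M, outer (EuclideanSpace.single i 1) v⟫ ^ 2
        + ∑ i, ⟪perp (outer v v) M, outer v (EuclideanSpace.single i 1)⟫ ^ 2) := by
  obtain ⟨hu1, ν, hν, hmax⟩ := hu
  set e := outer v v with he
  set Q := perp e M with hQdef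
  set ρ := ⟪M, e⟫
  have hM : M = ρ • e + Q := by rw [hQdef, perp_apply]; abel
  have he1 : ‖e‖ = 1 := by rw [he, norm_outer, hv, mul_one]
  have hQe : ⟪Q, e⟫ = 0 := by rw [hQdef, inner_perp_right, perp_self he1, inner_zero_right]
  have hMxy : ∀ x y, ⟪c • M, outer x y⟫ = c * (ρ * (⟪v, x⟫ * ⟪v, y⟫) + ⟪Q, outer x y⟫) := by
    intro x y
    rw [hM, inner_smul_left, inner_add_left, inner_smul_left, he, inner_outer_outer]
    rfl
  have hsymm : (asMat (c • M) + (asMat (c • M))ᵀ)ᵀ = asMat (c • M) + (asMat (c • M))ᵀ := by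
    rw [transpose_add, transpose_transpose, add_comm]
  -- Rayleigh quotient at v, to which Q contributes nothing as it is orthogonal to e.
  have hνρ : c * (2 * ρ) ≤ ν := by
    have h1 := dotProduct_mulVec_le hsymm hmax v.ofLp
    have h2 : v.ofLp ⬝ᵥ v.ofLp = 1 := by
      have := real_inner_self_eq_norm_sq v
      rw [hv, one_pow, EuclideanSpace.inner_eq_star_dotProduct] at this
      simpa using this
    rw [dotProduct_asMat_mulVec, hMxy, h2, ← he, hQe, real_inner_self_eq_norm_sq, hv] at h1
    linarith
  set κ := ⟪v, u⟫
  set p := u - κ • v with hp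
  have hup : u = κ • v + p := by rw [hp]; abel
  have hvp : ⟪v, p⟫ = 0 := by
    rw [hp, inner_sub_right, inner_smul_right, real_inner_self_eq_norm_sq, hv]; simp [κ]
  have hpu : ⟪p, u⟫ = ‖p‖ ^ 2 := by
    conv_lhs => rw [hup]
    rw [inner_add_right, inner_smul_right, real_inner_comm, hvp, real_inner_self_eq_norm_sq]
    simp
  have hκp : κ ^ 2 + ‖p‖ ^ 2 = 1 := by
    have : ‖u‖ ^ 2 = κ ^ 2 + ‖p‖ ^ 2 := by
      conv_lhs => rw [hup]
      rw [norm_add_sq_real, inner_smul_left, hvp, norm_smul, hv, mul_one, Real.norm_eq_abs, sq_abs]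
      simp
    rw [← this, hu1, one_pow]
  have hκ1 : |κ| ≤ 1 := by
    rw [← sq_le_one_iff_abs_le_one]; nlinarith [sq_nonneg ‖p‖]
  set a := √(∑ i, ⟪Q, outer (EuclideanSpace.single i 1) v⟫ ^ 2) with ha
  set b := √(∑ i, ⟪Q, outer v (EuclideanSpace.single i 1)⟫ ^ 2) with hb
  have ha2 : a ^ 2 = ∑ i, ⟪Q, outer (EuclideanSpace.single i 1) v⟫ ^ 2 :=
    Real.sq_sqrt (Finset.sum_nonneg fun _ _ => sq_nonneg _)
  have hb2 : b ^ 2 = ∑ i, ⟪Q, outer v (EuclideanSpace.single i 1)⟫ ^ 2 :=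
    Real.sq_sqrt (Finset.sum_nonneg fun _ _ => sq_nonneg _)
  have ha0 : 0 ≤ a := Real.sqrt_nonneg _
  have hb0 : 0 ≤ b := Real.sqrt_nonneg _
  -- The eigenvector equation tested against p, the part of u orthogonal to v: the signal drops out.
  have heq : ν * ‖p‖ ^ 2
      = c * (κ * (⟪Q, outer p v⟫ + ⟪Q, outer v p⟫) + 2 * ⟪Q, outer p p⟫) := by
    have h1 := dotProduct_asMat_mulVec (c • M) p u
    rw [hν, dotProduct_smul, hMxy, hMxy, hvp] at h1
    have h2 : p.ofLp ⬝ᵥ u.ofLp = ‖p‖ ^ 2 := by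
      rw [← hpu, EuclideanSpace.inner_eq_star_dotProduct]
      simp [dotProduct_comm]
    have h3 : ⟪Q, outer p u⟫ = κ * ⟪Q, outer p v⟫ + ⟪Q, outer p p⟫ := by
      conv_lhs => rw [hup]
      rw [outer_add_right, outer_smul_right, inner_add_right, inner_smul_right]
    have h4 : ⟪Q, outer u p⟫ = κ * ⟪Q, outer v p⟫ + ⟪Q, outer p p⟫ := by
      conv_lhs => rw [hup]
      rw [outer_add_left, outer_smul_left, inner_add_right, inner_smul_right]
    rw [h2, h3, h4, smul_eq_mul] at h1
    rw [h1]; ring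
  have hpp : |⟪Q, outer p p⟫| ≤ 1 / 4 * ‖p‖ ^ 2 := by
    refine (abs_real_inner_le_norm _ _).trans ?_
    rw [norm_outer, ← sq]
    gcongr
  have hlin : |κ * (⟪Q, outer p v⟫ + ⟪Q, outer v p⟫)| ≤ (a + b) * ‖p‖ := by
    rw [abs_mul]
    have h1 := abs_inner_outer_le_left Q p v
    have h2 := abs_inner_outer_le_right Q p v
    calc |κ| * |⟪Q, outer p v⟫ + ⟪Q, outer v p⟫|
        ≤ 1 * (|⟪Q, outer p v⟫| + |⟪Q, outer v p⟫|) := by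
          gcongr
          exact abs_add_le _ _
      _ ≤ (a + b) * ‖p‖ := by rw [one_mul, add_mul]; exact add_le_add h1 h2
  -- The eigenvalue is at least 2cρ ≥ 3c/2 and the quadratic term uses up at most c/2 of it; the
  -- remaining c‖p‖² is controlled by c(a + b)‖p‖.
  have hpab : ‖p‖ ≤ a + b := by
    by_contra hcon
    push Not at hcon
    have hp0 : 0 < ‖p‖ := by linarith
    have h1 : c * (2 * ρ) * ‖p‖ ^ 2 ≤ c * ((a + b) * ‖p‖ + 1 / 2 * ‖p‖ ^ 2) := by
      refine (mul_le_mul_of_nonneg_right hνρ (sq_nonneg _)).trans ?_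
      rw [heq]
      refine mul_le_mul_of_nonneg_left ?_ hc.le
      linarith [(le_abs_self _).trans hlin, (le_abs_self _).trans hpp]
    have h2 : 2 * ρ * ‖p‖ ^ 2 ≤ (a + b) * ‖p‖ + 1 / 2 * ‖p‖ ^ 2 := by
      rw [mul_assoc] at h1
      exact le_of_mul_le_mul_left h1 hc
    nlinarith
  -- The minimum is at most 2 - 2|κ| ≤ 2(1 - κ²).
  have hmin : min (‖u - v‖ ^ 2) (‖u + v‖ ^ 2) ≤ 2 * ‖p‖ ^ 2 := by
    rcases le_total 0 κ with hκ | hκ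
    · refine (min_le_left _ _).trans ?_
      rw [norm_sub_sq_real, hu1, hv, real_inner_comm]
      have : κ ≤ 1 := (le_abs_self _).trans hκ1
      change 1 ^ 2 - 2 * κ + 1 ^ 2 ≤ _
      nlinarith
    · refine (min_le_right _ _).trans ?_
      rw [norm_add_sq_real, hu1, hv, real_inner_comm]
      have : -1 ≤ κ := (abs_le.1 hκ1).1
      change 1 ^ 2 + 2 * κ + 1 ^ 2 ≤ _
      nlinarith
  refine hmin.trans ?_
  rw [← ha2, ← hb2]
  nlinarith [sq_nonneg (a - b), norm_nonneg p]

end Eigenvector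

/-! ### From the algorithm to the normalised iteration. -/

section Link
variable {k d : ℕ}

theorem asMat_oneMat : asMat (oneMat d) = 1 := by
  ext i j
  simp [asMat, oneMat, Matrix.one_apply]

theorem inner_oneMat_outer (v : EuclideanSpace ℝ (Fin d)) (hv : ‖v‖ = 1) :
    ⟪oneMat d, outer v v⟫ = 1 := by
  rw [inner_outer]
  have h := EuclideanSpace.real_norm_sq_eq v
  rw [hv, one_pow] at h
  rw [h]
  simp [oneMat, sq]

theorem norm_oneMat_sq : ‖oneMat d‖ ^ 2 = d := by
  rw [EuclideanSpace.real_norm_sq_eq, Fintype.sum_prod_type]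
  simp [oneMat]

/-- The iterates of the algorithm are positive multiples of the rescaled iterates. -/
theorem exists_nsga_eq (hk : Even k) (hk4 : 4 ≤ k) {lam : ℝ} (hlam : 0 < lam)
    {v : EuclideanSpace ℝ (Fin d)} (hv : ‖v‖ = 1) {η₀ : ℝ} (hη : 0 < η₀) {N : ℕ}
    {E : ℕ → Tensor k d} {η : ℕ → ℝ} (hηdef : ∀ t, η t = η₀ / 2 ^ (t / phaseLength N)) {t : ℕ}
    (h : ∀ u < t, 0 < ⟪normIter lam v η E u, outer v v⟫) :
    ∃ c : ℝ, 0 < c ∧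
      nsga η₀ N (fun s => observation lam v (E s)) t = asMat (c • normIter lam v η E t) := by
  induction t with
  | zero => exact ⟨1, one_pos, by rw [one_smul]; exact asMat_oneMat.symm⟩
  | succ t ih =>
    obtain ⟨c, hc, hceq⟩ := ih fun u hu => h u (by omega)
    have hρ := h t (Nat.lt_succ_self t)
    have hM : normIter lam v η E t ≠ 0 := by
      intro h0
      rw [h0, inner_zero_left] at hρ
      exact lt_irrefl _ hρ
    have he : ‖outer v v‖ = 1 := by rw [norm_outer, hv, mul_one]
    have hηt : 0 < η t := by rw [hηdef]; positivity
    have hg := growth_ge_one (m := k / 2) (s := η t * lam * (k / 2 : ℕ)) (by positivity)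
      (cosine_nonneg hρ.le) (cosine_le_one he (normIter lam v η E t))
    have hstep := nsgaStep_asMat hk hk4 (η t) lam c v (E t) (normIter lam v η E t) hM hc
      (by linarith)
    refine ⟨_, mul_pos hc (zero_lt_one.trans_le hg), ?_⟩
    rw [nsga, ← hηdef, hceq, hstep]
    congr 2
    rw [normIter]
    congr 1
    ring

end Link
end TensorPCA
end
-- Accuracy of the output on the good event.
noncomputable section
namespace TensorPCA
open scoped RealInnerProductSpace

section Accuracy
variable {k d : ℕ} {Ω : Type*} {mΩ : MeasurableSpace Ω} {μ : Measure Ω} {N : ℕ} {σ : ℝ}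
  {E : ℕ → Ω → Tensor k d}

theorem mul_add_sq_le {p x y b : ℝ} (hx : x ^ 2 ≤ 25) (hy : y ^ 2 ≤ b) :
    (p * x + y) ^ 2 ≤ 50 * p ^ 2 + 2 * b := by
  nlinarith [sq_nonneg (p * x - y), mul_le_mul_of_nonneg_left hx (sq_nonneg p)]

set_option maxHeartbeats 1000000 in
/-- The accuracy of the output off an event of small probability, in terms of the contraction over
one phase and of the stationary variance of the noise. -/
theorem exists_event_accuracy [IsProbabilityMeasure μ] (hE : IsIIDSubGaussianNoise μ N σ E)
    (hσ : 0 < σ) (hk : Even k) (hk4 : 4 ≤ k) (hkd : k ≤ d) {lam : ℝ} (hlam : 0 < lam)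
    {v : EuclideanSpace ℝ (Fin d)} (hv : ‖v‖ = 1) {η₀ ℓ : ℝ} (hη : 0 < η₀) (hℓ : 0 ≤ ℓ)
    (hT : 0 < phaseLength N) (hTN : 2 * phaseLength N ≤ N)
    (hs : lam * (k / 2 : ℕ) * η₀ ≤ 68 / 25)
    (hpow : 134 * √(d : ℝ) ^ (k / 2 - 2) < phaseLength N * (lam * (k / 2 : ℕ) * η₀))
    (hlog : 6 * Real.log d < phaseLength N * (lam * (k / 2 : ℕ) * η₀))
    (hn1 : 2 * σ * √(32 * N * (k / 2 : ℕ) * d * η₀ ^ 2 * ℓ) ≤ cosBound / (k / 2 : ℕ))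
    (hn2 : d * (2 * σ * √(512 * N * (k / 2 : ℕ) * η₀ ^ 2 * ℓ)) ≤ cosBound / (k / 2 : ℕ))
    (hπ : Real.exp (-(cosBound / 6 * (phaseLength N * (lam * (k / 2 : ℕ) * η₀)))) ≤ 1 / 30) :
    ∃ bad : Set Ω, μ bad ≤ ENNReal.ofReal (10 * (N + 1) ^ 2 * d ^ 2 * Real.exp (-ℓ)) ∧
      ∀ ω ∉ bad, ∀ u, IsNSGAOutput η₀ N (fun t => observation lam v (E t ω)) u →
        min (‖u - v‖ ^ 2) (‖u + v‖ ^ 2)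
          ≤ d * (400 * Real.exp (-(cosBound / 3 * (phaseLength N * (lam * (k / 2 : ℕ) * η₀))))
            + 64 * σ ^ 2 * (1536 * (k / 2 : ℕ) * η₀ / (cosBound * (lam * (k / 2 : ℕ))) * ℓ)) := by
  set T := phaseLength N with hTdef
  have hmN : 2 ≤ k / 2 := by omega
  have hm : (0 : ℝ) < (k / 2 : ℕ) := by exact_mod_cast (by omega : 0 < k / 2)
  set Λ := lam * (k / 2 : ℕ) with hΛdef
  have hΛ : 0 < Λ := by positivity
  set η : ℕ → ℝ := fun t => η₀ / 2 ^ (t / T) with hηdef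
  have hη0 : η 0 = η₀ := by simp [hηdef]
  have hηpos : ∀ t, 0 < η t := fun t => by simp only [hηdef]; positivity
  have hηle : ∀ t, η t ≤ η 0 := fun t => by
    rw [hη0]
    exact div_le_self hη.le (one_le_pow₀ (by norm_num))
  have hd4 : (4 : ℝ) ≤ d := by exact_mod_cast hk4.trans hkd
  have hc0 := cosBound_pos
  obtain ⟨bad, hbad, hgood⟩ := exists_noise_event (lam := lam) (Λ := Λ) (D := d) (T := T) hE hσ hk hk4
    (by omega) (by omega) hv hηpos hηle hΛ (by rw [hη0]; exact hs) hℓ (by linarith)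
  refine ⟨bad, hbad, fun ω hω u hu => ?_⟩
  obtain ⟨g1, g2, g3, g4⟩ := hgood ω hω
  set M := normIter lam v η fun s => E s ω with hM
  set X := normNoise lam v η fun s => E s ω with hX
  set e := outer v v with he
  rw [hη0] at g1 g2 g3 g4
  have he1 : ‖e‖ = 1 := by rw [he, norm_outer, hv, mul_one]
  have R : IsRun (k / 2) T N d Λ e η M X :=
    { hm := hmN
      hT := hTN
      hD := hd4
      hmD := by exact_mod_cast (by omega : k / 2 ≤ d)
      he := he1
      hΛ := hΛ
      step_pos := hηpos
      step_early := fun t ht => by simp only [hηdef, Nat.div_eq_of_lt ht, Nat.zero_div]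
      step_late := fun t ht => by
        rw [hη0]
        refine div_le_div_of_nonneg_left hη.le (by norm_num) ?_
        calc (2 : ℝ) = 2 ^ 1 := (pow_one 2).symm
          _ ≤ 2 ^ (t / T) := pow_le_pow_right₀ (by norm_num)
            ((Nat.one_le_div_iff hT).2 ht)
      step_mid := fun t ht ht2 => by
        have : t / T = 1 := Nat.div_eq_of_lt_le (by omega) (by omega)
        simp only [hηdef, this, Nat.zero_div, pow_one, pow_zero, div_one]
      step_le := by rw [hη0]; exact hs
      inner_init := inner_oneMat_outer v hv
      norm_init := norm_oneMat_sq
      succ := fun t => normIter_succ _ t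
      time_pow := by rw [hη0]; exact hpow
      time_log := by rw [hη0]; exact hlog
      noise_signal := fun t ht => (g1 t ht).trans hn1
      noise_early := fun t ht => (g2 t ht).trans hn2
      noise_late := fun r hr t ht => (g3 r hr t ht).trans hn2 }
  obtain ⟨c, hc, hceq⟩ := exists_nsga_eq hk hk4 hlam hv hη (N := N) (η := η) (E := fun s => E s ω)
    (fun _ => rfl) (t := N) (fun u hu => by linarith [R.inner_ge hu.le])
  obtain ⟨π, hπ1, hT5, hN, hfin⟩ := R.final
  rw [hη0] at hπ1
  rw [IsNSGAOutput, hceq] at hu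
  -- The orthogonal part is at most 5/30 + 1/54 < 1/4.
  have hclose := hu.min_le hc hv (by linarith [R.inner_ge le_rfl])
    (by linarith [R.eps_le, hπ1.trans hπ])
  refine hclose.trans ?_
  set B := 2 * σ * √(1536 * (k / 2 : ℕ) * η₀ / (cosBound * Λ) * ℓ) with hB
  have hB2 : B ^ 2 = 4 * σ ^ 2 * (1536 * (k / 2 : ℕ) * η₀ / (cosBound * Λ) * ℓ) := by
    rw [hB, mul_pow, Real.sq_sqrt (by positivity)]; ring
  have hπ2 : π ^ 2 ≤ Real.exp (-(cosBound / 3 * (T * (Λ * η₀)))) := by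
    have h1 : π ^ 2 = |π| ^ 2 := (sq_abs π).symm
    have h2 : Real.exp (-(cosBound / 3 * (T * (Λ * η₀))))
        = Real.exp (-(cosBound / 6 * (T * (Λ * η₀)))) ^ 2 := by
      rw [← Real.exp_nat_mul]; congr 1; push_cast; ring
    rw [h1, h2]
    gcongr
  have hterm : ∀ w : MatSpace d, ‖w‖ = 1 →
      |⟪ar (fineCoeff (k / 2) Λ e η M) (lateGain (k / 2) Λ e η M) X T N, perp e w⟫| ≤ B →
      ⟪perp e (M N), w⟫ ^ 2 ≤ 50 * π ^ 2 + 2 * B ^ 2 := by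
    intro w hw hBw
    rw [hfin, inner_add_left, inner_smul_left, inner_perp_right (ar _ _ _ _ _), conj_trivial]
    have h3 : ⟪ar (fineCoeff (k / 2) Λ e η M) (lateGain (k / 2) Λ e η M) X T N, perp e w⟫ ^ 2
        ≤ B ^ 2 := by
      rw [← sq_abs]; gcongr
    refine mul_add_sq_le ?_ h3
    have h2 : |⟪perp e (M T), w⟫| ≤ 5 :=
      (abs_real_inner_le_norm _ _).trans (by rw [hw, mul_one]; exact hT5)
    calc _ = |⟪perp e (M T), w⟫| ^ 2 := (sq_abs _).symm
      _ ≤ 5 ^ 2 := by gcongr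
      _ = 25 := by norm_num
  have s1 := Finset.sum_le_sum fun (i : Fin d) (_ : i ∈ Finset.univ) =>
    hterm (outer (EuclideanSpace.single i 1) v) (by rw [norm_outer, hv]; simp) (g4 i).1
  have s2 := Finset.sum_le_sum fun (i : Fin d) (_ : i ∈ Finset.univ) =>
    hterm (outer v (EuclideanSpace.single i 1)) (by rw [norm_outer, hv]; simp) (g4 i).2
  rw [Finset.sum_const, Finset.card_univ, Fintype.card_fin, nsmul_eq_mul] at s1 s2
  have hd0 : (0 : ℝ) ≤ d := by linarith
  calc _ ≤ 4 * (d * (50 * π ^ 2 + 2 * B ^ 2) + d * (50 * π ^ 2 + 2 * B ^ 2)) := by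
        linarith
    _ = d * (400 * π ^ 2 + 16 * B ^ 2) := by ring
    _ ≤ d * (400 * Real.exp (-(cosBound / 3 * (T * (Λ * η₀)))) + 16 * B ^ 2) := by gcongr
    _ = _ := by rw [hB2]; ring

end Accuracy
end TensorPCA
end
-- Step size, phase length and logarithmic factors.
noncomputable section
namespace TensorPCA

section Parameters

theorem log_le_two_mul_sqrt {x : ℝ} (hx : 0 < x) : Real.log x ≤ 2 * √x - 2 := by
  have h := Real.log_le_sub_one_of_pos (Real.sqrt_pos.2 hx)
  rw [Real.log_sqrt hx.le] at h
  linarith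

theorem one_le_log {x : ℝ} (hx : 4 ≤ x) : 1 ≤ Real.log x := by
  rw [Real.le_log_iff_exp_le (by linarith)]
  linarith [Real.exp_one_lt_d9]

section Dimension
variable {k d : ℕ}

theorem cast_eq_two_mul_half (hk : Even k) : (k : ℝ) = 2 * (k / 2 : ℕ) := by
  exact_mod_cast (Nat.two_mul_div_two_of_even hk).symm

theorem rpow_eq_sqrt_pow (hk : Even k) (hk4 : 4 ≤ k) :
    (d : ℝ) ^ ((k : ℝ) / 4 - 1) = √(d : ℝ) ^ (k / 2 - 2) := by
  rw [Real.sqrt_eq_rpow, ← Real.rpow_mul_natCast (by positivity), Nat.cast_sub (by omega),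
    cast_eq_two_mul_half hk]
  congr 1
  push_cast
  ring

theorem rpow_quarter (hd : 0 < d) :
    (d : ℝ) ^ ((k : ℝ) / 4) = (d : ℝ) ^ ((k : ℝ) / 4 - 1) * d := by
  rw [← Real.rpow_add_one (by positivity)]
  congr 1
  ring

theorem rpow_half (hd : 0 < d) :
    (d : ℝ) ^ ((k : ℝ) / 2) = ((d : ℝ) ^ ((k : ℝ) / 4 - 1)) ^ 2 * d ^ 2 := by
  rw [← mul_pow, ← rpow_quarter hd, ← Real.rpow_mul_natCast (by positivity)]
  congr 1
  push_cast
  ring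

theorem one_le_rpow_quarter_sub (hk4 : 4 ≤ k) (hd : 0 < d) : 1 ≤ (d : ℝ) ^ ((k : ℝ) / 4 - 1) := by
  have : (4 : ℝ) ≤ k := by exact_mod_cast hk4
  exact Real.one_le_rpow (by exact_mod_cast hd) (by linarith)

/-- The factor of the step size that depends on the order and the dimension. -/
def stepFactor (k d N : ℕ) : ℝ :=
  max (Real.log N / k)
    ((k : ℝ) * (d : ℝ) ^ ((k : ℝ) / 4 - 1) / max ((k : ℝ) * ((k : ℝ) - 4)) (Real.log d)⁻¹)

theorem stepOrder_eq (k d N : ℕ) (lam : ℝ) :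
    stepOrder k d N lam = stepFactor k d N * ((⌈Real.log N⌉₊ : ℝ) / (lam * N)) := rfl

theorem log_le_stepFactor (hk : Even k) (hk4 : 4 ≤ k) (N : ℕ) :
    Real.log N / 2 ≤ (k / 2 : ℕ) * stepFactor k d N := by
  have hm : (0 : ℝ) < (k / 2 : ℕ) := by exact_mod_cast (by omega : 0 < k / 2)
  calc Real.log N / 2 = (k / 2 : ℕ) * (Real.log N / k) := by
        rw [cast_eq_two_mul_half hk]; field_simp
    _ ≤ _ := by gcongr; exact le_max_left _ _

theorem rpow_le_stepFactor (hk : Even k) (hk4 : 4 ≤ k) (hkd : k ≤ d) (N : ℕ) :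
    (d : ℝ) ^ ((k : ℝ) / 4 - 1) / 2 ≤ (k / 2 : ℕ) * stepFactor k d N := by
  have hm : (0 : ℝ) < (k / 2 : ℕ) := by exact_mod_cast (by omega : 0 < k / 2)
  have hk4' : (4 : ℝ) ≤ k := by exact_mod_cast hk4
  have hl : 1 ≤ Real.log d := one_le_log (by exact_mod_cast hk4.trans hkd)
  have hl' : 0 < (Real.log d)⁻¹ := by positivity
  have hmax : max ((k : ℝ) * ((k : ℝ) - 4)) (Real.log d)⁻¹ ≤ k * k := by
    refine max_le (by nlinarith) ((inv_le_one_of_one_le₀ hl).trans (by nlinarith))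
  have hmax0 : 0 < max ((k : ℝ) * ((k : ℝ) - 4)) (Real.log d)⁻¹ := lt_max_of_lt_right hl'
  calc (d : ℝ) ^ ((k : ℝ) / 4 - 1) / 2
      = (k / 2 : ℕ) * (k * (d : ℝ) ^ ((k : ℝ) / 4 - 1) / (k * k)) := by
        rw [mul_div_mul_left _ _ (by positivity)]
        rw [cast_eq_two_mul_half hk]; field_simp
    _ ≤ (k / 2 : ℕ) * (k * (d : ℝ) ^ ((k : ℝ) / 4 - 1)
          / max ((k : ℝ) * ((k : ℝ) - 4)) (Real.log d)⁻¹) := by gcongr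
    _ ≤ _ := by gcongr; exact le_max_right _ _

/-- For k = 4 the logarithm comes from the entry 1/log d in the denominator, the other entry being
0; for k ≥ 6 it is dominated by d^(k/4-1) ≥ √d. -/
theorem log_dim_le_stepFactor (hk : Even k) (hk4 : 4 ≤ k) (hkd : k ≤ d) (N : ℕ) :
    Real.log d / 4 ≤ (k / 2 : ℕ) * stepFactor k d N := by
  have hl : 1 ≤ Real.log d := one_le_log (by exact_mod_cast hk4.trans hkd)
  obtain rfl | h6 : k = 4 ∨ 6 ≤ k := by
    obtain ⟨j, rfl⟩ := hk
    omega
  · refine le_trans ?_ (mul_le_mul_of_nonneg_left (le_max_right _ _) (by positivity))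
    norm_num [max_eq_right (inv_nonneg.2 (zero_le_one.trans hl))]
    linarith
  · refine le_trans ?_ (rpow_le_stepFactor hk hk4 hkd N)
    have hd1 : (1 : ℝ) ≤ d := by exact_mod_cast (by omega : 1 ≤ d)
    have h1 : √(d : ℝ) ≤ (d : ℝ) ^ ((k : ℝ) / 4 - 1) := by
      rw [rpow_eq_sqrt_pow hk hk4]
      exact le_self_pow₀ (Real.one_le_sqrt.2 hd1) (by omega)
    linarith [log_le_two_mul_sqrt (by linarith : (0 : ℝ) < d)]

/-- The constant 8 is attained by the second entry at k = 4; for k ≥ 6 the quotient (k/2)/(k - 4) is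
bounded. -/
theorem stepFactor_le (hk : Even k) (hk4 : 4 ≤ k) (hkd : k ≤ d) (N : ℕ) :
    stepFactor k d N ≤ 8 * ((d : ℝ) ^ ((k : ℝ) / 4 - 1)
      * max (Real.log N / (d : ℝ) ^ ((k : ℝ) / 4 - 1)) (Real.log d)) / (k / 2 : ℕ) := by
  have hm : (2 : ℝ) ≤ (k / 2 : ℕ) := by exact_mod_cast (by omega : 2 ≤ k / 2)
  have hl : 1 ≤ Real.log d := one_le_log (by exact_mod_cast hk4.trans hkd)
  have hR : 1 ≤ (d : ℝ) ^ ((k : ℝ) / 4 - 1) := one_le_rpow_quarter_sub hk4 (by omega)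
  have hlogN : 0 ≤ Real.log N := Real.log_natCast_nonneg N
  rw [stepFactor, le_div_iff₀ (by linarith), max_mul_of_nonneg _ _ (by linarith)]
  refine max_le ?_ ?_
  · calc Real.log N / k * (k / 2 : ℕ) = Real.log N / 2 := by
          rw [cast_eq_two_mul_half hk]; field_simp
      _ ≤ 8 * Real.log N := by linarith
      _ = 8 * ((d : ℝ) ^ ((k : ℝ) / 4 - 1) * (Real.log N / (d : ℝ) ^ ((k : ℝ) / 4 - 1))) := by
          rw [mul_div_cancel₀ _ (zero_lt_one.trans_le hR).ne']
      _ ≤ _ := by gcongr; exact le_max_left _ _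
  · refine le_trans ?_ (mul_le_mul_of_nonneg_left (mul_le_mul_of_nonneg_left
      (le_max_right _ _) (by linarith)) (by norm_num))
    obtain rfl | h6 : k = 4 ∨ 6 ≤ k := by
      obtain ⟨j, rfl⟩ := hk
      omega
    · norm_num [max_eq_right (inv_nonneg.2 (zero_le_one.trans hl))]
      linarith
    · have h6' : (6 : ℝ) ≤ k := by exact_mod_cast h6
      have h3 : (k : ℝ) * ((k : ℝ) - 4) ≤ max ((k : ℝ) * ((k : ℝ) - 4)) (Real.log d)⁻¹ :=
        le_max_left _ _
      have h4 : 0 < (k : ℝ) * ((k : ℝ) - 4) := by nlinarith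
      calc k * (d : ℝ) ^ ((k : ℝ) / 4 - 1) / max ((k : ℝ) * ((k : ℝ) - 4)) (Real.log d)⁻¹
              * (k / 2 : ℕ)
          ≤ k * (d : ℝ) ^ ((k : ℝ) / 4 - 1) / (k * ((k : ℝ) - 4)) * (k / 2 : ℕ) := by gcongr
        _ = (d : ℝ) ^ ((k : ℝ) / 4 - 1) * ((k / 2 : ℕ) / ((k : ℝ) - 4)) := by
          rw [mul_div_mul_left _ _ (by linarith)]; ring
        _ ≤ (d : ℝ) ^ ((k : ℝ) / 4 - 1) * (8 * Real.log d) := by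
          gcongr
          rw [div_le_iff₀ (by linarith)]
          have := cast_eq_two_mul_half hk
          nlinarith
        _ = _ := by ring

end Dimension

section Phase
variable {N : ℕ}

theorem two_le_log_nat (hN : 100 ≤ N) : 2 ≤ Real.log N := by
  have h : (100 : ℝ) ≤ N := by exact_mod_cast hN
  rw [Real.le_log_iff_exp_le (by linarith)]
  have h1 : Real.exp 2 = Real.exp 1 ^ 2 := by rw [← Real.exp_nat_mul]; norm_num
  rw [h1]
  nlinarith [Real.exp_one_lt_d9, Real.exp_pos 1]

theorem two_mul_phaseLength_le (hN : 100 ≤ N) : 2 * phaseLength N ≤ N := by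
  have hl := two_le_log_nat hN
  have h : (phaseLength N : ℝ) ≤ N / Real.log N := Nat.floor_le (by positivity)
  have h2 : (N : ℝ) / Real.log N ≤ N / 2 := by gcongr
  exact_mod_cast (by linarith : 2 * (phaseLength N : ℝ) ≤ N)

theorem div_le_phaseLength (hN : 100 ≤ N) : (N : ℝ) / (2 * Real.log N) ≤ phaseLength N := by
  have hl := two_le_log_nat hN
  have hN' : (100 : ℝ) ≤ N := by exact_mod_cast hN
  have h1 := log_le_two_mul_sqrt (by linarith : (0 : ℝ) < N)
  have h2 : 2 * √(N : ℝ) - 2 ≤ N / 2 := by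
    nlinarith [sq_nonneg (√(N : ℝ) - 2), Real.sq_sqrt (by linarith : (0 : ℝ) ≤ N)]
  have h3 : 2 ≤ (N : ℝ) / Real.log N := by
    rw [le_div_iff₀ (by linarith)]; linarith
  have h4 : (N : ℝ) / Real.log N < phaseLength N + 1 := Nat.lt_floor_add_one _
  have h5 : (N : ℝ) / (2 * Real.log N) = N / Real.log N / 2 := by
    rw [mul_comm, div_div]
  rw [h5]
  linarith

theorem half_le_phaseLength_mul_ceil (hN : 100 ≤ N) :
    (N : ℝ) / 2 ≤ phaseLength N * ⌈Real.log N⌉₊ := by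
  have hl := two_le_log_nat hN
  calc (N : ℝ) / 2 = N / (2 * Real.log N) * Real.log N := by field_simp
    _ ≤ _ := by
      gcongr
      exacts [div_le_phaseLength hN, Nat.le_ceil _]

theorem ceil_log_le (hN : 100 ≤ N) : (⌈Real.log N⌉₊ : ℝ) ≤ 2 * Real.log N := by
  have hl := two_le_log_nat hN
  linarith [Nat.ceil_lt_add_one (by linarith : 0 ≤ Real.log N)]

end Phase

section StepSize
variable {k d N : ℕ} {lam η₀ a : ℝ}

/-- The ceiling in `stepOrder` compensates the length of a phase, as their product is at least N/2.
Thus the step size accumulated over one phase is bounded below by the quantities that the alignment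
time requires. -/
theorem mul_stepFactor_le (hN : 100 ≤ N) (hlam : 0 < lam) (ha : 0 ≤ a)
    (h0 : 0 ≤ (k / 2 : ℕ) * stepFactor k d N) (h : a * stepOrder k d N lam ≤ η₀) :
    a / 2 * ((k / 2 : ℕ) * stepFactor k d N)
      ≤ phaseLength N * (lam * (k / 2 : ℕ) * η₀) := by
  have hN0 : (0 : ℝ) < N := by exact_mod_cast (by omega : 0 < N)
  calc a / 2 * ((k / 2 : ℕ) * stepFactor k d N)
      = a * ((k / 2 : ℕ) * stepFactor k d N) * (N / 2) / N := by field_simp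
    _ ≤ a * ((k / 2 : ℕ) * stepFactor k d N) * (phaseLength N * ⌈Real.log N⌉₊) / N := by
      gcongr
      exact half_le_phaseLength_mul_ceil hN
    _ = phaseLength N * (lam * (k / 2 : ℕ) * (a * stepOrder k d N lam)) := by
      rw [stepOrder_eq]; field_simp
    _ ≤ _ := by gcongr

theorem le_of_le_stepOrder (hk : Even k) (hk4 : 4 ≤ k) (hkd : k ≤ d) (hN : 100 ≤ N)
    (hlam : 0 < lam) (ha : 0 ≤ a) (h : η₀ ≤ a * stepOrder k d N lam) :
    η₀ ≤ 16 * a * ((d : ℝ) ^ ((k : ℝ) / 4 - 1)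
      * max (Real.log N / (d : ℝ) ^ ((k : ℝ) / 4 - 1)) (Real.log d)) * Real.log N
        / ((k / 2 : ℕ) * lam * N) := by
  have hN0 : (0 : ℝ) < N := by exact_mod_cast (by omega : 0 < N)
  have hm : (0 : ℝ) < (k / 2 : ℕ) := by exact_mod_cast (by omega : 0 < k / 2)
  have hl := two_le_log_nat hN
  have h1 := stepFactor_le hk hk4 hkd N
  have h0 : 0 ≤ stepFactor k d N := le_max_of_le_left (by positivity)
  refine h.trans ?_
  rw [stepOrder_eq]
  calc a * (stepFactor k d N * ((⌈Real.log N⌉₊ : ℝ) / (lam * N)))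
      ≤ a * (8 * ((d : ℝ) ^ ((k : ℝ) / 4 - 1)
      * max (Real.log N / (d : ℝ) ^ ((k : ℝ) / 4 - 1)) (Real.log d)) / (k / 2 : ℕ)
        * (2 * Real.log N / (lam * N))) := by
        gcongr
        exact ceil_log_le hN
    _ = _ := by field_simp; ring

end StepSize

section Logarithms
variable {k d N : ℕ} {σ δ : ℝ}

/-- As σ may be below 1, log σ can be negative, but σ²N ≥ 1 limits the loss to half of log N. -/
theorem le_logFactor (hk4 : 4 ≤ k) (hd : 0 < d) (hN : 0 < N) (hδ : 0 < δ)
    (hσN : 1 ≤ σ ^ 2 * N) (hσ : 0 < σ) :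
    Real.log 4 + Real.log N / 2 + Real.log d - Real.log δ ≤ logFactor k d N σ δ := by
  have hk4' : (4 : ℝ) ≤ k := by exact_mod_cast hk4
  have hd' : (0 : ℝ) < d := by exact_mod_cast hd
  have hN' : (0 : ℝ) < N := by exact_mod_cast hN
  have h1 : 0 ≤ 2 * Real.log σ + Real.log N := by
    have := Real.log_nonneg hσN
    rwa [Real.log_mul (by positivity) (by positivity), Real.log_pow] at this
  have h2 : Real.log 4 ≤ Real.log k := Real.log_le_log (by norm_num) hk4'
  rw [logFactor, Real.log_div (by positivity) (by positivity),
    Real.log_mul (by positivity) (by positivity), Real.log_mul (by positivity) (by positivity),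
    Real.log_mul (by positivity) (by positivity)]
  linarith

theorem log_union_le (hN : 0 < N) (hd : 0 < d) (hδ : 0 < δ) :
    Real.log (10 * (N + 1) ^ 2 * d ^ 2 / δ)
      ≤ Real.log 40 + 2 * Real.log N + 2 * Real.log d - Real.log δ := by
  have hd' : (0 : ℝ) < d := by exact_mod_cast hd
  have hN' : (1 : ℝ) ≤ N := by exact_mod_cast hN
  have h0 : (0 : ℝ) < N := by linarith
  calc Real.log (10 * (N + 1) ^ 2 * d ^ 2 / δ) ≤ Real.log (40 * N ^ 2 * d ^ 2 / δ) := by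
        refine Real.log_le_log (by positivity) ?_
        gcongr ?_ * _ / _
        nlinarith
    _ = _ := by
        rw [Real.log_div (by positivity) (by positivity), Real.log_mul (by positivity) (by positivity),
          Real.log_mul (by positivity) (by positivity), Real.log_pow, Real.log_pow]
        push_cast
        ring

theorem log_union_nonneg (hd : 0 < d) (hδ : 0 < δ) (hδ1 : δ < 1) :
    0 ≤ Real.log (10 * (N + 1) ^ 2 * d ^ 2 / δ) := by
  have hd' : (1 : ℝ) ≤ d := by exact_mod_cast hd
  have h1 : (1 : ℝ) ≤ (N + 1) ^ 2 := one_le_pow₀ (by linarith [Nat.cast_nonneg (α := ℝ) N])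
  have h2 : (1 : ℝ) ≤ 10 * (N + 1) ^ 2 * d ^ 2 :=
    one_le_mul_of_one_le_of_one_le (by linarith) (one_le_pow₀ hd')
  exact Real.log_nonneg ((one_le_div hδ).2 (by linarith))

end Logarithms

end Parameters
end TensorPCA
end
-- Noise budget and final rate.
noncomputable section
namespace TensorPCA

section Budget
variable {d N m lam σ A G LG L ℓ η C : ℝ}

theorem step_variance_le (hd : 0 < d) (hN : 0 < N) (hm : 0 < m) (hlam : 0 < lam)
    (hσ : 0 < σ) (hA : 0 < A) (hG : 0 < G) (hC : 0 < C) (hη0 : 0 < η)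
    (hη : η ≤ 16 * A * G * LG / (m * lam * N)) (hL : 1 ≤ L) (hLGL : LG ≤ 2 * L)
    (hℓ : 0 ≤ ℓ) (hℓL : ℓ ≤ 4 * L)
    (hS : C * (2 * m * L ^ 3 * (σ * d * G) ^ 2) ≤ N * lam ^ 2) :
    (d * (2 * σ)) ^ 2 * (512 * N * m * η ^ 2 * ℓ) ≤ 2 ^ 22 * A ^ 2 / C / m ^ 2 := by
  calc (d * (2 * σ)) ^ 2 * (512 * N * m * η ^ 2 * ℓ)
      ≤ (d * (2 * σ)) ^ 2 * (512 * N * m * (16 * A * G * (2 * L) / (m * lam * N)) ^ 2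
          * (4 * L)) := by
        have h2 : 16 * A * G * LG / (m * lam * N) ≤ 16 * A * G * (2 * L) / (m * lam * N) := by
          gcongr
        have h3 := hη.trans h2
        gcongr
    _ = 2 ^ 22 * A ^ 2 / C / m ^ 2
          * (C * (2 * m * L ^ 3 * (σ * d * G) ^ 2) / (N * lam ^ 2)) := by
        field_simp
        ring
    _ ≤ 2 ^ 22 * A ^ 2 / C / m ^ 2 * 1 := by
        gcongr
        exact div_le_one_of_le₀ hS (by positivity)
    _ = _ := mul_one _

theorem noise_late_le {cb : ℝ} (hcb : 0 < cb) (hN : 0 < N) (hm : 0 < m)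
    (hC : 0 < C) (hℓ : 0 ≤ ℓ) (hCA : 2 ^ 22 * A ^ 2 / cb ^ 2 ≤ C)
    (h : (d * (2 * σ)) ^ 2 * (512 * N * m * η ^ 2 * ℓ) ≤ 2 ^ 22 * A ^ 2 / C / m ^ 2) :
    d * (2 * σ * √(512 * N * m * η ^ 2 * ℓ)) ≤ cb / m := by
  refine le_of_sq_le_sq ?_ (by positivity)
  calc _ = (d * (2 * σ)) ^ 2 * (512 * N * m * η ^ 2 * ℓ) := by
        rw [← mul_assoc, mul_pow, Real.sq_sqrt (by positivity)]
    _ ≤ 2 ^ 22 * A ^ 2 / C / m ^ 2 := h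
    _ ≤ cb ^ 2 / m ^ 2 := by
      gcongr
      rw [div_le_iff₀ hC]
      rw [div_le_iff₀ (by positivity)] at hCA
      linarith
    _ = _ := by rw [div_pow]

theorem noise_signal_le_late (hd : 1 ≤ d) (hN : 0 < N) (hm : 0 < m) (hσ : 0 < σ) (hℓ : 0 ≤ ℓ) :
    2 * σ * √(32 * N * m * d * η ^ 2 * ℓ) ≤ d * (2 * σ * √(512 * N * m * η ^ 2 * ℓ)) := by
  have hd0 : 0 ≤ d := by linarith
  calc 2 * σ * √(32 * N * m * d * η ^ 2 * ℓ)
      ≤ 2 * σ * √(d ^ 2 * (512 * N * m * η ^ 2 * ℓ)) := by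
        refine mul_le_mul_of_nonneg_left (Real.sqrt_le_sqrt ?_) (by positivity)
        have h1 : 0 ≤ N * m * η ^ 2 * ℓ := by positivity
        have h2 : 32 * d ≤ 512 * d ^ 2 := by nlinarith
        calc _ = 32 * d * (N * m * η ^ 2 * ℓ) := by ring
          _ ≤ 512 * d ^ 2 * (N * m * η ^ 2 * ℓ) := mul_le_mul_of_nonneg_right h2 h1
          _ = _ := by ring
    _ = _ := by
      rw [Real.sqrt_mul (by positivity), Real.sqrt_sq hd0]
      ring

/-- Three powers of L are enough, two from the squared step size and one from the union bound; the
exponent 7/2 leaves a margin. -/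
theorem sample_bound {X R κ : ℝ} (hC : 0 < C) (hlam : 0 < lam) (hκ : 0 ≤ κ) (hL : 1 ≤ L)
    (h : C * (X ^ 2 * (σ ^ 2 * κ * L ^ (7 / 2 : ℝ) / lam ^ 2) * (R ^ 2 * d ^ 2)) ≤ N) :
    C * (κ * L ^ 3 * (σ * d * (R * X)) ^ 2) ≤ N * lam ^ 2 := by
  have h1 : L ^ 3 ≤ L ^ (7 / 2 : ℝ) := by
    rw [← Real.rpow_natCast]
    exact Real.rpow_le_rpow_of_exponent_le hL (by norm_num)
  calc C * (κ * L ^ 3 * (σ * d * (R * X)) ^ 2)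
      ≤ C * (κ * L ^ (7 / 2 : ℝ) * (σ * d * (R * X)) ^ 2) := by gcongr
    _ = C * (X ^ 2 * (σ ^ 2 * κ * L ^ (7 / 2 : ℝ) / lam ^ 2) * (R ^ 2 * d ^ 2)) * lam ^ 2 := by
      field_simp
    _ ≤ N * lam ^ 2 := by gcongr

/-- The left side is σ/(λ√N) times σdG/(λ√N), up to the stated constants and logarithms, and the
sample size makes the second factor at most 1. -/
theorem stationary_variance_le {cb : ℝ} (hcb : 0 < cb) (hd : 0 < d) (hN : 0 < N) (hm : 1 ≤ m)
    (hlam : 0 < lam) (hσ : 0 < σ) (hA : 0 < A) (hG : 0 < G) (hC : 1 ≤ C)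
    (hη : η ≤ 16 * A * G * LG / (m * lam * N)) (hL : 1 ≤ L) (hLGL : LG ≤ 2 * L)
    (hℓ : 0 ≤ ℓ) (hℓL : ℓ ≤ 4 * L)
    (hS : C * (2 * m * L ^ 3 * (σ * d * G) ^ 2) ≤ N * lam ^ 2) :
    d * (64 * σ ^ 2 * (1536 * m * η / (cb * (lam * m)) * ℓ))
      ≤ 12582912 * A / cb * L ^ 2 * (σ / (lam * √N)) := by
  have hm0 : 0 < m := by linarith
  have hY : σ * d * G ≤ √N * lam := by
    have h1 : (σ * d * G) ^ 2 ≤ N * lam ^ 2 := by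
      refine le_trans ?_ hS
      have h2 : 1 ≤ C * (2 * m * L ^ 3) := by
        have : 1 ≤ L ^ 3 := one_le_pow₀ hL
        nlinarith [mul_le_mul hC (mul_le_mul hm this (by norm_num) hm0.le) (by norm_num)
          (by linarith)]
      nlinarith [sq_nonneg (σ * d * G)]
    have h3 : N * lam ^ 2 = (√N * lam) ^ 2 := by rw [mul_pow, Real.sq_sqrt hN.le]
    rw [h3] at h1
    exact le_of_sq_le_sq h1 (by positivity)
  have hs : √N ^ 2 = N := Real.sq_sqrt hN.le
  have hs0 : 0 < √N := Real.sqrt_pos.2 hN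
  calc d * (64 * σ ^ 2 * (1536 * m * η / (cb * (lam * m)) * ℓ))
      ≤ d * (64 * σ ^ 2 * (1536 * m * (16 * A * G * (2 * L) / (1 * lam * N))
          / (cb * (lam * m)) * (4 * L))) := by
        have h2 : 16 * A * G * LG / (m * lam * N) ≤ 16 * A * G * (2 * L) / (1 * lam * N) := by
          gcongr
        have h3 := hη.trans h2
        gcongr
    _ = 12582912 * A / cb * L ^ 2 * (σ / (lam * √N)) * (σ * d * G / (√N * lam)) := by
        field_simp
        rw [hs]
        ring
    _ ≤ 12582912 * A / cb * L ^ 2 * (σ / (lam * √N)) * 1 := by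
        gcongr
        exact div_le_one_of_le₀ hY (by positivity)
    _ = _ := mul_one _

/-- The exponential is at most (Nd)⁻⁴, which beats σ/(λ√N) because λ is at most polynomial in N and
d. -/
theorem transient_le {c₀ C₀ P : ℝ} (hc₀ : 0 < c₀) (hd : 1 ≤ d) (hN : 1 ≤ N) (hlam : 0 < lam)
    (hlam' : lam ≤ C₀ * (N * d)) (hC₀ : 0 < C₀) (hσ : c₀ ≤ σ)
    (hP : 4 * (Real.log N + Real.log d) ≤ P) :
    d * (400 * Real.exp (-P)) ≤ 400 * C₀ / c₀ * (σ / (lam * √N)) := by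
  have hd0 : 0 < d := by linarith
  have hN0 : 0 < N := by linarith
  have hs : √N ≤ N := Real.sqrt_le_iff.2 ⟨hN0.le, by nlinarith⟩
  have hs0 : 0 < √N := Real.sqrt_pos.2 hN0
  have h1 : Real.exp (-P) ≤ ((N * d) ^ 4)⁻¹ := by
    calc Real.exp (-P) ≤ Real.exp (-(4 * (Real.log N + Real.log d))) := by gcongr
      _ = ((N * d) ^ 4)⁻¹ := by
        rw [Real.exp_neg, ← Real.log_mul hN0.ne' hd0.ne']
        congr 1
        have := Real.exp_nat_mul (Real.log (N * d)) 4
        rwa [Real.exp_log (by positivity)] at this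
  calc d * (400 * Real.exp (-P)) ≤ d * (400 * ((N * d) ^ 4)⁻¹) := by gcongr
    _ ≤ 400 * (1 / (N * d * N)) := by
      have : d * (400 * ((N * d) ^ 4)⁻¹) = 400 * (1 / (N * d * N)) * (1 / (N ^ 2 * d ^ 2)) := by
        field_simp
      rw [this]
      refine mul_le_of_le_one_right (by positivity) (div_le_one_of_le₀ ?_ (by positivity))
      exact one_le_mul_of_one_le_of_one_le (one_le_pow₀ hN) (one_le_pow₀ hd)
    _ = 400 * C₀ / c₀ * (c₀ / ((C₀ * (N * d)) * N)) := by field_simp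
    _ ≤ _ := by gcongr; exact hc₀.le.trans hσ

/-- The last term alone suffices since δ < 1; the step-size condition makes the base of the power in
the first term nonnegative. -/
theorem le_errorRate {k d N : ℕ} {lam σ δ η₀ : ℝ} (hlam : 0 < lam) (hσ : 0 < σ) (hδ : 0 < δ)
    (hδ1 : δ < 1) (hN : 0 < N) (h : 0 ≤ 1 - η₀ * lam * k / (2 * Real.exp 1)) :
    σ / (lam * √N) ≤ errorRate k d N lam σ δ η₀ := by
  have hN' : (0 : ℝ) < N := by exact_mod_cast hN
  have h1 : √δ ≤ 1 := Real.sqrt_le_one.2 hδ1.le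
  have h0 : 0 < √δ := Real.sqrt_pos.2 hδ
  have h2 : σ / (lam * √N) ≤ σ / (lam * √δ * √N) := by
    gcongr
    exact mul_le_of_le_one_right hlam.le h1
  have h3 := Real.rpow_nonneg h ((phaseLength N : ℝ) / 2)
  rw [errorRate]
  refine h2.trans (le_add_of_nonneg_left ?_)
  positivity

end Budget
end TensorPCA
end

/-! ### The main theorem: choice of constants. -/

set_option maxHeartbeats 4000000 in
theorem mainTheorem3 (c₀ C₀ : ℝ) (hc₀ : 0 < c₀) (hC₀ : 0 < C₀) :
    ∃ a : ℝ, 0 < a ∧ ∀ A : ℝ, a ≤ A →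
      ∃ (C₁ C₂ : ℝ) (p : ℕ), 0 < C₁ ∧ 0 < C₂ ∧
        ∀ (k d N : ℕ) (lam σ δ η₀ : ℝ),
          Even k → 4 ≤ k → k ≤ d →
          c₀ ≤ lam → lam ≤ C₀ * (d : ℝ) ^ ((k : ℝ) / 4) → c₀ ≤ σ →
          0 < δ → δ < 1 →
          C₁ ≤ N → C₁ * TensorPCA.sampleOrder k d N lam σ δ ≤ N →
          a * TensorPCA.stepOrder k d N lam ≤ η₀ → η₀ ≤ A * TensorPCA.stepOrder k d N lam →
          0 ≤ 1 - η₀ * lam * k / (2 * Real.exp 1) →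
          ∀ (Ω : Type*) [MeasurableSpace Ω] (μ : Measure Ω) [IsProbabilityMeasure μ]
            (vstar : EuclideanSpace ℝ (Fin d)) (E : ℕ → Ω → TensorPCA.Tensor k d)
            (vhat : Ω → EuclideanSpace ℝ (Fin d)),
            ‖vstar‖ = 1 →
            TensorPCA.IsIIDSubGaussianNoise μ N σ E →
            (∀ ω, TensorPCA.IsNSGAOutput η₀ N
              (fun t => TensorPCA.observation lam vstar (E t ω)) (vhat ω)) →
            μ {ω | ¬ min (‖vhat ω - vstar‖ ^ 2) (‖vhat ω + vstar‖ ^ 2)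
                ≤ C₂ * TensorPCA.logFactor k d N σ δ ^ p
                    * TensorPCA.errorRate k d N lam σ δ η₀} ≤ ENNReal.ofReal δ := by
  have hcb := TensorPCA.cosBound_pos
  have hcb27 := TensorPCA.cosBound_le
  set cb := TensorPCA.cosBound
  -- This makes `cb * P ≥ 1000 * F` for the step size P accumulated over a phase, which at once
  -- covers the alignment time, the bound 1/30 on the transient and its final smallness (Nd)⁻⁴.
  refine ⟨2000 / cb, by positivity, fun A hA => ?_⟩
  have hA0 : 0 < A := lt_of_lt_of_le (by positivity) hA
  -- The entries ensure, in this order: noise below the tolerance `cb / m`, σ²N ≥ 1, and log N ≥ 2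
  -- with phases of positive length. The exponent 2 of the logarithm comes from one factor in η₀ and
  -- one in the union bound.
  refine ⟨max (2 ^ 22 * A ^ 2 / cb ^ 2) (max (1 / c₀ ^ 2) 100),
    12582912 * A / cb + 400 * C₀ / c₀, 2, by positivity, by positivity, ?_⟩
  intro k d N lam σ δ η₀ hk hk4 hkd hlam hlam' hσ hδ hδ1 hN hS hη hη' hstep Ω _ μ _ vstar E vhat
    hv hE hout
  set C₁ := max (2 ^ 22 * A ^ 2 / cb ^ 2) (max (1 / c₀ ^ 2) 100)
  have hC1 : 2 ^ 22 * A ^ 2 / cb ^ 2 ≤ C₁ := le_max_left _ _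
  have hC2 : 1 / c₀ ^ 2 ≤ C₁ := (le_max_left _ _).trans (le_max_right _ _)
  have hC3 : 100 ≤ C₁ := (le_max_right _ _).trans (le_max_right _ _)
  have hC0 : 0 < C₁ := by linarith
  have hN100 : 100 ≤ N := by exact_mod_cast hC3.trans hN
  have hNr : (100 : ℝ) ≤ N := by exact_mod_cast hN100
  have hN0 : (0 : ℝ) < N := by linarith
  have hlam0 : 0 < lam := by linarith
  have hσ0 : 0 < σ := by linarith
  have hd4 : (4 : ℝ) ≤ d := by exact_mod_cast hk4.trans hkd
  have hd0 : (0 : ℝ) < d := by linarith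
  have hdN : 0 < d := by omega
  have hm2 : (2 : ℝ) ≤ (k / 2 : ℕ) := by exact_mod_cast (by omega : 2 ≤ k / 2)
  have hkm := TensorPCA.cast_eq_two_mul_half hk
  have hLG := TensorPCA.two_le_log_nat hN100
  have hld : 1 ≤ Real.log d := TensorPCA.one_le_log hd4
  have hR1 := TensorPCA.one_le_rpow_quarter_sub hk4 hdN
  have hRpow := TensorPCA.rpow_eq_sqrt_pow (d := d) hk hk4
  have hf1 := TensorPCA.log_le_stepFactor (d := d) hk hk4 N
  have hf2 := TensorPCA.rpow_le_stepFactor hk hk4 hkd N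
  have hf3 := TensorPCA.log_dim_le_stepFactor hk hk4 hkd N
  have hP0 := TensorPCA.mul_stepFactor_le hN100 hlam0 (by positivity) (by linarith) hη
  have hη0 : 0 < η₀ := by
    refine lt_of_lt_of_le ?_ hη
    rw [TensorPCA.stepOrder_eq]
    have hF : 0 < TensorPCA.stepFactor k d N :=
      pos_of_mul_pos_right (by linarith : 0 < (k / 2 : ℕ) * TensorPCA.stepFactor k d N)
        (by linarith)
    have : 0 < ⌈Real.log N⌉₊ := Nat.ceil_pos.2 (by linarith)
    positivity
  have hηup := TensorPCA.le_of_le_stepOrder hk hk4 hkd hN100 hlam0 hA0.le hη'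
  have hquarter := TensorPCA.rpow_quarter (k := k) hdN
  have hhalf := TensorPCA.rpow_half (k := k) hdN
  set R := (d : ℝ) ^ ((k : ℝ) / 4 - 1) with hR
  set X := max (Real.log N / R) (Real.log d) with hX
  have hX1 : 1 ≤ X := hld.trans (le_max_right _ _)
  set F := (k / 2 : ℕ) * TensorPCA.stepFactor k d N
  set P := (TensorPCA.phaseLength N : ℝ) * (lam * (k / 2 : ℕ) * η₀) with hP
  have hcbP : 1000 * F ≤ cb * P := by
    have h1 := mul_le_mul_of_nonneg_left hP0 hcb.le
    have h2 : cb * (2000 / cb / 2 * F) = 1000 * F := by field_simp; ring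
    linarith
  have hF0 : 0 ≤ F := by linarith
  have hPF : 27000 * F ≤ P := by
    have : 0 ≤ P := by positivity
    nlinarith
  have hs : lam * (k / 2 : ℕ) * η₀ ≤ Real.exp 1 := by
    have h1 : η₀ * lam * k / (2 * Real.exp 1) ≤ 1 := by linarith
    rw [div_le_one (by positivity), hkm] at h1
    linarith
  have hTN := TensorPCA.two_mul_phaseLength_le hN100
  have hT : 0 < TensorPCA.phaseLength N := by
    have h1 : (0 : ℝ) < TensorPCA.phaseLength N :=
      lt_of_lt_of_le (by positivity) (TensorPCA.div_le_phaseLength hN100)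
    exact_mod_cast h1
  -- A phase has at most N/2 steps with parameter at most e, so P ≤ 3N/2, while P is at least a
  -- multiple of R. Hence λ ≤ C₀Nd, as the transient bound requires.
  have hRN : R ≤ N := by
    have h1 : P ≤ N / 2 * 3 := by
      have h2 : (TensorPCA.phaseLength N : ℝ) ≤ N / 2 := by
        have : (2 * TensorPCA.phaseLength N : ℝ) ≤ N := by exact_mod_cast hTN
        linarith
      rw [hP]
      gcongr
      linarith [Real.exp_one_lt_d9]
    linarith
  have hσN : 1 ≤ σ ^ 2 * N := by
    calc (1 : ℝ) = c₀ ^ 2 * (1 / c₀ ^ 2) := by field_simp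
      _ ≤ σ ^ 2 * N := by
        gcongr
        exact hC2.trans hN
  have hL := TensorPCA.le_logFactor hk4 hdN (by omega) hδ hσN hσ0
  have hℓL := TensorPCA.log_union_le (N := N) (by omega) hdN hδ
  have hℓ0 := TensorPCA.log_union_nonneg (N := N) hdN hδ hδ1
  set L := TensorPCA.logFactor k d N σ δ
  set ℓ := Real.log (10 * (N + 1) ^ 2 * d ^ 2 / δ) with hℓ
  have hlδ : Real.log δ ≤ 0 := Real.log_nonpos hδ.le hδ1.le
  have hl4 : 0 ≤ Real.log 4 := Real.log_nonneg (by norm_num)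
  have hl40 : Real.log 40 ≤ 4 * Real.log 4 := by
    have h1 : (4 : ℝ) * Real.log 4 = Real.log (4 ^ 4) := by rw [Real.log_pow]; norm_num
    rw [h1]
    exact Real.log_le_log (by norm_num) (by norm_num)
  have hL1 : 1 ≤ L := by linarith
  have hLGL : Real.log N ≤ 2 * L := by linarith
  have hℓ4 : ℓ ≤ 4 * L := by linarith
  have hq : 0 < 10 * ((N : ℝ) + 1) ^ 2 * d ^ 2 / δ := by positivity
  rw [TensorPCA.sampleOrder, hhalf] at hS
  have hsample : C₁ * (2 * (k / 2 : ℕ) * L ^ 3 * (σ * d * (R * X)) ^ 2) ≤ N * lam ^ 2 := by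
    rw [← hkm]
    exact TensorPCA.sample_bound hC0 hlam0 (by positivity) hL1 hS
  have hvar := TensorPCA.step_variance_le hd0 hN0 (by linarith) hlam0 hσ0 hA0
    (by positivity : 0 < R * X) hC0 hη0 hηup hL1 hLGL hℓ0 hℓ4 hsample
  have hn2 := TensorPCA.noise_late_le hcb hN0 (by linarith) hC0 hℓ0 hC1 hvar
  have hn1 := (TensorPCA.noise_signal_le_late (η := η₀) (by linarith) hN0 (by linarith) hσ0
    hℓ0).trans hn2
  have hπ : Real.exp (-(cb / 6 * P)) ≤ 1 / 30 := by
    have h1 : 29 ≤ cb / 6 * P := by linarith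
    have h2 := Real.add_one_le_exp (cb / 6 * P)
    rw [Real.exp_neg, ← one_div]
    gcongr
    linarith
  obtain ⟨bad, hbad, hgood⟩ := TensorPCA.exists_event_accuracy hE hσ0 hk hk4 hkd hlam0 hv hη0 hℓ0
    hT hTN (by linarith [Real.exp_one_lt_d9]) (by rw [← hRpow]; linarith) (by linarith) hn1 hn2 hπ
  have hmeasure : 10 * ((N : ℝ) + 1) ^ 2 * d ^ 2 * Real.exp (-ℓ) = δ := by
    rw [hℓ, Real.exp_neg, Real.exp_log hq]
    field_simp
  rw [hmeasure] at hbad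
  refine (measure_mono fun ω hω => ?_).trans hbad
  by_contra hω'
  refine hω ((hgood ω hω' _ (hout ω)).trans ?_)
  have hrate := TensorPCA.le_errorRate (δ := δ) (d := d) (N := N) hlam0 hσ0 hδ hδ1 (by omega) hstep
  have h1 := TensorPCA.stationary_variance_le hcb hd0 hN0 (by linarith) hlam0 hσ0 hA0
    (by positivity : 0 < R * X) (by linarith) hηup hL1 hLGL hℓ0 hℓ4 hsample
  have h2 : d * (400 * Real.exp (-(cb / 3 * P))) ≤ 400 * C₀ / c₀ * (σ / (lam * √N)) := by
    refine TensorPCA.transient_le hc₀ (by linarith) (by linarith) hlam0 ?_ hC₀ hσ (by linarith)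
    rw [hquarter] at hlam'
    exact hlam'.trans (by gcongr)
  have hL2 : 1 ≤ L ^ 2 := one_le_pow₀ hL1
  calc d * (400 * Real.exp (-(cb / 3 * P))
        + 64 * σ ^ 2 * (1536 * (k / 2 : ℕ) * η₀ / (cb * (lam * (k / 2 : ℕ))) * ℓ))
      ≤ 400 * C₀ / c₀ * (σ / (lam * √N))
        + 12582912 * A / cb * L ^ 2 * (σ / (lam * √N)) := by
        rw [mul_add]
        exact add_le_add h2 h1
    _ ≤ 400 * C₀ / c₀ * L ^ 2 * (σ / (lam * √N))
        + 12582912 * A / cb * L ^ 2 * (σ / (lam * √N)) := by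
        gcongr
        exact le_mul_of_one_le_right (by positivity) hL2
    _ = (12582912 * A / cb + 400 * C₀ / c₀) * L ^ 2 * (σ / (lam * √N)) := by ring
    _ ≤ _ := by gcongr
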